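/- Let $1<p<\infty$. \textbf{Notation.} Let $(X,\mathcal M,\mu)$ be a measure space and $\mathcal B\subset\mathcal M$ a family of sets with $0<\mu(B)<\infty$ for $B\in\mathcal B$. $\mathcal B$ satisfies the \emph{Besicovitch $D$-condition} ($D\in\mathbb N$) if every $\mathcal A\subset\mathcal B$ has a subcollection $\mathcal A'\subset\mathcal A$ with $\bigcup_{A\in\mathcal A'}A=\bigcup_{A\in\mathcal A}A$ and $\sum_{A\in\mathcal A'}\mathbf 1_A\le D$ everywhere. Write $\langle f\rangle_B=\frac1{\mu(B)}\int_B|f|\,d\mu$ and $\langle f\rangle_B^*=\sup_{A\in\mathcal B,\,A\supset B}\langle f\rangle_A$. A collection $\mathcal S\subset\mathcal B$ is \emph{$\gamma$-sparse} ($0<\gamma<1$) if there are pairwise disjoint measurable sets $E_B\subset B$ ($B\in\mathcal S$) with $\mu(E_B)\ge\gamma\mu(B)$; put $A_{\mathcal S}f=\sum_{B\in\mathcal S}\langle f\rangle_B\mathbf 1_B$. A \emph{weight} is a measurable function $w$ with $0<w<\infty$ a.e.; it is an $A_p$ weight if $$[w]_{A_p}=\sup_{B\in\mathcal B}\Big(\frac1{\mu(B)}\int_B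 w\,d\mu\Big)\Big(\frac1{\mu(B)}\int_B w^{-1/(p-1)}\,d\mu\Big)^{p-1}<\infty .$$ For a measure $\nu$ (extended to all subsets as an outer measure $\nu^*$) and an arbitrary, possibly non-measurable, $g$ put $\|g\|_{L^p(\nu)}=\big(p\int_0^\infty t^{p-1}\nu^*\{|g|>t\}\,dt\big)^{1/p}$. Further, $L^p(w)=L^p(w\,d\mu)$, and $\|T\|_{L^p(w)\to L^p(w)}=\sup_{f\in L^p(w)}\|Tf\|_{L^p(w)}/\|f\|_{L^p(w)}$. $\mathcal B$ is a \emph{ball-basis} with constant $K$ if moreover: any $x,y\in X$ lie in a common $B\in\mathcal B$; for each measurable $E$ and $\varepsilon>0$ there are countably many $B_k\in\mathcal B$ with $\mu(E\,\triangle\bigcup_k B_k)<\varepsilon$; and to each $B\in\mathcal B$ is attached a hull $B^*\in\mathcal B$ with $\mu(B^*)\le K\mu(B)$ that contains every $A\in\mathcal B$ with $A\cap B\ne\varnothing$ and $\mu(A)\le2\mu(B)$. Let $\mathcal B$ be a ball-basis. A map $T$ from $L^1(X)$ to the space of all real functions on $X$ is \emph{subadditive} if $|T(\lambda f)(x)|=|\lambda||Tf(x)|$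 ($\lambda\in\mathbb R$) and $|T(f+g)(x)|\le|Tf(x)|+|Tg(x)|$ for all $x\in X$. A \emph{bounded oscillation (BO) operator} is a subadditive $T$ with finite constants $$L_1=\sup_{B\in\mathcal B}\ \sup_{x,x'\in B,\ f\in L^1}\frac{|T(f\mathbf 1_{X\setminus B^*})(x)-T(f\mathbf 1_{X\setminus B^*})(x')|}{\langle f\rangle_B^*},$$ $$L_2=\sup_{A\in\mathcal B,\,A^*\ne X}\ \inf_{B\in\mathcal B,\,B\supsetneq A}\ \sup_{x\in A,\ f\in L^1}\frac{|T(f\mathbf 1_{B^*\setminus A^*})(x)|}{\langle f\rangle_{B^*}} .$$ It satisfies the \emph{weak-$L^1$ inequality} if $\|T\|_{L^1\to L^{1,\infty}}=\sup_{t>0,\,f\in L^1}t\,\mu^*\{|Tf|>t\}/\|f\|_{L^1}<\infty$. (In all quotients $0/0=0$ and $a/0=\infty$ for $a>0$.) \textbf{Theorem.} (i) There is a constant $c_p$, depending only on $p$, such that if $(X,\mathcal M,\mu)$ is a measure space, $\mathcal B$ is a family of measurable sets of positive finite measure satisfying the Besicovitch $D$-condition, $0<\gamma<1$, $\mathcal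 S\subset\mathcal B$ is $\gamma$-sparse and $w$ is an $A_p$ weight, then $$\|A_{\mathcal S}\|_{L^p(w)\to L^p(w)}\le c_p\,\gamma^{-1}D^{\max\{1/(p-1),\,p-1\}}[w]_{A_p}^{\max\{1,\,1/(p-1)\}} .$$ (ii) For all $K$ and $D$ there is a constant $C$, depending only on $p$, $K$ and $D$, such that if $\mathcal B$ is a ball-basis with constant $K$ of a measure space $(X,\mathcal M,\mu)$ satisfying the Besicovitch $D$-condition, $T$ is a BO operator satisfying the weak-$L^1$ inequality and $w$ is an $A_p$ weight, then $L^p(w)\subset L^1(X)$ and $$\|T\|_{L^p(w)\to L^p(w)}\le C\big(L_1+L_2+\|T\|_{L^1\to L^{1,\infty}}\big)[w]_{A_p}^{\max\{1,\,1/(p-1)\}} .$$ -/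

import Mathlib

open MeasureTheory Set
open scoped ENNReal NNReal

noncomputable section

namespace BallOsc

/-- The average `⟨f⟩_B = μ(B)⁻¹ ∫_B |f| dμ`. -/
def avg {X : Type*} [MeasurableSpace X] (μ : Measure X) (f : X → ℝ) (B : Set X) : ℝ≥0∞ :=
  (∫⁻ x in B, ‖f x‖ₑ ∂μ) / μ B

/-- `⟨f⟩*_B`, the supremum of `⟨f⟩_A` over the members `A ⊇ B` of the family `ℬ`. -/
def maxAvg {X : Type*} [MeasurableSpace X] (μ : Measure X) (ℬ : Set (Set X))
    (f : X → ℝ) (B : Set X) : ℝ≥0∞ :=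
  ⨆ A ∈ ℬ, ⨆ (_ : B ⊆ A), avg μ f A

/-- `ℬ` is a ball-basis of the measure space `(X, μ)`, where `hull B` is the hull `B*` of a ball `B`
and `K` is the constant in `μ(B*) ≤ K μ(B)`. -/
structure IsBallBasis {X : Type*} [MeasurableSpace X] (μ : Measure X) (ℬ : Set (Set X))
    (hull : Set X → Set X) (K : ℝ≥0) : Prop where
  measurableSet : ∀ B ∈ ℬ, MeasurableSet B
  measure_pos : ∀ B ∈ ℬ, 0 < μ B
  measure_lt_top : ∀ B ∈ ℬ, μ B < ∞
  exists_mem_mem : ∀ x y : X, ∃ B ∈ ℬ, x ∈ B ∧ y ∈ B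
  approx : ∀ E : Set X, MeasurableSet E → ∀ ε : ℝ≥0∞, 0 < ε →
    ∃ 𝒜 ⊆ ℬ, 𝒜.Countable ∧ μ (symmDiff E (⋃₀ 𝒜)) < ε
  hull_mem : ∀ B ∈ ℬ, hull B ∈ ℬ
  subset_hull : ∀ B ∈ ℬ, ∀ A ∈ ℬ, μ A ≤ 2 * μ B → (A ∩ B).Nonempty → A ⊆ hull B
  measure_hull_le : ∀ B ∈ ℬ, μ (hull B) ≤ K * μ B

/-- The Besicovitch `D`-condition for a family of sets. -/
def Besicovitch {X : Type*} (ℬ : Set (Set X)) (D : ℕ) : Prop :=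
  ∀ 𝒜 ⊆ ℬ, ∃ 𝒜' ⊆ 𝒜, ⋃₀ 𝒜' = ⋃₀ 𝒜 ∧ ∀ x, {A ∈ 𝒜' | x ∈ A}.encard ≤ D

/-- `𝒮` is a `γ`-sparse subcollection of `ℬ`. -/
def IsSparse {X : Type*} [MeasurableSpace X] (μ : Measure X) (ℬ : Set (Set X)) (γ : ℝ≥0)
    (𝒮 : Set (Set X)) : Prop :=
  𝒮 ⊆ ℬ ∧ ∃ E : Set X → Set X,
    (∀ B ∈ 𝒮, E B ⊆ B ∧ MeasurableSet (E B) ∧ γ * μ B ≤ μ (E B)) ∧ 𝒮.PairwiseDisjoint E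

/-- The operator `A_𝒮 f(x) = ∑_{A ∈ 𝒮} ⟨f⟩_A 1_A(x)`. -/
def sparseOp {X : Type*} [MeasurableSpace X] (μ : Measure X) (𝒮 : Set (Set X))
    (f : X → ℝ) (x : X) : ℝ≥0∞ :=
  ∑' A : 𝒮, (A : Set X).indicator (fun _ => avg μ f A) x

/-- A weight: a measurable function, positive and finite almost everywhere. -/
structure IsWeight {X : Type*} [MeasurableSpace X] (μ : Measure X) (w : X → ℝ≥0∞) : Prop where
  aemeasurable : AEMeasurable w μ
  ae_pos : ∀ᵐ x ∂μ, 0 < w x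
  ae_lt_top : ∀ᵐ x ∂μ, w x < ∞

/-- The characteristic `[w]_{A_p}` of a weight `w` with respect to the family `ℬ`. -/
def apChar {X : Type*} [MeasurableSpace X] (μ : Measure X) (ℬ : Set (Set X)) (p : ℝ)
    (w : X → ℝ≥0∞) : ℝ≥0∞ :=
  ⨆ B ∈ ℬ, ((∫⁻ x in B, w x ∂μ) / μ B) *
    ((∫⁻ x in B, (w x) ^ (-1 / (p - 1)) ∂μ) / μ B) ^ (p - 1)

/-- `w` is a weight satisfying the `A_p` condition with respect to `ℬ`. -/
def IsApWeight {X : Type*} [MeasurableSpace X] (μ : Measure X) (ℬ : Set (Set X)) (p : ℝ)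
    (w : X → ℝ≥0∞) : Prop :=
  IsWeight μ w ∧ apChar μ ℬ p w < ∞

/-- The `L^p(ν)` norm `(p ∫_0^∞ t^{p-1} ν*{g > t} dt)^{1/p}` of an arbitrary, possibly
non-measurable, function `g ≥ 0`. Here `ν*` is the outer measure of `ν`; in Mathlib the value of a
measure at a non-measurable set is its outer measure. -/
def outerLpNorm {X : Type*} [MeasurableSpace X] (p : ℝ) (ν : Measure X) (g : X → ℝ≥0∞) : ℝ≥0∞ :=
  (ENNReal.ofReal p *
    ∫⁻ t in Ioi (0 : ℝ), ENNReal.ofReal (t ^ (p - 1)) * ν {x | ENNReal.ofReal t < g x}) ^ (1 / p)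

/-- The norm `‖T‖_{L^p(ν) → L^p(ν)}` of a map `T` with possibly non-measurable values; in
`ℝ≥0∞`, `a / 0 = ∞` for `a ≠ 0` and `0 / 0 = 0`. -/
def strongNorm {X : Type*} [MeasurableSpace X] (p : ℝ) (ν : Measure X)
    (T : (X → ℝ) → X → ℝ≥0∞) : ℝ≥0∞ :=
  ⨆ (f : X → ℝ) (_ : MemLp f (ENNReal.ofReal p) ν),
    outerLpNorm p ν (T f) / eLpNorm f (ENNReal.ofReal p) ν

/-- `T`, restricted to the integrable functions, is a subadditive operator from `L^1(X)` to the
space of all real functions on `X`. -/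
structure IsSubadditive {X : Type*} [MeasurableSpace X] (μ : Measure X)
    (T : (X → ℝ) → X → ℝ) : Prop where
  abs_smul : ∀ (c : ℝ) (f : X → ℝ), Integrable f μ → ∀ x, |T (c • f) x| = |c| * |T f x|
  abs_add_le : ∀ f g : X → ℝ, Integrable f μ → Integrable g μ →
    ∀ x, |T (f + g) x| ≤ |T f x| + |T g x|

/-- The weak-type norm `‖T‖_{L^1 → L^{1,∞}}`. -/
def weakNorm {X : Type*} [MeasurableSpace X] (μ : Measure X) (T : (X → ℝ) → X → ℝ) : ℝ≥0∞ :=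
  ⨆ (t : ℝ) (_ : 0 < t) (f : X → ℝ) (_ : Integrable f μ),
    ENNReal.ofReal t * μ {x | t < |T f x|} / eLpNorm f 1 μ

/-- The localization constant `L₁(T)`. -/
def locConst {X : Type*} [MeasurableSpace X] (μ : Measure X) (ℬ : Set (Set X))
    (hull : Set X → Set X) (T : (X → ℝ) → X → ℝ) : ℝ≥0∞ :=
  ⨆ B ∈ ℬ, ⨆ x ∈ B, ⨆ x' ∈ B, ⨆ (f : X → ℝ) (_ : Integrable f μ),
    ENNReal.ofReal |T ((hull B)ᶜ.indicator f) x - T ((hull B)ᶜ.indicator f) x'| / maxAvg μ ℬ f B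

/-- The connectivity constant `L₂(T)`: the infimum of the constants `L` such that each ball `A` with
`A* ≠ X` has a ball `B ⊋ A` with `|T(f 1_{B* \ A*})(x)| ≤ L ⟨f⟩_{B*}` for all `x ∈ A` and
`f ∈ L^1(X)`. -/
def connConst {X : Type*} [MeasurableSpace X] (μ : Measure X) (ℬ : Set (Set X))
    (hull : Set X → Set X) (T : (X → ℝ) → X → ℝ) : ℝ≥0∞ :=
  ⨆ A ∈ ℬ, ⨆ (_ : hull A ≠ univ), ⨅ B ∈ ℬ, ⨅ (_ : A ⊂ B),
    ⨆ x ∈ A, ⨆ (f : X → ℝ) (_ : Integrable f μ),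
      ENNReal.ofReal |T ((hull B \ hull A).indicator f) x| / avg μ f (hull B)

/-- `T` is a bounded oscillation operator (on `L^1`) with respect to the ball-basis `ℬ`. -/
structure IsBO {X : Type*} [MeasurableSpace X] (μ : Measure X) (ℬ : Set (Set X))
    (hull : Set X → Set X) (T : (X → ℝ) → X → ℝ) : Prop where
  subadditive : IsSubadditive μ T
  localization : locConst μ ℬ hull T < ∞
  connectivity : connConst μ ℬ hull T < ∞

end BallOsc

end

open BallOsc

universe u

namespace BallOsc

/-! ### Layer cake formula and maximal functions over finite families -/

/-! Part (i). By duality it suffices to bound the bilinear form `sparseForm`, the sum of `⟨f⟩_B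
⟨g⟩_B μ(B)`. For `p = 2` and weights `W`, `V = W⁻¹`, write each average of `f` as an average of `f /
V` with respect to `V dμ` times `⟨V⟩_B`, and treat `g` likewise with `W`. The factors `⟨W⟩_B ⟨V⟩_B`
are at most the characteristic, and `μ(B)` is at most `γ⁻¹ μ(E_B)`, so the form is controlled by the
integral of a product of two maximal functions taken with respect to `V dμ` and `W dμ`. The
Besicovitch condition makes a maximal function bounded for every measure, with a constant that knows
only `D`; hence the linear dependence on the characteristic (`sparseForm_le_two`).

For `p ≥ 2` one extrapolates (`sparseForm_le_of_two_le`). Buckley's bound for the maximal operator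
on `L^q(v)`, where `q = p / (p - 1)` and `v` is the dual weight, feeds the Rubio de Francia
algorithm, which gives a majorant `G` of `g` with `M G ≤ 2 A G`. The weight `G^θ w^(1/(p-1))`, `θ =
(p - 2)/(p - 1)`, then has `A_2` characteristic at most `(2A)^θ Q^(1/(p-1))`. As `A` is linear in
`Q`, this is again linear in `Q`. For `p < 2` the two functions and the two weights are
interchanged. Finite families suffice, since only countably many sets matter and monotone
convergence applies (`meanSum_le`).

Part (ii). The Besicovitch condition forces the whole space to be a ball (`IsBallBasis.univ_mem`);
so `μ` is finite and Hölder's inequality on that ball embeds `L^p(w)` in `L^1`. The operator is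
dominated by a sparse sum (`IsBallBasis.exists_domination`). Write `Q***` for the threefold hull.
Off a small bad set attached to `Q`, both `T(f 1_{Q***})` and the averages of `f 1_{Q***}` are
bounded by a multiple of `⟨f⟩_{Q***}`. Almost every bad point lies in a ball `B` that is maximal
among those at least half of which is bad. Larger balls contain many good points, and oscillation,
connectivity and weak type carry the good bound over to `B`, up to the part of `f` in `A***` for any
ball `A` with `B ⊆ A**`. Repeating the argument with `A` in place of `Q` gives the domination.

The balls `A` must come from one sparse family serving all points
(`IsBallBasis.exists_sparse_family`). They are selected greedily by dyadic size class, disjointly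
within a class, and form a tree whose generations shrink geometrically. Hence the much smaller
members meeting a given `A` cover at most half of it. The remaining parts overlap boundedly rather
than being disjoint, which is why the estimates of part (i) are proved with an overlap bound `N`. -/

theorem lintegral_rpow_layer_of_ne_top {X : Type*} [MeasurableSpace X] (ν : Measure X)
    {g : X → ℝ≥0∞} (hg : Measurable g) (hfin : ∀ x, g x ≠ ∞) {q : ℝ} (hq : 0 < q) :
    ∫⁻ x, g x ^ q ∂ν = ENNReal.ofReal q *
      ∫⁻ t in Ioi (0 : ℝ), ENNReal.ofReal (t ^ (q - 1)) * ν {x | ENNReal.ofReal t < g x} := by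
  have h := lintegral_rpow_eq_lintegral_meas_lt_mul ν (f := fun x => (g x).toReal)
    (Filter.Eventually.of_forall fun _ => ENNReal.toReal_nonneg) hg.ennreal_toReal.aemeasurable hq
  have h1 : ∀ x, ENNReal.ofReal ((g x).toReal ^ q) = g x ^ q := fun x => by
    rw [← ENNReal.ofReal_rpow_of_nonneg ENNReal.toReal_nonneg hq.le, ENNReal.ofReal_toReal (hfin x)]
  simp only [h1] at h
  rw [h]
  congr 1
  refine setLIntegral_congr_fun measurableSet_Ioi fun t ht => ?_
  have : {a | t < (g a).toReal} = {x | ENNReal.ofReal t < g x} := by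
    ext x
    exact (ENNReal.ofReal_lt_iff_lt_toReal (le_of_lt ht) (hfin x)).symm
  rw [this, mul_comm]

/-- The layer cake formula for functions with values in `ℝ≥0∞`. -/
theorem lintegral_rpow_layer {X : Type*} [MeasurableSpace X] (ν : Measure X)
    {g : X → ℝ≥0∞} (hg : Measurable g) {q : ℝ} (hq : 0 < q) :
    ∫⁻ x, g x ^ q ∂ν = ENNReal.ofReal q *
      ∫⁻ t in Ioi (0 : ℝ), ENNReal.ofReal (t ^ (q - 1)) * ν {x | ENNReal.ofReal t < g x} := by
  -- Infinite values either form a null set, and may be replaced by zero, or make both sides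
  -- infinite; for the right-hand side this is seen by truncating `g` at `n` and letting `n` grow.
  by_cases h0 : ν {x | g x = ∞} = 0
  · set g' : X → ℝ≥0∞ := fun x => if g x = ∞ then 0 else g x with hg'
    have hm : Measurable g' :=
      Measurable.ite (hg (measurableSet_singleton _)) measurable_const hg
    have hae : g =ᵐ[ν] g' := by
      have : ∀ᵐ x ∂ν, g x ≠ ∞ := by
        rw [ae_iff]; simpa using h0
      filter_upwards [this] with x hx
      simp [hg', hx]
    have h := lintegral_rpow_layer_of_ne_top ν hm (fun x => by
      simp only [hg']; split_ifs with h <;> simp [h]) hq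
    have e1 : ∫⁻ x, g x ^ q ∂ν = ∫⁻ x, g' x ^ q ∂ν :=
      lintegral_congr_ae (by filter_upwards [hae] with x hx; rw [hx])
    rw [e1, h]
    congr 1
    refine lintegral_congr fun t => ?_
    congr 1
    refine measure_congr ?_
    filter_upwards [hae] with x hx
    simp only [eq_iff_iff]
    change (ENNReal.ofReal t < g' x) ↔ (ENNReal.ofReal t < g x)
    rw [hx]
  · have hS : MeasurableSet {x | g x = ∞} := hg (measurableSet_singleton _)
    have hL : ∫⁻ x, g x ^ q ∂ν = ∞ := by
      refine top_unique ?_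
      calc ∞ = ∞ * ν {x | g x = ∞} := (ENNReal.top_mul h0).symm
        _ = ∫⁻ x in {x | g x = ∞}, ∞ ∂ν := by rw [setLIntegral_const]
        _ ≤ ∫⁻ x in {x | g x = ∞}, g x ^ q ∂ν := by
            refine setLIntegral_mono' hS fun x hx => ?_
            rw [show g x = ∞ from hx, ENNReal.top_rpow_of_pos hq]
        _ ≤ _ := setLIntegral_le_lintegral _ _
    rw [hL]
    symm
    have hn : ∀ n : ℕ, (n : ℝ≥0∞) ^ q * ν {x | g x = ∞} ≤ ENNReal.ofReal q *
        ∫⁻ t in Ioi (0 : ℝ), ENNReal.ofReal (t ^ (q - 1)) * ν {x | ENNReal.ofReal t < g x} := by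
      intro n
      calc (n : ℝ≥0∞) ^ q * ν {x | g x = ∞}
          = ∫⁻ x in {x | g x = ∞}, (n : ℝ≥0∞) ^ q ∂ν := by rw [setLIntegral_const]
        _ ≤ ∫⁻ x in {x | g x = ∞}, (min (g x) n) ^ q ∂ν := by
            refine setLIntegral_mono' hS fun x hx => ?_
            rw [show g x = ∞ from hx]; simp
        _ ≤ ∫⁻ x, (min (g x) n) ^ q ∂ν := setLIntegral_le_lintegral _ _
        _ = _ := lintegral_rpow_layer_of_ne_top ν (hg.min measurable_const)
            (fun x => ne_top_of_le_ne_top (ENNReal.natCast_ne_top n) (min_le_right _ _)) hq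
        _ ≤ _ := by
            gcongr with t x
            exact min_le_left _ _
    have hlim : Filter.Tendsto (fun n : ℕ => (n : ℝ≥0∞) ^ q * ν {x | g x = ∞}) Filter.atTop
        (nhds (∞ * ν {x | g x = ∞})) := by
      refine ENNReal.Tendsto.mul_const ?_ (Or.inl ENNReal.top_ne_zero)
      have := (ENNReal.continuous_rpow_const (y := q)).tendsto ∞
      rw [ENNReal.top_rpow_of_pos hq] at this
      exact this.comp ENNReal.tendsto_nat_nhds_top
    rw [ENNReal.top_mul h0] at hlim
    exact top_unique (le_of_tendsto' hlim hn)

/-- The average of `f` over `B`, with respect to `ν`. -/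
noncomputable def mean {X : Type*} [MeasurableSpace X] (ν : Measure X) (f : X → ℝ≥0∞) (B : Set X) :
    ℝ≥0∞ :=
  (∫⁻ x in B, f x ∂ν) / ν B

/-- The maximal function over an indexed family of sets. -/
noncomputable def maxFun {X ι : Type*} [MeasurableSpace X] (ν : Measure X) (B : ι → Set X)
    (f : X → ℝ≥0∞) (x : X) : ℝ≥0∞ :=
  ⨆ i, (B i).indicator (fun _ => mean ν f (B i)) x

/-- Finite subfamilies have subfamilies with the same union that cover no point more than `D`
times. -/
def Overlap {X ι : Type*} (B : ι → Set X) (D : ℕ) : Prop :=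
  ∀ J : Finset ι, ∃ J' ⊆ J, (⋃ i ∈ J, B i) ⊆ (⋃ i ∈ J', B i) ∧
    ∀ x, ∑ i ∈ J', (B i).indicator (fun _ => (1 : ℝ≥0∞)) x ≤ D

section Finite

variable {X ι : Type*} [MeasurableSpace X] {B : ι → Set X}

theorem mean_mono (ν : Measure X) {f g : X → ℝ≥0∞} (h : ∀ x, f x ≤ g x) (A : Set X) :
    mean ν f A ≤ mean ν g A := by
  unfold mean; gcongr; exact h _

theorem mean_const_le (ν : Measure X) (c : ℝ≥0∞) (A : Set X) : mean ν (fun _ => c) A ≤ c := by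
  unfold mean
  rw [setLIntegral_const]
  exact ENNReal.div_le_of_le_mul le_rfl

theorem mean_le_maxFun (ν : Measure X) (f : X → ℝ≥0∞) {i : ι} {x : X} (hx : x ∈ B i) :
    mean ν f (B i) ≤ maxFun ν B f x := by
  refine le_trans ?_ (le_iSup _ i)
  rw [indicator_of_mem hx]

theorem maxFun_le {ν : Measure X} {f : X → ℝ≥0∞} {x : X} {c : ℝ≥0∞}
    (h : ∀ i, x ∈ B i → mean ν f (B i) ≤ c) : maxFun ν B f x ≤ c := by
  refine iSup_le fun i => ?_
  by_cases hx : x ∈ B i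
  · rw [indicator_of_mem hx]; exact h i hx
  · rw [indicator_of_notMem hx]; exact zero_le

theorem measurable_maxFun [Countable ι] (ν : Measure X) (hB : ∀ i, MeasurableSet (B i))
    (f : X → ℝ≥0∞) : Measurable (maxFun ν B f) :=
  Measurable.iSup fun i => measurable_const.indicator (hB i)

theorem maxFun_mono (ν : Measure X) {f g : X → ℝ≥0∞} (h : ∀ x, f x ≤ g x) (x : X) :
    maxFun ν B f x ≤ maxFun ν B g x :=
  maxFun_le fun _ hx => (mean_mono ν h _).trans (mean_le_maxFun ν g hx)

theorem maxFun_add_const_le (ν : Measure X) {f : X → ℝ≥0∞} (hf : Measurable f) (c : ℝ≥0∞) (x : X) :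
    maxFun ν B (fun y => f y + c) x ≤ maxFun ν B f x + c := by
  refine maxFun_le fun i hx => ?_
  have : mean ν (fun y => f y + c) (B i) = mean ν f (B i) + mean ν (fun _ => c) (B i) := by
    unfold mean
    rw [lintegral_add_left hf, ENNReal.add_div]
  rw [this]
  exact add_le_add (mean_le_maxFun ν f hx) (mean_const_le ν c _)

theorem sum_setLIntegral_le (ν : Measure X) (hB : ∀ i, MeasurableSet (B i)) {f : X → ℝ≥0∞}
    (hf : Measurable f) {J : Finset ι} {D : ℝ≥0∞}
    (hD : ∀ x, ∑ i ∈ J, (B i).indicator (fun _ => (1 : ℝ≥0∞)) x ≤ D) :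
    ∑ i ∈ J, ∫⁻ x in B i, f x ∂ν ≤ D * ∫⁻ x, f x ∂ν := by
  calc ∑ i ∈ J, ∫⁻ x in B i, f x ∂ν
      = ∑ i ∈ J, ∫⁻ x, (B i).indicator (fun _ => (1 : ℝ≥0∞)) x * f x ∂ν := by
        refine Finset.sum_congr rfl fun i _ => ?_
        rw [← lintegral_indicator (hB i)]
        refine lintegral_congr fun x => ?_
        by_cases hx : x ∈ B i <;> simp [hx]
    _ = ∫⁻ x, (∑ i ∈ J, (B i).indicator (fun _ => (1 : ℝ≥0∞)) x) * f x ∂ν := by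
        rw [← lintegral_finsetSum]
        · simp_rw [Finset.sum_mul]
        · exact fun i _ => (measurable_const.indicator (hB i)).mul hf
    _ ≤ ∫⁻ x, D * f x ∂ν := lintegral_mono fun x => by gcongr; exact hD x
    _ = _ := lintegral_const_mul _ hf

/-- The weak type inequality for the maximal function. -/
theorem weak_maxFun [Finite ι] (ν : Measure X) (hB : ∀ i, MeasurableSet (B i)) {D : ℕ}
    (hD : Overlap B D) {f : X → ℝ≥0∞} (hf : Measurable f) (t : ℝ≥0∞) :
    t * ν {x | t < maxFun ν B f x} ≤ D * ∫⁻ x, f x ∂ν := by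
  classical
  have := Fintype.ofFinite ι
  -- The sets with mean above `t` cover the level set. Thinning them to overlap `D` without changing
  -- the union replaces a covering lemma, so nothing like doubling is asked of `ν`.
  obtain ⟨J', hJ', hU, hJD⟩ := hD (Finset.univ.filter fun i => t < mean ν f (B i))
  have hsub : {x | t < maxFun ν B f x} ⊆ ⋃ i ∈ J', B i := by
    intro x hx
    refine hU ?_
    obtain ⟨i, hi⟩ := lt_iSup_iff.1 (show t < ⨆ i, _ from hx)
    by_cases hxi : x ∈ B i
    · rw [indicator_of_mem hxi] at hi
      simp only [mem_iUnion]
      exact ⟨i, by simpa using hi, hxi⟩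
    · rw [indicator_of_notMem hxi] at hi
      exact absurd hi not_lt_zero
  calc t * ν {x | t < maxFun ν B f x} ≤ t * ∑ i ∈ J', ν (B i) := by
        gcongr
        exact (measure_mono hsub).trans (measure_biUnion_finset_le _ _)
    _ = ∑ i ∈ J', t * ν (B i) := Finset.mul_sum _ _ _
    _ ≤ ∑ i ∈ J', ∫⁻ x in B i, f x ∂ν := by
        refine Finset.sum_le_sum fun i hi => ENNReal.mul_le_of_le_div ?_
        exact (Finset.mem_filter.1 (hJ' hi)).2.le
    _ ≤ _ := sum_setLIntegral_le ν hB hf hJD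

/-- The strong type inequality for the maximal function. -/
theorem strong_maxFun [Finite ι] (ν : Measure X) (hB : ∀ i, MeasurableSet (B i)) {D : ℕ}
    (hD : Overlap B D) {q : ℝ} (hq : 1 < q) {f : X → ℝ≥0∞} (hf : Measurable f) :
    ∫⁻ x, maxFun ν B f x ^ q ∂ν ≤
      ENNReal.ofReal (2 ^ q * q / (q - 1)) * D * ∫⁻ x, f x ^ q ∂ν := by
  have hq0 : 0 < q := by linarith
  have hM := measurable_maxFun ν hB f
  -- Truncation: off `S` one has `f ≤ t / 2`, so the maximal function of `f` exceeds `t` only where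
  -- that of `f 1_S` exceeds `t / 2`. Writing the integral of `f` over `S` as a measure of density
  -- `f` makes the later integration in `t` a layer cake formula with exponent `q - 1`.
  have key : ∀ t : ℝ, 0 < t → ENNReal.ofReal t * ν {x | ENNReal.ofReal t < maxFun ν B f x} ≤
      2 * D * (ν.withDensity f) {x | ENNReal.ofReal t < 2 * f x} := by
    intro t ht
    set s : ℝ≥0∞ := ENNReal.ofReal (t / 2)
    have hs2 : ENNReal.ofReal t = 2 * s := by
      rw [show (2 : ℝ≥0∞) = ENNReal.ofReal 2 by simp, ← ENNReal.ofReal_mul (by norm_num)]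
      congr 1; ring
    set S := {x | ENNReal.ofReal t < 2 * f x}
    have hS : MeasurableSet S := measurableSet_lt measurable_const (hf.const_mul _)
    have hsub : {x | ENNReal.ofReal t < maxFun ν B f x} ⊆
        {x | s < maxFun ν B (S.indicator f) x} := by
      intro x hx
      by_contra hcon
      have h1 : maxFun ν B f x ≤ maxFun ν B (fun y => S.indicator f y + s) x := by
        refine maxFun_mono ν (fun y => ?_) x
        by_cases hy : y ∈ S
        · rw [indicator_of_mem hy]; exact le_self_add
        · rw [indicator_of_notMem hy, zero_add]
          have : 2 * f y ≤ 2 * s := by rw [← hs2]; exact not_lt.1 hy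
          exact (ENNReal.mul_le_mul_iff_right (by norm_num) (by norm_num)).1 this
      have h2 := maxFun_add_const_le (B := B) ν (hf.indicator hS) s x
      have h3 : maxFun ν B (S.indicator f) x + s ≤ s + s := by gcongr; exact not_lt.1 hcon
      refine absurd (lt_of_lt_of_le hx (h1.trans (h2.trans h3))) ?_
      rw [hs2, two_mul]; exact lt_irrefl _
    calc ENNReal.ofReal t * ν {x | ENNReal.ofReal t < maxFun ν B f x}
        ≤ 2 * (s * ν {x | s < maxFun ν B (S.indicator f) x}) := by
          rw [hs2, mul_assoc]; rw [hs2] at hsub; gcongr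
      _ ≤ 2 * (D * ∫⁻ x, S.indicator f x ∂ν) := by
          exact mul_le_mul' le_rfl (weak_maxFun ν hB hD (hf.indicator hS) s)
      _ = _ := by rw [lintegral_indicator hS, withDensity_apply _ hS, mul_assoc]
  calc ∫⁻ x, maxFun ν B f x ^ q ∂ν
      = ENNReal.ofReal q * ∫⁻ t in Ioi (0 : ℝ), ENNReal.ofReal (t ^ (q - 1)) *
          ν {x | ENNReal.ofReal t < maxFun ν B f x} := lintegral_rpow_layer ν hM hq0
    _ ≤ ENNReal.ofReal q * ∫⁻ t in Ioi (0 : ℝ), (2 * D) * (ENNReal.ofReal (t ^ (q - 1 - 1)) *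
          (ν.withDensity f) {x | ENNReal.ofReal t < 2 * f x}) := by
        gcongr ENNReal.ofReal q * ?_
        refine setLIntegral_mono' measurableSet_Ioi fun t ht => ?_
        have ht : 0 < t := ht
        rw [Real.rpow_sub_one ht.ne' (q - 1), div_eq_mul_inv,
          ENNReal.ofReal_mul (by positivity)]
        have h3 : ν {x | ENNReal.ofReal t < maxFun ν B f x} ≤ ENNReal.ofReal t⁻¹ *
            (2 * D * (ν.withDensity f) {x | ENNReal.ofReal t < 2 * f x}) := by
          have h4 : ENNReal.ofReal t⁻¹ * (ENNReal.ofReal t *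
              ν {x | ENNReal.ofReal t < maxFun ν B f x}) =
              ν {x | ENNReal.ofReal t < maxFun ν B f x} := by
            rw [← mul_assoc, ← ENNReal.ofReal_mul (by positivity), inv_mul_cancel₀ ht.ne']
            simp
          rw [← h4]
          exact mul_le_mul' le_rfl (key t ht)
        calc _ ≤ ENNReal.ofReal (t ^ (q - 1)) * (ENNReal.ofReal t⁻¹ *
            (2 * D * (ν.withDensity f) {x | ENNReal.ofReal t < 2 * f x})) := by gcongr
          _ = _ := by ring
    _ = ENNReal.ofReal q * ((2 * D) * ∫⁻ t in Ioi (0 : ℝ), (ENNReal.ofReal (t ^ (q - 1 - 1)) *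
          (ν.withDensity f) {x | ENNReal.ofReal t < 2 * f x})) := by
        rw [lintegral_const_mul' _ _ (by finiteness)]
    _ = ENNReal.ofReal (2 ^ q * q / (q - 1)) * D * ∫⁻ x, f x ^ q ∂ν := by
        have h1 := lintegral_rpow_layer (ν.withDensity f) (hf.const_mul 2) (q := q - 1) (by linarith)
        have h2 : ∫⁻ x, (2 * f x) ^ (q - 1) ∂(ν.withDensity f) =
            ENNReal.ofReal (2 ^ (q - 1)) * ∫⁻ x, f x ^ q ∂ν := by
          rw [lintegral_withDensity_eq_lintegral_mul _ hf ((hf.const_mul 2).pow_const _),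
            ← lintegral_const_mul _ (hf.pow_const _)]
          refine lintegral_congr fun x => ?_
          rw [Pi.mul_apply, ENNReal.mul_rpow_of_nonneg _ _ (by linarith),
            ← ENNReal.ofReal_rpow_of_pos (by norm_num)]
          simp only [ENNReal.ofReal_ofNat]
          rw [mul_left_comm]
          congr 1
          have : f x ^ q = f x ^ (1 + (q - 1)) := by congr 1; ring
          rw [this, ENNReal.rpow_add_of_nonneg _ _ (by norm_num) (by linarith), ENNReal.rpow_one]
        rw [h2] at h1
        set I := ∫⁻ t in Ioi (0 : ℝ), (ENNReal.ofReal (t ^ (q - 1 - 1)) *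
          (ν.withDensity f) {x | ENNReal.ofReal t < 2 * f x})
        have hI : I = ENNReal.ofReal (q - 1)⁻¹ *
            (ENNReal.ofReal (2 ^ (q - 1)) * ∫⁻ x, f x ^ q ∂ν) := by
          rw [h1, ← mul_assoc, ← ENNReal.ofReal_mul (by rw [inv_nonneg]; linarith),
            inv_mul_cancel₀ (by linarith)]
          simp
        rw [hI]
        have h5 : ENNReal.ofReal (2 ^ q * q / (q - 1)) = ENNReal.ofReal q * 2 *
            ENNReal.ofReal (q - 1)⁻¹ * ENNReal.ofReal (2 ^ (q - 1)) := by
          rw [show (2 : ℝ≥0∞) = ENNReal.ofReal 2 by simp, ← ENNReal.ofReal_mul hq0.le,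
            ← ENNReal.ofReal_mul (by positivity), ← ENNReal.ofReal_mul
              (mul_nonneg (by positivity) (by rw [inv_nonneg]; linarith))]
          congr 1
          rw [Real.rpow_sub_one (by norm_num)]
          field_simp
        rw [h5]
        ring

end Finite

/-! ### Weighted bounds over finite families -/

/-- `w` and `v = w ^ (-1 / (p - 1))` are measurable, positive and finite functions. -/
structure IsDualPair {X : Type*} [MeasurableSpace X] (p : ℝ) (w v : X → ℝ≥0∞) : Prop where
  measurable : Measurable w
  pos : ∀ x, w x ≠ 0
  ne_top : ∀ x, w x ≠ ∞
  dual : ∀ x, v x = w x ^ (-1 / (p - 1))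

/-- The norm constant of the maximal function. -/
noncomputable def maxConst (q : ℝ) : ℝ := 2 ^ q * q / (q - 1)

theorem maxConst_pos {q : ℝ} (hq : 1 < q) : 0 < maxConst q := by
  unfold maxConst
  have : 0 < q - 1 := by linarith
  have : 0 < q := by linarith
  positivity

section Finite

variable {X ι : Type*} [MeasurableSpace X] {B : ι → Set X} {μ : Measure X}

theorem IsDualPair.symm {p : ℝ} (hp : 1 < p) {w v : X → ℝ≥0∞} (h : IsDualPair p w v) :
    IsDualPair (p / (p - 1)) v w := by
  have hv : v = fun x => w x ^ (-1 / (p - 1)) := funext h.dual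
  have hp1 : p - 1 ≠ 0 := by linarith
  refine ⟨hv ▸ h.measurable.pow_const _, fun x => ?_, fun x => ?_, fun x => ?_⟩
  · rw [h.dual]
    exact (ENNReal.rpow_pos (pos_iff_ne_zero.2 (h.pos x)) (h.ne_top x)).ne'
  · rw [h.dual]
    exact ENNReal.rpow_ne_top_of_ne_zero (h.pos x) (h.ne_top x)
  · rw [h.dual, ← ENNReal.rpow_mul]
    have : -1 / (p - 1) * (-1 / (p / (p - 1) - 1)) = 1 := by
      have h2 : p / (p - 1) - 1 = 1 / (p - 1) := by field_simp; ring
      rw [h2]; field_simp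
    rw [this, ENNReal.rpow_one]

theorem setLIntegral_withDensity {w f : X → ℝ≥0∞} (hw : Measurable w) (hf : Measurable f)
    {A : Set X} (hA : MeasurableSet A) :
    ∫⁻ x in A, f x ∂(μ.withDensity w) = ∫⁻ x in A, w x * f x ∂μ :=
  setLIntegral_withDensity_eq_setLIntegral_mul μ hw hf hA

theorem lintegral_withDensity {w f : X → ℝ≥0∞} (hw : Measurable w) (hf : Measurable f) :
    ∫⁻ x, f x ∂(μ.withDensity w) = ∫⁻ x, w x * f x ∂μ :=
  lintegral_withDensity_eq_lintegral_mul μ hw hf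

theorem mean_ne_zero {w : X → ℝ≥0∞} (hw : Measurable w) (h0 : ∀ x, w x ≠ 0) {A : Set X}
    (hA : 0 < μ A) (hA' : μ A < ∞) : mean μ w A ≠ 0 := by
  unfold mean
  refine (ENNReal.div_pos ?_ hA'.ne).ne'
  rw [← pos_iff_ne_zero, setLIntegral_pos_iff hw]
  have : Function.support w = univ := by ext x; simp [h0 x]
  rwa [this, univ_inter]

/-- Change of measure, `f dμ = (f / w) w dμ`. It trades means with respect to `μ` for means with
respect to a weighted measure, whose maximal function has a norm independent of the weight. -/
theorem mean_withDensity {w f : X → ℝ≥0∞} (hw : Measurable w) (hf : Measurable f)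
    (h0 : ∀ x, w x ≠ 0) (ht : ∀ x, w x ≠ ∞) {A : Set X} (hA : MeasurableSet A)
    (hA0 : 0 < μ A) (hA' : μ A < ∞) (hm : mean μ w A ≠ ∞) :
    mean μ f A = mean (μ.withDensity w) (fun x => f x / w x) A * mean μ w A := by
  have hI : ∫⁻ x in A, w x ∂μ ≠ 0 := fun h => mean_ne_zero hw h0 hA0 hA' (by simp [mean, h])
  have hI' : ∫⁻ x in A, w x ∂μ ≠ ∞ := fun h => hm (by simp [mean, h, ENNReal.top_div, hA'.ne])
  have hfw : Measurable fun x => f x / w x := hf.div hw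
  unfold mean
  rw [setLIntegral_withDensity hw hfw hA, withDensity_apply _ hA]
  have : ∀ x, w x * (f x / w x) = f x := fun x => ENNReal.mul_div_cancel (h0 x) (ht x)
  simp_rw [this]
  rw [← mul_div_assoc, ENNReal.div_mul_cancel hI hI']

/-- Neither factor of a finite product can be infinite when the other is nonzero. Applied to the
`A_p` product, it gives local integrability of both weights. -/
theorem mean_ne_top_of_mul {a b Q : ℝ≥0∞} {s : ℝ} (hs : 0 < s) (h : a * b ^ s ≤ Q) (hQ : Q ≠ ∞)
    (ha : a ≠ 0) (hb : b ≠ 0) : a ≠ ∞ ∧ b ≠ ∞ := by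
  constructor
  · rintro rfl
    have : b ^ s ≠ 0 := by simp [ENNReal.rpow_eq_zero_iff, hb, hs.not_gt]
    rw [ENNReal.top_mul this] at h
    exact hQ (top_unique h)
  · rintro rfl
    rw [ENNReal.top_rpow_of_pos hs, ENNReal.mul_top ha] at h
    exact hQ (top_unique h)

/-- Buckley's bound for the maximal function on `L^q(u)`, by Lerner's argument. -/
theorem buckley [Finite ι] (hB : ∀ i, MeasurableSet (B i)) (hB0 : ∀ i, 0 < μ (B i))
    (hBt : ∀ i, μ (B i) < ∞) {D : ℕ} (hD : Overlap B D) {q : ℝ} (hq : 1 < q)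
    {u v : X → ℝ≥0∞} (huv : IsDualPair q u v) {Q : ℝ≥0∞} (hQt : Q ≠ ∞)
    (hQ : ∀ i, mean μ u (B i) * mean μ v (B i) ^ (q - 1) ≤ Q) {f : X → ℝ≥0∞} (hf : Measurable f) :
    ∫⁻ x, maxFun μ B f x ^ q ∂(μ.withDensity u) ≤
      ENNReal.ofReal (maxConst (q / (q - 1)) * maxConst q) * (D : ℝ≥0∞) ^ (2 : ℝ) *
        Q ^ (q / (q - 1)) * ∫⁻ x, f x ^ q ∂(μ.withDensity u) := by
  have hq1 : 0 < q - 1 := by linarith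
  have hq'1 : 1 < q / (q - 1) := by rw [lt_div_iff₀ hq1]; linarith
  have hvu := huv.symm hq
  have hum := huv.measurable
  have hvm := hvu.measurable
  set N : X → ℝ≥0∞ := maxFun (μ.withDensity v) B (fun x => f x / v x) with hN
  have hNm : Measurable N := measurable_maxFun _ hB _
  set h : X → ℝ≥0∞ := fun x => N x ^ (q - 1) / u x with hh
  have hhm : Measurable h := (hNm.pow_const _).div hum
  have hfv : Measurable fun x => f x / v x := hf.div hvm
  -- With `N` the maximal function of `f / v` for `v dμ`, one has `⟨f⟩^(q-1) ≤ ⟨v⟩^(q-1) ⟨N^(q-1)⟩`,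
  -- and the last mean is `⟨u⟩` times a mean of `h = N^(q-1) / u` for `u dμ`. The product of `⟨u⟩`
  -- and `⟨v⟩^(q-1)` is at most `Q`.
  have hpt : ∀ x, maxFun μ B f x ≤
      (Q * maxFun (μ.withDensity u) B h x) ^ (1 / (q - 1)) := by
    intro x
    refine maxFun_le fun i hx => ?_
    have hu0 := mean_ne_zero hum huv.pos (hB0 i) (hBt i)
    have hv0 := mean_ne_zero hvm hvu.pos (hB0 i) (hBt i)
    obtain ⟨hut, hvt⟩ := mean_ne_top_of_mul hq1 (hQ i) hQt hu0 hv0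
    have h1 := mean_withDensity hvm hf hvu.pos hvu.ne_top (hB i) (hB0 i) (hBt i) hvt
    set m := mean (μ.withDensity v) (fun x => f x / v x) (B i) with hm
    have h2 : m ^ (q - 1) ≤ mean μ (fun x => N x ^ (q - 1)) (B i) := by
      unfold mean
      rw [ENNReal.le_div_iff_mul_le (Or.inl (hB0 i).ne') (Or.inl (hBt i).ne), ← setLIntegral_const]
      refine setLIntegral_mono' (hB i) fun y hy => ?_
      exact ENNReal.rpow_le_rpow (mean_le_maxFun _ _ hy) hq1.le
    have h3 := mean_withDensity (f := fun x => N x ^ (q - 1)) hum (hNm.pow_const _) huv.pos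
      huv.ne_top (hB i) (hB0 i) (hBt i) hut
    have h4 : mean μ f (B i) ^ (q - 1) ≤ Q * maxFun (μ.withDensity u) B h x := by
      calc mean μ f (B i) ^ (q - 1) = m ^ (q - 1) * mean μ v (B i) ^ (q - 1) := by
            rw [h1, ENNReal.mul_rpow_of_nonneg _ _ hq1.le]
        _ ≤ (mean (μ.withDensity u) h (B i) * mean μ u (B i)) * mean μ v (B i) ^ (q - 1) := by
            gcongr; exact h2.trans h3.le
        _ = (mean μ u (B i) * mean μ v (B i) ^ (q - 1)) * mean (μ.withDensity u) h (B i) := by ring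
        _ ≤ _ := mul_le_mul' (hQ i) (mean_le_maxFun _ _ hx)
    calc mean μ f (B i) = (mean μ f (B i) ^ (q - 1)) ^ (1 / (q - 1)) := by
          rw [← ENNReal.rpow_mul, mul_one_div_cancel hq1.ne', ENNReal.rpow_one]
      _ ≤ _ := ENNReal.rpow_le_rpow h4 (by positivity)
  have hMh : Measurable (maxFun (μ.withDensity u) B h) := measurable_maxFun _ hB _
  have hQ't : Q ^ (q / (q - 1)) ≠ ∞ := ENNReal.rpow_ne_top_of_nonneg (by positivity) hQt
  -- The two weighted maximal bounds, in `L^(q/(q-1))(u)` and in `L^q(v)`, chain together because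
  -- this identity and the next one pass from one weight to the other. Each bound costs one factor
  -- `D`.
  have hpow1 : ∀ x, u x * h x ^ (q / (q - 1)) = v x * N x ^ q := by
    intro x
    simp only [hh]
    rw [ENNReal.div_rpow_of_nonneg _ _ (by positivity), ← ENNReal.rpow_mul,
      mul_div_cancel₀ _ hq1.ne', huv.dual x, div_eq_mul_inv, ← ENNReal.rpow_neg,
      mul_left_comm, mul_comm]
    congr 1
    nth_rw 1 [← ENNReal.rpow_one (u x)]
    rw [← ENNReal.rpow_add _ _ (huv.pos x) (huv.ne_top x)]
    congr 1
    field_simp; ring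
  have hpow2 : ∀ x, v x * (f x / v x) ^ q = u x * f x ^ q := by
    intro x
    rw [ENNReal.div_rpow_of_nonneg _ _ (by positivity), div_eq_mul_inv, ← ENNReal.rpow_neg,
      hvu.dual x, mul_left_comm, mul_comm]
    congr 1
    nth_rw 1 [← ENNReal.rpow_one (v x)]
    rw [← ENNReal.rpow_add _ _ (hvu.pos x) (hvu.ne_top x)]
    congr 1
    have h2 : q / (q - 1) - 1 = 1 / (q - 1) := by field_simp; ring
    rw [h2]; field_simp; ring
  calc ∫⁻ x, maxFun μ B f x ^ q ∂(μ.withDensity u)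
      ≤ ∫⁻ x, Q ^ (q / (q - 1)) * maxFun (μ.withDensity u) B h x ^ (q / (q - 1))
          ∂(μ.withDensity u) := by
        refine lintegral_mono fun x => ?_
        calc maxFun μ B f x ^ q ≤ ((Q * maxFun (μ.withDensity u) B h x) ^ (1 / (q - 1))) ^ q :=
              ENNReal.rpow_le_rpow (hpt x) (by positivity)
          _ = _ := by
              rw [← ENNReal.rpow_mul, one_div_mul_eq_div,
                ENNReal.mul_rpow_of_nonneg _ _ (by positivity)]
    _ = Q ^ (q / (q - 1)) * ∫⁻ x, maxFun (μ.withDensity u) B h x ^ (q / (q - 1))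
          ∂(μ.withDensity u) := lintegral_const_mul' _ _ hQ't
    _ ≤ Q ^ (q / (q - 1)) * (ENNReal.ofReal (maxConst (q / (q - 1))) * D *
          ∫⁻ x, h x ^ (q / (q - 1)) ∂(μ.withDensity u)) :=
        mul_le_mul' le_rfl (strong_maxFun _ hB hD hq'1 hhm)
    _ = Q ^ (q / (q - 1)) * (ENNReal.ofReal (maxConst (q / (q - 1))) * D *
          ∫⁻ x, N x ^ q ∂(μ.withDensity v)) := by
        rw [lintegral_withDensity hum (hhm.pow_const _), lintegral_withDensity hvm (hNm.pow_const _)]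
        simp_rw [hpow1]
    _ ≤ Q ^ (q / (q - 1)) * (ENNReal.ofReal (maxConst (q / (q - 1))) * D *
          (ENNReal.ofReal (maxConst q) * D * ∫⁻ x, (f x / v x) ^ q ∂(μ.withDensity v))) :=
        mul_le_mul' le_rfl (mul_le_mul' le_rfl (strong_maxFun _ hB hD hq hfv))
    _ = Q ^ (q / (q - 1)) * (ENNReal.ofReal (maxConst (q / (q - 1))) * D *
          (ENNReal.ofReal (maxConst q) * D * ∫⁻ x, f x ^ q ∂(μ.withDensity u))) := by
        rw [lintegral_withDensity hvm (hfv.pow_const _), lintegral_withDensity hum (hf.pow_const _)]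
        simp_rw [hpow2]
    _ = _ := by
        rw [ENNReal.ofReal_mul (maxConst_pos hq'1).le, ENNReal.rpow_two]
        ring

/-- The sum of `⟨f⟩_{B i} ⟨g⟩_{B i} μ(B i)`. -/
noncomputable def sparseForm [Fintype ι] (μ : Measure X) (B : ι → Set X) (f g : X → ℝ≥0∞) :
    ℝ≥0∞ :=
  ∑ i, mean μ f (B i) * mean μ g (B i) * μ (B i)

/-- The `B i` contain subsets `E i` with `μ (E i) ≥ γ μ (B i)` that cover no point more than `N`
times. -/
structure SparseSets (μ : Measure X) (B E : ι → Set X) (γ N : ℝ≥0) : Prop where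
  subset : ∀ i, E i ⊆ B i
  measurableSet : ∀ i, MeasurableSet (E i)
  le : ∀ i, γ * μ (B i) ≤ μ (E i)
  overlap : ∀ x, ∑' i, (E i).indicator (fun _ => (1 : ℝ≥0∞)) x ≤ N

/-- The bilinear estimate in `L²` for the weights `W` and `W⁻¹`. -/
theorem sparseForm_le_two [Fintype ι] (hB : ∀ i, MeasurableSet (B i)) (hB0 : ∀ i, 0 < μ (B i))
    (hBt : ∀ i, μ (B i) < ∞) {D : ℕ} (hD : Overlap B D) {E : ι → Set X} {γ N : ℝ≥0} (hγ : 0 < γ)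
    (hE : SparseSets μ B E γ N) {W V : X → ℝ≥0∞} (hW : IsDualPair 2 W V) {C : ℝ≥0∞} (hCt : C ≠ ∞)
    (hC : ∀ i, mean μ W (B i) * mean μ V (B i) ≤ C)
    {f g : X → ℝ≥0∞} (hf : Measurable f) (hg : Measurable g) :
    sparseForm μ B f g ≤ (γ : ℝ≥0∞)⁻¹ * N * C * (ENNReal.ofReal (maxConst 2) * D) *
      (∫⁻ x, W x * f x ^ (2 : ℝ) ∂μ) ^ (1 / 2 : ℝ) *
      (∫⁻ x, V x * g x ^ (2 : ℝ) ∂μ) ^ (1 / 2 : ℝ) := by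
  have hV : IsDualPair 2 V W := by
    have := hW.symm (by norm_num)
    norm_num at this; exact this
  have hVW : ∀ x, V x * W x = 1 := fun x => by
    rw [hW.dual x]
    norm_num [ENNReal.rpow_neg_one]
    exact ENNReal.inv_mul_cancel (hW.pos x) (hW.ne_top x)
  have hWm := hW.measurable
  have hVm := hV.measurable
  set F := maxFun (μ.withDensity V) B (fun x => f x / V x) with hF
  set G := maxFun (μ.withDensity W) B (fun x => g x / W x) with hG
  have hFm : Measurable F := measurable_maxFun _ hB _
  have hGm : Measurable G := measurable_maxFun _ hB _
  have hpt : ∀ i, ∀ x ∈ B i, mean μ f (B i) * mean μ g (B i) ≤ C * (F x * G x) := by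
    intro i x hx
    have hw0 := mean_ne_zero hWm hW.pos (hB0 i) (hBt i)
    have hv0 := mean_ne_zero hVm hV.pos (hB0 i) (hBt i)
    obtain ⟨hwt, hvt⟩ := mean_ne_top_of_mul one_pos
      (by rw [ENNReal.rpow_one]; exact hC i) hCt hw0 hv0
    rw [mean_withDensity hVm hf hV.pos hV.ne_top (hB i) (hB0 i) (hBt i) hvt,
      mean_withDensity hWm hg hW.pos hW.ne_top (hB i) (hB0 i) (hBt i) hwt]
    calc _ = (mean μ W (B i) * mean μ V (B i)) *
          (mean (μ.withDensity V) (fun x => f x / V x) (B i) *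
            mean (μ.withDensity W) (fun x => g x / W x) (B i)) := by ring
      _ ≤ _ := by
          refine mul_le_mul' (hC i) (mul_le_mul' ?_ ?_)
          · exact mean_le_maxFun (μ.withDensity V) (fun x => f x / V x) hx
          · exact mean_le_maxFun (μ.withDensity W) (fun x => g x / W x) hx
  have hγ0 : (γ : ℝ≥0∞) ≠ 0 := by exact_mod_cast hγ.ne'
  -- The pointwise bound holds on all of `B i`, in particular on `E i`, where each term can be
  -- integrated at the cost of `γ⁻¹`. Summing the integrals costs the overlap `N`.
  have hsum : sparseForm μ B f g ≤ (γ : ℝ≥0∞)⁻¹ * (N * (C * ∫⁻ x, F x * G x ∂μ)) := by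
    calc sparseForm μ B f g
        ≤ ∑ i, (γ : ℝ≥0∞)⁻¹ * ∫⁻ x, (E i).indicator (fun _ => (1 : ℝ≥0∞)) x *
            (C * (F x * G x)) ∂μ := by
          refine Finset.sum_le_sum fun i _ => ?_
          have h1 : μ (B i) ≤ (γ : ℝ≥0∞)⁻¹ * μ (E i) := by
            calc μ (B i) = (γ : ℝ≥0∞)⁻¹ * (γ * μ (B i)) := by
                  rw [← mul_assoc, ENNReal.inv_mul_cancel hγ0 ENNReal.coe_ne_top, one_mul]
              _ ≤ _ := mul_le_mul' le_rfl (hE.le i)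
          calc mean μ f (B i) * mean μ g (B i) * μ (B i)
              ≤ mean μ f (B i) * mean μ g (B i) * ((γ : ℝ≥0∞)⁻¹ * μ (E i)) := by gcongr
            _ = (γ : ℝ≥0∞)⁻¹ * ∫⁻ x in E i, mean μ f (B i) * mean μ g (B i) ∂μ := by
                rw [setLIntegral_const]; ring
            _ ≤ (γ : ℝ≥0∞)⁻¹ * ∫⁻ x in E i, C * (F x * G x) ∂μ := by
                refine mul_le_mul' le_rfl (setLIntegral_mono' (hE.measurableSet i) fun x hx => ?_)
                exact hpt i x (hE.subset i hx)
            _ = _ := by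
                rw [← lintegral_indicator (hE.measurableSet i)]
                congr 1
                refine lintegral_congr fun x => ?_
                by_cases hx : x ∈ E i <;> simp [hx]
      _ = (γ : ℝ≥0∞)⁻¹ * ∫⁻ x, (∑ i, (E i).indicator (fun _ => (1 : ℝ≥0∞)) x) *
            (C * (F x * G x)) ∂μ := by
          rw [← Finset.mul_sum, ← lintegral_finsetSum]
          · simp_rw [Finset.sum_mul]
          · exact fun i _ => (measurable_const.indicator (hE.measurableSet i)).mul
              ((hFm.mul hGm).const_mul _)
      _ ≤ (γ : ℝ≥0∞)⁻¹ * ∫⁻ x, N * (C * (F x * G x)) ∂μ := by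
          gcongr with x
          exact (tsum_fintype _).symm.le.trans (hE.overlap x)
      _ = _ := by
          rw [lintegral_const_mul' _ _ (by finiteness), lintegral_const_mul' _ _ hCt]
  -- Since `V W = 1`, the weights can be inserted for free before applying the Cauchy–Schwarz
  -- inequality.
  have hsplit : ∀ a b : ℝ≥0∞, ∀ x, (V x * a ^ (2 : ℝ)) ^ (1 / 2 : ℝ) *
      (W x * b ^ (2 : ℝ)) ^ (1 / 2 : ℝ) = a * b := by
    intro a b x
    rw [← ENNReal.mul_rpow_of_nonneg _ _ (by norm_num), show V x * a ^ (2 : ℝ) *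
      (W x * b ^ (2 : ℝ)) = (V x * W x) * (a ^ (2 : ℝ) * b ^ (2 : ℝ)) by ring, hVW, one_mul,
      ← ENNReal.mul_rpow_of_nonneg _ _ (by norm_num), ← ENNReal.rpow_mul]
    norm_num
  have hFG : ∫⁻ x, F x * G x ∂μ ≤ (∫⁻ x, V x * F x ^ (2 : ℝ) ∂μ) ^ (1 / 2 : ℝ) *
      (∫⁻ x, W x * G x ^ (2 : ℝ) ∂μ) ^ (1 / 2 : ℝ) := by
    refine le_trans (le_of_eq ?_) (ENNReal.lintegral_mul_norm_pow_le
      (f := fun x => V x * F x ^ (2 : ℝ)) (g := fun x => W x * G x ^ (2 : ℝ))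
      (hVm.mul (hFm.pow_const _)).aemeasurable (hWm.mul (hGm.pow_const _)).aemeasurable
      (p := 1 / 2) (q := 1 / 2) (by norm_num) (by norm_num) (by norm_num))
    exact lintegral_congr fun x => (hsplit _ _ x).symm
  have hsq : ∀ a : ℝ≥0∞, ∀ U U' : X → ℝ≥0∞, (∀ x, U x * U' x = 1) → ∀ x,
      U x * (a / U x) ^ (2 : ℝ) = U' x * a ^ (2 : ℝ) := by
    intro a U U' h x
    have : (U x)⁻¹ = U' x :=
      (ENNReal.eq_inv_of_mul_eq_one_left (by rw [mul_comm]; exact h x)).symm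
    rw [div_eq_mul_inv, this, ENNReal.rpow_two, ENNReal.rpow_two]
    calc U x * (a * U' x) ^ 2 = (U x * U' x) * (U' x * a ^ 2) := by ring
      _ = _ := by rw [h, one_mul]
  have hFb : ∫⁻ x, V x * F x ^ (2 : ℝ) ∂μ ≤ ENNReal.ofReal (maxConst 2) * D *
      ∫⁻ x, W x * f x ^ (2 : ℝ) ∂μ := by
    have := strong_maxFun (μ.withDensity V) hB hD one_lt_two (hf.div hVm)
    rw [lintegral_withDensity hVm ((hf.div hVm).pow_const _)] at this
    rw [← lintegral_withDensity hVm (hFm.pow_const _)]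
    refine this.trans (le_of_eq ?_)
    congr 1
    exact lintegral_congr fun x => hsq _ V W hVW x
  have hGb : ∫⁻ x, W x * G x ^ (2 : ℝ) ∂μ ≤ ENNReal.ofReal (maxConst 2) * D *
      ∫⁻ x, V x * g x ^ (2 : ℝ) ∂μ := by
    have := strong_maxFun (μ.withDensity W) hB hD one_lt_two (hg.div hWm)
    rw [lintegral_withDensity hWm ((hg.div hWm).pow_const _)] at this
    rw [← lintegral_withDensity hWm (hGm.pow_const _)]
    refine this.trans (le_of_eq ?_)
    congr 1
    exact lintegral_congr fun x => hsq _ W V (fun x => by rw [mul_comm]; exact hVW x) x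
  have hcc : ∀ c : ℝ≥0∞, c ^ (1 / 2 : ℝ) * c ^ (1 / 2 : ℝ) = c := fun c => by
    rw [← ENNReal.rpow_add_of_nonneg _ _ (by norm_num) (by norm_num)]; norm_num
  set c := ENNReal.ofReal (maxConst 2) * D
  set I := ∫⁻ x, W x * f x ^ (2 : ℝ) ∂μ
  set J := ∫⁻ x, V x * g x ^ (2 : ℝ) ∂μ
  calc sparseForm μ B f g ≤ (γ : ℝ≥0∞)⁻¹ * (N * (C * ((c * I) ^ (1 / 2 : ℝ) *
        (c * J) ^ (1 / 2 : ℝ)))) := by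
        refine hsum.trans ?_
        gcongr
        refine hFG.trans ?_
        gcongr
    _ = (γ : ℝ≥0∞)⁻¹ * N * C * (c ^ (1 / 2 : ℝ) * c ^ (1 / 2 : ℝ)) * I ^ (1 / 2 : ℝ) *
        J ^ (1 / 2 : ℝ) := by
        rw [ENNReal.mul_rpow_of_nonneg c I (by norm_num),
          ENNReal.mul_rpow_of_nonneg c J (by norm_num)]
        ring
    _ = _ := by rw [hcc]

/-- The algorithm of Rubio de Francia: a majorant `G` of `g` with `M G ≤ 2 A G`. -/
theorem exists_rubioDeFrancia [Finite ι] (hB : ∀ i, MeasurableSet (B i)) {ν : Measure X} {q : ℝ}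
    (hq : 1 ≤ q) {A : ℝ≥0∞} (hA0 : A ≠ 0) (hAt : A ≠ ∞)
    (hM : ∀ f : X → ℝ≥0∞, Measurable f →
      ∫⁻ x, maxFun μ B f x ^ q ∂ν ≤ A ^ q * ∫⁻ x, f x ^ q ∂ν)
    {g : X → ℝ≥0∞} (hg : Measurable g) :
    ∃ G : X → ℝ≥0∞, Measurable G ∧ (∀ x, g x ≤ G x) ∧ (∀ x, maxFun μ B G x ≤ 2 * A * G x) ∧
      ∫⁻ x, G x ^ q ∂ν ≤ 2 ^ q * ∫⁻ x, g x ^ q ∂ν := by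
  have hq0 : 0 < q := by linarith
  -- The majorant is `G = ∑ (2A)^(-k) M^k g`. The operator `M` has norm at most `A`, so the norms of
  -- the terms decay like `2^(-k)`; applying `M` shifts the index and loses only the factor `2A`.
  set a : ℕ → X → ℝ≥0∞ := fun k => (maxFun μ B)^[k] g with ha
  have hasucc : ∀ k, a (k + 1) = maxFun μ B (a k) := fun k => by
    simp only [ha, Function.iterate_succ_apply']
  have ham : ∀ k, Measurable (a k) := by
    intro k
    cases k with
    | zero => exact hg
    | succ k => rw [hasucc]; exact measurable_maxFun _ hB _
  set r : ℝ≥0∞ := (2 * A)⁻¹ with hr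
  have h2A0 : 2 * A ≠ 0 := mul_ne_zero two_ne_zero hA0
  have h2At : 2 * A ≠ ∞ := ENNReal.mul_ne_top (by norm_num) hAt
  have hr0 : r ≠ ∞ := ENNReal.inv_ne_top.2 h2A0
  set b : ℕ → X → ℝ≥0∞ := fun k x => r ^ k * a k x with hb
  have hbm : ∀ k, Measurable (b k) := fun k => (ham k).const_mul _
  set n : (X → ℝ≥0∞) → ℝ≥0∞ := fun h => (∫⁻ x, h x ^ q ∂ν) ^ (1 / q) with hn
  have hqq : ∀ y : ℝ≥0∞, (y ^ q) ^ (1 / q) = y := fun y => by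
    rw [← ENNReal.rpow_mul, mul_one_div_cancel hq0.ne', ENNReal.rpow_one]
  have hqq' : ∀ y : ℝ≥0∞, (y ^ (1 / q)) ^ q = y := fun y => by
    rw [← ENNReal.rpow_mul, one_div_mul_cancel hq0.ne', ENNReal.rpow_one]
  have hna : ∀ k, n (a k) ≤ A ^ k * n g := by
    intro k
    induction k with
    | zero => simp [ha]
    | succ k ih =>
      have h1 := ENNReal.rpow_le_rpow (hM (a k) (ham k)) (show 0 ≤ 1 / q by positivity)
      rw [ENNReal.mul_rpow_of_nonneg _ _ (by positivity), hqq, ← hasucc] at h1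
      calc n (a (k + 1)) ≤ A * n (a k) := h1
        _ ≤ A * (A ^ k * n g) := by gcongr
        _ = _ := by ring
  have hnb : ∀ k, n (b k) ≤ 2⁻¹ ^ k * n g := by
    intro k
    have h1 : n (b k) = r ^ k * n (a k) := by
      simp only [hn, hb]
      simp_rw [ENNReal.mul_rpow_of_nonneg _ _ hq0.le]
      rw [lintegral_const_mul' _ _ (ENNReal.rpow_ne_top_of_nonneg hq0.le (ENNReal.pow_ne_top hr0)),
        ENNReal.mul_rpow_of_nonneg _ _ (by positivity), hqq]
    rw [h1]
    calc r ^ k * n (a k) ≤ r ^ k * (A ^ k * n g) := by gcongr; exact hna k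
      _ = (r * A) ^ k * n g := by rw [mul_pow]; ring
      _ = _ := by
        congr 2
        rw [hr, ENNReal.mul_inv (Or.inl two_ne_zero) (Or.inl (by norm_num)), mul_assoc,
          ENNReal.inv_mul_cancel hA0 hAt, mul_one]
  set S : ℕ → X → ℝ≥0∞ := fun m x => ∑ k ∈ Finset.range m, b k x with hS
  have hSm : ∀ m, Measurable (S m) := fun m => Finset.measurable_fun_sum _ fun k _ => hbm k
  have hnS : ∀ m, n (S m) ≤ ∑ k ∈ Finset.range m, 2⁻¹ ^ k * n g := by
    intro m
    induction m with
    | zero => simp [hn, hS, ENNReal.zero_rpow_of_pos, hq0]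
    | succ m ih =>
      rw [Finset.sum_range_succ]
      have h1 := ENNReal.lintegral_Lp_add_le (μ := ν) (hSm m).aemeasurable (hbm m).aemeasurable hq
      have h2 : S (m + 1) = S m + b m := by
        ext x; simp only [hS, Finset.sum_range_succ, Pi.add_apply]
      calc n (S (m + 1)) ≤ n (S m) + n (b m) := by rw [h2]; exact h1
        _ ≤ _ := add_le_add ih (hnb m)
  have hnS' : ∀ m, n (S m) ≤ 2 * n g := fun m => by
    refine (hnS m).trans ?_
    rw [← Finset.sum_mul]
    gcongr
    refine (ENNReal.sum_le_tsum _).trans ?_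
    rw [ENNReal.tsum_geometric]
    simp
  set G : X → ℝ≥0∞ := fun x => ∑' k, b k x with hG
  have hGm : Measurable G := Measurable.tsum hbm
  refine ⟨G, hGm, fun x => ?_, fun x => ?_, ?_⟩
  · calc g x = b 0 x := by simp [hb, ha]
      _ ≤ _ := ENNReal.le_tsum 0
  · refine maxFun_le fun i hx => ?_
    have h1 : mean μ G (B i) = ∑' k, r ^ k * mean μ (a k) (B i) := by
      unfold mean
      simp only [hG]
      rw [lintegral_tsum fun k => (hbm k).aemeasurable, div_eq_mul_inv, ← ENNReal.tsum_mul_right]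
      congr 1; ext k
      simp only [hb]
      rw [lintegral_const_mul _ (ham k), div_eq_mul_inv, mul_assoc]
    rw [h1]
    calc ∑' k, r ^ k * mean μ (a k) (B i) ≤ ∑' k, (2 * A) * b (k + 1) x := by
          refine ENNReal.tsum_le_tsum fun k => ?_
          have h2 : mean μ (a k) (B i) ≤ a (k + 1) x := by
            rw [hasucc]; exact mean_le_maxFun _ _ hx
          calc r ^ k * mean μ (a k) (B i) ≤ r ^ k * a (k + 1) x := by gcongr
            _ = (2 * A * r) * (r ^ k * a (k + 1) x) := by
                rw [hr, ENNReal.mul_inv_cancel h2A0 h2At, one_mul]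
            _ = _ := by simp only [hb]; ring
      _ = 2 * A * ∑' k, b (k + 1) x := ENNReal.tsum_mul_left
      _ ≤ _ := by
          gcongr
          exact ENNReal.tsum_comp_le_tsum_of_injective (add_left_injective 1) (fun k => b k x)
  · have hmono : ∀ x, Monotone fun m => S m x := fun x m m' h =>
      Finset.sum_le_sum_of_subset (Finset.range_mono h)
    have hlim := lintegral_tendsto_of_tendsto_of_monotone (μ := ν) (f := fun m x => S m x ^ q)
      (F := fun x => G x ^ q) (fun m => ((hSm m).pow_const _).aemeasurable)
      (Filter.Eventually.of_forall fun x m m' h => ENNReal.rpow_le_rpow (hmono x h) hq0.le)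
      (Filter.Eventually.of_forall fun x =>
        (ENNReal.continuous_rpow_const.tendsto _).comp (ENNReal.tendsto_nat_tsum fun k => b k x))
    refine le_of_tendsto' hlim fun m => ?_
    have := ENNReal.rpow_le_rpow (hnS' m) hq0.le
    rw [ENNReal.mul_rpow_of_nonneg _ _ hq0.le] at this
    simpa only [hn, hqq'] using this

end Finite

/-- The constant of the bilinear estimate for `2 ≤ p`. -/
noncomputable def formConst (p : ℝ) : ℝ≥0∞ :=
  (2 * ENNReal.ofReal (maxConst p * maxConst (p / (p - 1))) ^ (1 / (p / (p - 1)))) ^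
    ((p - 2) / (p - 1)) * ENNReal.ofReal (maxConst 2) * 2 ^ ((p / (p - 1) + 1) / (p / (p - 1)))

theorem formConst_ne_top {p : ℝ} (hp : 2 ≤ p) : formConst p ≠ ∞ := by
  have h1 : 0 < p - 1 := by linarith
  have h2 : 0 ≤ p - 2 := by linarith
  have h3 : 0 < p := by linarith
  unfold formConst
  refine ENNReal.mul_ne_top (ENNReal.mul_ne_top (ENNReal.rpow_ne_top_of_nonneg (by positivity)
    (ENNReal.mul_ne_top (by norm_num) (ENNReal.rpow_ne_top_of_nonneg (by positivity)
    ENNReal.ofReal_ne_top))) ENNReal.ofReal_ne_top)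
    (ENNReal.rpow_ne_top_of_nonneg (by positivity) (by norm_num))

/-- Covering a point needs at least one set. Having `D ≥ 1` permits raising exponents of `D` and
keeps the constants of the extrapolation nonzero. -/
theorem Overlap.one_le {X ι : Type*} {B : ι → Set X} {D : ℕ} (hD : Overlap B D)
    {i : ι} (hi : (B i).Nonempty) : 1 ≤ D := by
  classical
  obtain ⟨x, hx⟩ := hi
  obtain ⟨J', -, hU, h⟩ := hD {i}
  have hx' : x ∈ ⋃ i ∈ J', B i := hU (by simpa using hx)
  simp only [mem_iUnion] at hx'
  obtain ⟨j, hj, hxj⟩ := hx'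
  have h1 := Finset.single_le_sum (f := fun i => (B i).indicator (fun _ => (1 : ℝ≥0∞)) x)
    (fun _ _ => zero_le) hj
  simp only [indicator_of_mem hxj] at h1
  exact_mod_cast h1.trans (h x)

/-! ### Extrapolation from `L²` to `L^p` for `p ≥ 2` -/

section Finite

variable {X ι : Type*} [MeasurableSpace X] {B : ι → Set X} {μ : Measure X}

theorem mean_eq_zero_of_ae {f : X → ℝ≥0∞} (hf : f =ᵐ[μ] 0) (A : Set X) : mean μ f A = 0 := by
  unfold mean
  rw [lintegral_congr_ae (ae_restrict_of_ae hf)]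
  simp

/-- The bilinear estimate for `2 ≤ p`, by extrapolation from `L²`. -/
theorem sparseForm_le_of_two_le [Fintype ι] [Nonempty ι] (hB : ∀ i, MeasurableSet (B i))
    (hB0 : ∀ i, 0 < μ (B i)) (hBt : ∀ i, μ (B i) < ∞) {D : ℕ} (hD : Overlap B D) {E : ι → Set X}
    {γ N : ℝ≥0} (hγ : 0 < γ) (hE : SparseSets μ B E γ N) {p : ℝ} (hp : 2 ≤ p) {w v : X → ℝ≥0∞}
    (hw : IsDualPair p w v) {Q : ℝ≥0∞} (hQt : Q ≠ ∞)
    (hQ : ∀ i, mean μ w (B i) * mean μ v (B i) ^ (p - 1) ≤ Q) (hvt : ∫⁻ x, v x ∂μ ≠ ∞)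
    {f g : X → ℝ≥0∞} (hf : Measurable f) (hg : Measurable g)
    (hgt : ∫⁻ x, v x * g x ^ (p / (p - 1)) ∂μ ≠ ∞) :
    sparseForm μ B f g ≤ (γ : ℝ≥0∞)⁻¹ * N * formConst p * (D : ℝ≥0∞) ^ (p - 1) * Q *
      (∫⁻ x, w x * f x ^ p ∂μ) ^ (1 / p) *
      (∫⁻ x, v x * g x ^ (p / (p - 1)) ∂μ) ^ (1 / (p / (p - 1))) := by
  obtain ⟨i₀⟩ := ‹Nonempty ι›
  have hp1 : 0 < p - 1 := by linarith
  have hp2 : 0 ≤ p - 2 := by linarith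
  have hp0 : 0 < p := by linarith
  have hD1 : 1 ≤ D := hD.one_le (nonempty_of_measure_ne_zero (hB0 i₀).ne')
  have hD0 : (D : ℝ≥0∞) ≠ 0 := by exact_mod_cast (by omega : D ≠ 0)
  have hv := hw.symm (by linarith)
  have hwm := hw.measurable
  have hvm := hv.measurable
  set q := p / (p - 1) with hq
  have hq1 : 1 < q := by rw [hq, lt_div_iff₀ hp1]; linarith
  have hq0 : 0 < q := by linarith
  have hqp : q - 1 = 1 / (p - 1) := by rw [hq]; field_simp; ring
  have hqq : q / (q - 1) = p := by rw [hqp, hq]; field_simp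
  have hvgm : Measurable fun x => v x * g x ^ q := hvm.mul (hg.pow_const _)
  set T := ∫⁻ x, v x * g x ^ q ∂μ with hT
  -- The general argument needs `T ≠ 0`, both to choose a positive `ε` below and to add exponents of
  -- `T'`.
  by_cases hT0 : T = 0
  · have hg0 : g =ᵐ[μ] 0 := by
      rw [hT, lintegral_eq_zero_iff hvgm] at hT0
      filter_upwards [hT0] with x hx
      have : g x ^ q = 0 := by simpa [hv.pos x] using hx
      simpa [ENNReal.rpow_eq_zero_iff, hq0, hq0.not_gt] using this
    have : sparseForm μ B f g = 0 :=
      Finset.sum_eq_zero fun i _ => by rw [mean_eq_zero_of_ae hg0]; simp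
    rw [this]; exact zero_le
  -- the constant of the maximal function on `L^q(v)`
  set c₁ := ENNReal.ofReal (maxConst p * maxConst q) with hc₁
  set A := c₁ ^ (1 / q) * (D : ℝ≥0∞) ^ (2 / q) * Q with hA
  have hw0 := mean_ne_zero hwm hw.pos (hB0 i₀) (hBt i₀)
  have hv0 := mean_ne_zero hvm hv.pos (hB0 i₀) (hBt i₀)
  obtain ⟨hwt₀, hvt₀⟩ := mean_ne_top_of_mul hp1 (hQ i₀) hQt hw0 hv0
  have hQ0 : Q ≠ 0 := by
    intro h
    have := hQ i₀
    rw [h, nonpos_iff_eq_zero, mul_eq_zero, ENNReal.rpow_eq_zero_iff] at this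
    rcases this with h | h | h
    · exact hw0 h
    · exact hv0 h.1
    · exact hvt₀ h.1
  have hc₁0 : c₁ ≠ 0 := by
    rw [hc₁]
    simpa using mul_pos (maxConst_pos (by linarith : 1 < p)) (maxConst_pos hq1)
  have hA0 : A ≠ 0 := by
    refine mul_ne_zero (mul_ne_zero ?_ ?_) hQ0
    · exact (ENNReal.rpow_pos (pos_iff_ne_zero.2 hc₁0) ENNReal.ofReal_ne_top).ne'
    · exact (ENNReal.rpow_pos (pos_iff_ne_zero.2 hD0) (ENNReal.natCast_ne_top D)).ne'
  have hAt : A ≠ ∞ := ENNReal.mul_ne_top (ENNReal.mul_ne_top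
    (ENNReal.rpow_ne_top_of_nonneg (by positivity) ENNReal.ofReal_ne_top)
    (ENNReal.rpow_ne_top_of_nonneg (by positivity) (ENNReal.natCast_ne_top D))) hQt
  have hAq : A ^ q = c₁ * (D : ℝ≥0∞) ^ (2 : ℝ) * (Q ^ (1 / (p - 1))) ^ p := by
    rw [hA, ENNReal.mul_rpow_of_nonneg _ _ hq0.le, ENNReal.mul_rpow_of_nonneg _ _ hq0.le,
      ← ENNReal.rpow_mul, ← ENNReal.rpow_mul, ← ENNReal.rpow_mul, one_div_mul_cancel hq0.ne',
      div_mul_cancel₀ _ hq0.ne', ENNReal.rpow_one, one_div_mul_eq_div]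
  have hQv : ∀ i, mean μ v (B i) * mean μ w (B i) ^ (q - 1) ≤ Q ^ (1 / (p - 1)) := by
    intro i
    refine le_trans (le_of_eq ?_) (ENNReal.rpow_le_rpow (hQ i) (by positivity : 0 ≤ 1 / (p - 1)))
    rw [ENNReal.mul_rpow_of_nonneg _ _ (by positivity), ← ENNReal.rpow_mul,
      mul_one_div_cancel hp1.ne', ENNReal.rpow_one, hqp, mul_comm]
  have hM : ∀ h : X → ℝ≥0∞, Measurable h → ∫⁻ x, maxFun μ B h x ^ q ∂(μ.withDensity v) ≤
      A ^ q * ∫⁻ x, h x ^ q ∂(μ.withDensity v) := by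
    intro h hh
    have := buckley hB hB0 hBt hD hq1 hv
      (ENNReal.rpow_ne_top_of_nonneg (by positivity : 0 ≤ 1 / (p - 1)) hQt) hQv hh
    rw [hqq, ← hc₁] at this
    rwa [hAq]
  -- a positive majorant
  set s := ∫⁻ x, v x ∂μ with hs
  set ε := (T / (s + 1)) ^ (1 / q) with hε
  have hs1 : s + 1 ≠ ∞ := ENNReal.add_ne_top.2 ⟨hvt, ENNReal.one_ne_top⟩
  have hε0 : ε ≠ 0 := (ENNReal.rpow_pos (ENNReal.div_pos hT0 hs1)
    (ENNReal.div_ne_top hgt (by simp))).ne'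
  -- The constant `ε` keeps the majorant away from zero, so that its negative powers are finite, yet
  -- adds at most `T` to the integral. The denominator `s + 1` needs no separate case `s = 0`.
  have hεs : s * ε ^ q ≤ T := by
    rw [hε, ← ENNReal.rpow_mul, one_div_mul_cancel hq0.ne', ENNReal.rpow_one]
    calc s * (T / (s + 1)) ≤ (s + 1) * (T / (s + 1)) := by gcongr; exact le_self_add
      _ ≤ T := ENNReal.mul_div_le
  obtain ⟨G, hGm, hgG, hMG, hGint⟩ := exists_rubioDeFrancia hB hq1.le hA0 hAt hM
    (hg.max (measurable_const (a := ε)))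
  have hGε : ∀ x, ε ≤ G x := fun x => (le_max_right _ _).trans (hgG x)
  have hGg : ∀ x, g x ≤ G x := fun x => (le_max_left _ _).trans (hgG x)
  have hGT : ∫⁻ x, v x * G x ^ q ∂μ ≤ 2 ^ (q + 1) * T := by
    rw [lintegral_withDensity hvm (hGm.pow_const _),
      lintegral_withDensity hvm ((hg.max measurable_const).pow_const _)] at hGint
    refine hGint.trans ?_
    have h1 : ∫⁻ x, v x * (max (g x) ε) ^ q ∂μ ≤ T + s * ε ^ q := by
      rw [hT, hs, ← lintegral_mul_const _ hvm, ← lintegral_add_left hvgm]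
      refine lintegral_mono fun x => ?_
      rw [← mul_add]
      gcongr
      rcases max_cases (g x) ε with ⟨h, -⟩ | ⟨h, -⟩ <;> rw [h]
      · exact le_self_add
      · exact le_add_self
    calc (2 : ℝ≥0∞) ^ q * ∫⁻ x, v x * (max (g x) ε) ^ q ∂μ ≤ 2 ^ q * (T + T) := by
          gcongr; exact h1.trans (by gcongr)
      _ = _ := by
          rw [ENNReal.rpow_add _ _ (by norm_num) (by norm_num), ENNReal.rpow_one]; ring
  have hGTt : ∫⁻ x, v x * G x ^ q ∂μ ≠ ∞ := ne_top_of_le_ne_top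
    (ENNReal.mul_ne_top (ENNReal.rpow_ne_top_of_nonneg (by positivity) (by norm_num)) hgt) hGT
  have hGfin : ∀ᵐ x ∂μ, G x ≠ ∞ := by
    filter_upwards [ae_lt_top (hvm.mul (hGm.pow_const q)) hGTt] with x hx h
    simp [h, ENNReal.top_rpow_of_pos hq0, ENNReal.mul_top (hv.pos x)] at hx
  -- On a null set `G` may be infinite; the value `1` there makes the weights below a dual pair at
  -- every point.
  set G' : X → ℝ≥0∞ := fun x => if G x = ∞ then 1 else G x with hG'
  have hG'm : Measurable G' := Measurable.ite (hGm (measurableSet_singleton _)) measurable_const hGm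
  have hGG' : G' =ᵐ[μ] G := by
    filter_upwards [hGfin] with x hx
    simp [hG', hx]
  have hG'0 : ∀ x, G' x ≠ 0 := fun x => by
    simp only [hG']; split_ifs
    · exact one_ne_zero
    · exact (lt_of_lt_of_le (pos_iff_ne_zero.2 hε0) (hGε x)).ne'
  have hG't : ∀ x, G' x ≠ ∞ := fun x => by
    simp only [hG']; split_ifs with h
    · exact ENNReal.one_ne_top
    · exact h
  -- the extrapolation weight
  set θ := (p - 2) / (p - 1) with hθ
  have hθ0 : 0 ≤ θ := by positivity
  have hθ1 : θ + 1 / (p - 1) = 1 := by rw [hθ]; field_simp; ring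
  set W : X → ℝ≥0∞ := fun x => G' x ^ θ * w x ^ (1 / (p - 1)) with hW
  set V : X → ℝ≥0∞ := fun x => G' x ^ (-θ) * v x with hV
  have hWV : IsDualPair 2 W V := by
    refine ⟨(hG'm.pow_const _).mul (hwm.pow_const _), fun x => ?_, fun x => ?_, fun x => ?_⟩
    · exact mul_ne_zero (ENNReal.rpow_pos (pos_iff_ne_zero.2 (hG'0 x)) (hG't x)).ne'
        (ENNReal.rpow_pos (pos_iff_ne_zero.2 (hw.pos x)) (hw.ne_top x)).ne'
    · exact ENNReal.mul_ne_top (ENNReal.rpow_ne_top_of_nonneg hθ0 (hG't x))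
        (ENNReal.rpow_ne_top_of_nonneg (by positivity) (hw.ne_top x))
    · have h1 : (-1 / (2 - 1) : ℝ) = -1 := by norm_num
      simp only [hV, hW]
      rw [h1, ENNReal.mul_rpow_of_ne_top (ENNReal.rpow_ne_top_of_nonneg hθ0 (hG't x))
        (ENNReal.rpow_ne_top_of_nonneg (by positivity) (hw.ne_top x)), ← ENNReal.rpow_mul,
        ← ENNReal.rpow_mul, hw.dual x]
      congr 2 <;> ring
  have hVm : Measurable V := (hG'm.pow_const _).mul hvm
  set C := (2 * A) ^ θ * Q ^ (1 / (p - 1)) with hC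
  have h2At : 2 * A ≠ ∞ := ENNReal.mul_ne_top (by norm_num) hAt
  have hCt : C ≠ ∞ := ENNReal.mul_ne_top (ENNReal.rpow_ne_top_of_nonneg hθ0 h2At)
    (ENNReal.rpow_ne_top_of_nonneg (by positivity) hQt)
  -- Hölder's inequality gives `⟨W⟩ ≤ ⟨G⟩^θ ⟨w⟩^(1/(p-1))`. On `B i` the mean of `G` is at most `2 A
  -- G`, so `⟨G⟩^θ` cancels the factor `G^(-θ)` in `V`; the dual `A_p` product of `v` and `w`
  -- remains.
  have hCb : ∀ i, mean μ W (B i) * mean μ V (B i) ≤ C := by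
    intro i
    have h1 : mean μ W (B i) ≤ mean μ G (B i) ^ θ * mean μ w (B i) ^ (1 / (p - 1)) := by
      unfold mean
      rw [ENNReal.div_rpow_of_nonneg _ _ hθ0, ENNReal.div_rpow_of_nonneg _ _ (by positivity)]
      have h2 : μ (B i) = μ (B i) ^ θ * μ (B i) ^ (1 / (p - 1)) := by
        rw [← ENNReal.rpow_add _ _ (hB0 i).ne' (hBt i).ne, hθ1, ENNReal.rpow_one]
      have h3 : ∫⁻ x in B i, W x ∂μ ≤
          (∫⁻ x in B i, G x ∂μ) ^ θ * (∫⁻ x in B i, w x ∂μ) ^ (1 / (p - 1)) := by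
        rw [← lintegral_congr_ae (ae_restrict_of_ae hGG')]
        exact ENNReal.lintegral_mul_norm_pow_le hG'm.aemeasurable hwm.aemeasurable hθ0
          (by positivity) hθ1
      have hne : μ (B i) ^ θ ≠ 0 := (ENNReal.rpow_pos (hB0 i) (hBt i).ne).ne'
      have hnt : μ (B i) ^ θ ≠ ∞ := ENNReal.rpow_ne_top_of_nonneg hθ0 (hBt i).ne
      calc (∫⁻ x in B i, W x ∂μ) / μ (B i)
          ≤ ((∫⁻ x in B i, G x ∂μ) ^ θ * (∫⁻ x in B i, w x ∂μ) ^ (1 / (p - 1))) /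
            (μ (B i) ^ θ * μ (B i) ^ (1 / (p - 1))) := by rw [← h2]; gcongr
        _ = _ := by
            simp only [div_eq_mul_inv]
            rw [ENNReal.mul_inv (Or.inl hne) (Or.inl hnt)]
            ring
    have h4 : mean μ G (B i) ^ θ * mean μ V (B i) ≤ (2 * A) ^ θ * mean μ v (B i) := by
      unfold mean
      rw [← mul_div_assoc, ← mul_div_assoc]
      refine ENNReal.div_le_div_right ?_ _
      change mean μ G (B i) ^ θ * _ ≤ _
      rw [← lintegral_const_mul _ hVm, ← lintegral_const_mul _ hvm]
      refine lintegral_mono_ae ?_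
      filter_upwards [ae_restrict_of_ae hGG', ae_restrict_mem (hB i)] with x hx hxB
      have h5 : mean μ G (B i) ≤ 2 * A * G' x := by
        rw [hx]; exact (mean_le_maxFun μ G hxB).trans (hMG x)
      calc mean μ G (B i) ^ θ * V x ≤ (2 * A * G' x) ^ θ * V x := by gcongr
        _ = (2 * A) ^ θ * (G' x ^ θ * G' x ^ (-θ)) * v x := by
            rw [ENNReal.mul_rpow_of_nonneg _ _ hθ0]; simp only [hV]; ring
        _ = _ := by
            rw [← ENNReal.rpow_add _ _ (hG'0 x) (hG't x), add_neg_cancel, ENNReal.rpow_zero,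
              mul_one]
    calc mean μ W (B i) * mean μ V (B i)
        ≤ (mean μ G (B i) ^ θ * mean μ w (B i) ^ (1 / (p - 1))) * mean μ V (B i) := by gcongr
      _ = (mean μ G (B i) ^ θ * mean μ V (B i)) * mean μ w (B i) ^ (1 / (p - 1)) := by ring
      _ ≤ ((2 * A) ^ θ * mean μ v (B i)) * mean μ w (B i) ^ (1 / (p - 1)) := by gcongr
      _ = (2 * A) ^ θ * (mean μ v (B i) * mean μ w (B i) ^ (q - 1)) := by rw [hqp]; ring
      _ ≤ C := mul_le_mul' le_rfl (hQv i)
  have hmain := sparseForm_le_two hB hB0 hBt hD hγ hE hWV hCt hCb hf hg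
  set T' := 2 ^ (q + 1) * T with hT'
  set Fp := ∫⁻ x, w x * f x ^ p ∂μ with hFp
  -- Because `2 - θ = q`, the inequality `g ≤ G` turns the integrand into `v G^q`.
  have hVg : ∫⁻ x, V x * g x ^ (2 : ℝ) ∂μ ≤ T' := by
    refine le_trans (lintegral_mono_ae ?_) hGT
    filter_upwards [hGG'] with x hx
    calc V x * g x ^ (2 : ℝ) ≤ V x * G' x ^ (2 : ℝ) := by
          gcongr; rw [hx]; exact hGg x
      _ = v x * (G' x ^ (-θ) * G' x ^ (2 : ℝ)) := by simp only [hV]; ring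
      _ = v x * G' x ^ q := by
          rw [← ENNReal.rpow_add _ _ (hG'0 x) (hG't x)]
          congr 2
          rw [hθ, hq]; field_simp; ring
      _ = _ := by rw [hx]
  -- Hölder's inequality with exponents `p / 2` and `p / (p - 2)`, in the form of weights `2 / p`
  -- and `(p - 2) / p` so that `p = 2` is included.
  have hWf : ∫⁻ x, W x * f x ^ (2 : ℝ) ∂μ ≤ Fp ^ (2 / p) * T' ^ ((p - 2) / p) := by
    have h1 : ∀ x, W x * f x ^ (2 : ℝ) =
        (w x * f x ^ p) ^ (2 / p) * (v x * G' x ^ q) ^ ((p - 2) / p) := by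
      intro x
      have e0 : 0 ≤ (p - 2) / p := by positivity
      rw [ENNReal.mul_rpow_of_nonneg _ _ (by positivity), ENNReal.mul_rpow_of_nonneg _ _ e0,
        ← ENNReal.rpow_mul, ← ENNReal.rpow_mul, hw.dual x, ← ENNReal.rpow_mul,
        mul_div_cancel₀ _ hp0.ne']
      have e1 : q * ((p - 2) / p) = θ := by rw [hq, hθ]; field_simp
      rw [e1]
      have e2 : w x ^ (1 / (p - 1)) = w x ^ (2 / p) * w x ^ (-1 / (p - 1) * ((p - 2) / p)) := by
        rw [← ENNReal.rpow_add _ _ (hw.pos x) (hw.ne_top x)]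
        congr 1
        field_simp; ring
      simp only [hW]
      rw [e2]; ring
    have h2 : ∫⁻ x, v x * G' x ^ q ∂μ ≤ T' := by
      refine le_trans (le_of_eq (lintegral_congr_ae ?_)) hGT
      filter_upwards [hGG'] with x hx
      rw [hx]
    simp_rw [h1]
    refine (ENNReal.lintegral_mul_norm_pow_le (f := fun x => w x * f x ^ p)
      (g := fun x => v x * G' x ^ q) (hwm.mul (hf.pow_const _)).aemeasurable
      (hvm.mul (hG'm.pow_const _)).aemeasurable (by positivity) (by positivity)
      (by field_simp; ring)).trans ?_
    gcongr
  have hT't : T' ≠ ∞ :=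
    ENNReal.mul_ne_top (ENNReal.rpow_ne_top_of_nonneg (by positivity) (by norm_num)) hgt
  have hT'0 : T' ≠ 0 :=
    mul_ne_zero (ENNReal.rpow_pos (by norm_num) (by norm_num)).ne' hT0
  have hprod : (∫⁻ x, W x * f x ^ (2 : ℝ) ∂μ) ^ (1 / 2 : ℝ) *
      (∫⁻ x, V x * g x ^ (2 : ℝ) ∂μ) ^ (1 / 2 : ℝ) ≤
      2 ^ ((q + 1) / q) * (Fp ^ (1 / p) * T ^ (1 / q)) := by
    calc _ ≤ (Fp ^ (2 / p) * T' ^ ((p - 2) / p)) ^ (1 / 2 : ℝ) * T' ^ (1 / 2 : ℝ) := by gcongr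
      _ = Fp ^ (1 / p) * T' ^ (1 / q) := by
          rw [ENNReal.mul_rpow_of_nonneg _ _ (by norm_num), ← ENNReal.rpow_mul, ← ENNReal.rpow_mul,
            mul_assoc, ← ENNReal.rpow_add _ _ hT'0 hT't]
          congr 2
          · field_simp
          · rw [hq]; field_simp; ring
      _ = _ := by
          rw [hT', ENNReal.mul_rpow_of_nonneg _ _ (by positivity), ← ENNReal.rpow_mul,
            mul_one_div]
          ring
  have hCD : C * (ENNReal.ofReal (maxConst 2) * D) * 2 ^ ((q + 1) / q) ≤
      formConst p * (D : ℝ≥0∞) ^ (p - 1) * Q := by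
    have h1 : (2 * A) ^ θ = (2 * c₁ ^ (1 / q)) ^ θ * (D : ℝ≥0∞) ^ (2 / q * θ) * Q ^ θ := by
      rw [hA, ENNReal.rpow_mul, ← ENNReal.mul_rpow_of_nonneg _ _ hθ0,
        ← ENNReal.mul_rpow_of_nonneg _ _ hθ0]
      congr 1; ring
    have h2 : Q ^ θ * Q ^ (1 / (p - 1)) = Q := by
      rw [← ENNReal.rpow_add _ _ hQ0 hQt, hθ1, ENNReal.rpow_one]
    -- The comparison `2 (p - 2) / p + 1 ≤ p - 1` of exponents amounts to `(p - 2)² ≥ 0`.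
    have h3 : (D : ℝ≥0∞) ^ (2 / q * θ) * D ≤ (D : ℝ≥0∞) ^ (p - 1) := by
      nth_rw 2 [← ENNReal.rpow_one (D : ℝ≥0∞)]
      rw [← ENNReal.rpow_add _ _ hD0 (ENNReal.natCast_ne_top D)]
      refine ENNReal.rpow_le_rpow_of_exponent_le (by exact_mod_cast hD1) ?_
      have : 2 / q * θ = 2 * (p - 2) / p := by rw [hq, hθ]; field_simp
      rw [this, div_add_one hp0.ne', div_le_iff₀ hp0]
      nlinarith [sq_nonneg (p - 2)]
    calc C * (ENNReal.ofReal (maxConst 2) * D) * 2 ^ ((q + 1) / q)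
        = formConst p * ((D : ℝ≥0∞) ^ (2 / q * θ) * D) * (Q ^ θ * Q ^ (1 / (p - 1))) := by
          rw [hC, h1, formConst]; ring
      _ ≤ _ := by rw [h2]; gcongr
  calc sparseForm μ B f g ≤ (γ : ℝ≥0∞)⁻¹ * N * C * (ENNReal.ofReal (maxConst 2) * D) *
        (2 ^ ((q + 1) / q) * (Fp ^ (1 / p) * T ^ (1 / q))) := by
        refine hmain.trans ?_
        rw [mul_assoc]
        gcongr
    _ = (γ : ℝ≥0∞)⁻¹ * N * (C * (ENNReal.ofReal (maxConst 2) * D) * 2 ^ ((q + 1) / q)) *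
        (Fp ^ (1 / p) * T ^ (1 / q)) := by ring
    _ ≤ (γ : ℝ≥0∞)⁻¹ * N * (formConst p * (D : ℝ≥0∞) ^ (p - 1) * Q) *
        (Fp ^ (1 / p) * T ^ (1 / q)) := by gcongr
    _ = _ := by ring

end Finite

/-! ### The weighted bound for sums of averages -/

/-- The constant of the weighted bound. -/
noncomputable def opConst (p : ℝ) : ℝ≥0∞ :=
  if 2 ≤ p then formConst p else formConst (p / (p - 1))

theorem opConst_ne_top {p : ℝ} (hp : 1 < p) : opConst p ≠ ∞ := by
  unfold opConst
  split_ifs with h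
  · exact formConst_ne_top h
  · refine formConst_ne_top ?_
    rw [le_div_iff₀ (by linarith)]
    linarith

/-- The sum of the functions `⟨f⟩_{B i} 1_{B i}`. -/
noncomputable def meanSum {X ι : Type*} [MeasurableSpace X] (μ : Measure X) (B : ι → Set X)
    (f : X → ℝ≥0∞) (x : X) : ℝ≥0∞ :=
  ∑' i, (B i).indicator (fun _ => mean μ f (B i)) x

/-- The bound for the norm of `meanSum` on `L^p(w)`. -/
noncomputable def normBound (p : ℝ) (γ N : ℝ≥0) (D : ℕ) (Q : ℝ≥0∞) : ℝ≥0∞ :=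
  (γ : ℝ≥0∞)⁻¹ * N * opConst p * (D : ℝ≥0∞) ^ max (1 / (p - 1)) (p - 1) *
    Q ^ max 1 (1 / (p - 1))

/-- An indexed family may repeat a set, while the Besicovitch condition counts sets. Choosing one
index for each set of the thinned collection makes the two counts agree. -/
theorem Besicovitch.overlap {X ι : Type*} {ℬ : Set (Set X)} {D : ℕ} (h : Besicovitch ℬ D)
    {B : ι → Set X} (hB : ∀ i, B i ∈ ℬ) : Overlap B D := by
  classical
  intro J
  obtain ⟨𝒜, h𝒜, hU, hD⟩ := h (B '' J) (by rintro _ ⟨i, -, rfl⟩; exact hB i)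
  have hs : ∀ A : 𝒜, ∃ i ∈ J, B i = A := fun A => by
    obtain ⟨i, hi, h⟩ := h𝒜 A.2
    exact ⟨i, hi, h⟩
  choose s hsJ hsB using hs
  set J' := J.filter fun i => ∃ h : B i ∈ 𝒜, s ⟨B i, h⟩ = i with hJ'
  refine ⟨J', Finset.filter_subset _ _, fun x hx => ?_, fun x => ?_⟩
  · have hx' : x ∈ ⋃₀ (B '' J) := by
      simp only [mem_iUnion] at hx
      obtain ⟨i, hi, hx⟩ := hx
      exact ⟨B i, ⟨i, hi, rfl⟩, hx⟩
    rw [← hU] at hx'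
    obtain ⟨A, hA, hx⟩ := hx'
    simp only [mem_iUnion]
    refine ⟨s ⟨A, hA⟩, ?_, ?_⟩
    · rw [hJ', Finset.mem_filter]
      refine ⟨hsJ _, ?_⟩
      have e := hsB ⟨A, hA⟩
      refine ⟨e ▸ hA, ?_⟩
      congr 1
      exact Subtype.ext e
    · rw [hsB]; exact hx
  · have h1 : ∑ i ∈ J', (B i).indicator (fun _ => (1 : ℝ≥0∞)) x =
        ((J'.filter fun i => x ∈ B i).card : ℝ≥0∞) := by
      simp [indicator_apply]
    rw [h1]
    have h2 : ((J'.filter fun i => x ∈ B i).card : ℕ∞) ≤ D := by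
      refine le_trans ?_ (hD x)
      rw [← Set.encard_coe_eq_coe_finsetCard]
      refine Set.encard_le_encard_of_injOn (f := B) (fun i hi => ?_) (fun i hi j hj hij => ?_)
      · simp only [hJ', Finset.coe_filter, Finset.mem_filter, mem_ofPred_eq] at hi
        exact ⟨hi.1.2.1, hi.2⟩
      · simp only [hJ', Finset.coe_filter, Finset.mem_filter, mem_ofPred_eq] at hi hj
        obtain ⟨⟨-, hi1, hi2⟩, -⟩ := hi
        obtain ⟨⟨-, hj1, hj2⟩, -⟩ := hj
        rw [← hi2, ← hj2]
        congr 1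
        exact Subtype.ext hij
    exact_mod_cast h2

/-! ### Duality and passage to countable families -/

section Finite

variable {X ι : Type*} [MeasurableSpace X] {B : ι → Set X} {μ : Measure X}

/-- The form is symmetric, so for `p < 2` the case `2 ≤ p / (p - 1)` applies with `f, w` and `g, v`
interchanged. The characteristic of `v` for the dual exponent is bounded by `Q^(1/(p-1))`, and `p /
(p - 1) - 1 = 1 / (p - 1)`; this produces the two maxima in the exponents. -/
theorem sparseForm_le [Fintype ι] [Nonempty ι] (hB : ∀ i, MeasurableSet (B i))
    (hB0 : ∀ i, 0 < μ (B i)) (hBt : ∀ i, μ (B i) < ∞) {D : ℕ} (hD : Overlap B D) {E : ι → Set X}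
    {γ N : ℝ≥0} (hγ : 0 < γ) (hE : SparseSets μ B E γ N) {p : ℝ} (hp : 1 < p) {w v : X → ℝ≥0∞}
    (hw : IsDualPair p w v) {Q : ℝ≥0∞} (hQt : Q ≠ ∞)
    (hQ : ∀ i, mean μ w (B i) * mean μ v (B i) ^ (p - 1) ≤ Q)
    (hwt : ∫⁻ x, w x ∂μ ≠ ∞) (hvt : ∫⁻ x, v x ∂μ ≠ ∞)
    {f g : X → ℝ≥0∞} (hf : Measurable f) (hg : Measurable g)
    (hft : ∫⁻ x, w x * f x ^ p ∂μ ≠ ∞) (hgt : ∫⁻ x, v x * g x ^ (p / (p - 1)) ∂μ ≠ ∞) :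
    sparseForm μ B f g ≤ normBound p γ N D Q *
      (∫⁻ x, w x * f x ^ p ∂μ) ^ (1 / p) *
      (∫⁻ x, v x * g x ^ (p / (p - 1)) ∂μ) ^ (1 / (p / (p - 1))) := by
  have hp1 : 0 < p - 1 := by linarith
  unfold normBound opConst
  split_ifs with h2
  · have e1 : max (1 / (p - 1)) (p - 1) = p - 1 := by
      refine max_eq_right ?_
      rw [div_le_iff₀ hp1]; nlinarith
    have e2 : max 1 (1 / (p - 1)) = 1 := by
      refine max_eq_left ?_
      rw [div_le_iff₀ hp1]; linarith
    rw [e1, e2, ENNReal.rpow_one]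
    exact sparseForm_le_of_two_le hB hB0 hBt hD hγ hE h2 hw hQt hQ hvt hf hg hgt
  · have h1 : 1 ≤ 1 / (p - 1) := by rw [le_div_iff₀ hp1]; linarith
    have e1 : max (1 / (p - 1)) (p - 1) = 1 / (p - 1) := max_eq_left (by linarith)
    have e2 : max 1 (1 / (p - 1)) = 1 / (p - 1) := max_eq_right h1
    have hq1 : p / (p - 1) - 1 = 1 / (p - 1) := by field_simp; ring
    have hqq : p / (p - 1) / (p / (p - 1) - 1) = p := by rw [hq1]; field_simp
    have hq2 : 2 ≤ p / (p - 1) := by rw [le_div_iff₀ hp1]; linarith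
    have h := sparseForm_le_of_two_le hB hB0 hBt hD hγ hE hq2 (hw.symm hp)
      (ENNReal.rpow_ne_top_of_nonneg (by positivity : 0 ≤ 1 / (p - 1)) hQt) (fun i => by
        rw [hq1]
        refine le_trans (le_of_eq ?_)
          (ENNReal.rpow_le_rpow (hQ i) (by positivity : 0 ≤ 1 / (p - 1)))
        rw [ENNReal.mul_rpow_of_nonneg _ _ (by positivity), ← ENNReal.rpow_mul,
          mul_one_div_cancel hp1.ne', ENNReal.rpow_one, mul_comm]) hwt hg hf (by rwa [hqq])
    rw [hqq, hq1] at h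
    rw [e1, e2]
    have hsymm : sparseForm μ B f g = sparseForm μ B g f :=
      Finset.sum_congr rfl fun i _ => by ring
    rw [hsymm]
    refine h.trans (le_of_eq ?_)
    ring

/-- Hölder's inequality for `f = (w f^p)^(1/p) v^((p-1)/p)`. -/
theorem setLIntegral_ne_top_of_dual {p : ℝ} (hp : 1 < p) {w v : X → ℝ≥0∞}
    (hw : IsDualPair p w v) (hvt : ∫⁻ x, v x ∂μ ≠ ∞) {f : X → ℝ≥0∞} (hf : Measurable f)
    (hft : ∫⁻ x, w x * f x ^ p ∂μ ≠ ∞) : ∫⁻ x, f x ∂μ ≠ ∞ := by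
  have hp1 : 0 < p - 1 := by linarith
  have hp0 : 0 < p := by linarith
  have h1 : ∀ x, f x = (w x * f x ^ p) ^ (1 / p) * v x ^ ((p - 1) / p) := by
    intro x
    rw [ENNReal.mul_rpow_of_nonneg _ _ (by positivity), ← ENNReal.rpow_mul,
      mul_one_div_cancel hp0.ne', ENNReal.rpow_one, hw.dual x, ← ENNReal.rpow_mul, mul_right_comm,
      ← ENNReal.rpow_add _ _ (hw.pos x) (hw.ne_top x)]
    have : 1 / p + -1 / (p - 1) * ((p - 1) / p) = 0 := by field_simp; ring
    rw [this, ENNReal.rpow_zero, one_mul]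
  rw [lintegral_congr h1]
  refine ne_top_of_le_ne_top ?_ (ENNReal.lintegral_mul_norm_pow_le
    (f := fun x => w x * f x ^ p) (g := v)
    (hw.measurable.mul (hf.pow_const _)).aemeasurable (hw.symm hp).measurable.aemeasurable
    (by positivity) (by positivity) (by field_simp; ring))
  exact ENNReal.mul_ne_top (ENNReal.rpow_ne_top_of_nonneg (by positivity) hft)
    (ENNReal.rpow_ne_top_of_nonneg (by positivity) hvt)

/-- The weighted bound for a finite family in a space where the weights are integrable. -/
theorem meanSum_le_of_finite [Fintype ι] (hB : ∀ i, MeasurableSet (B i))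
    (hB0 : ∀ i, 0 < μ (B i)) (hBt : ∀ i, μ (B i) < ∞) {D : ℕ} (hD : Overlap B D) {E : ι → Set X}
    {γ N : ℝ≥0} (hγ : 0 < γ) (hE : SparseSets μ B E γ N) {p : ℝ} (hp : 1 < p) {w v : X → ℝ≥0∞}
    (hw : IsDualPair p w v) {Q : ℝ≥0∞} (hQt : Q ≠ ∞)
    (hQ : ∀ i, mean μ w (B i) * mean μ v (B i) ^ (p - 1) ≤ Q)
    (hwt : ∫⁻ x, w x ∂μ ≠ ∞) (hvt : ∫⁻ x, v x ∂μ ≠ ∞)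
    {f : X → ℝ≥0∞} (hf : Measurable f) (hft : ∫⁻ x, w x * f x ^ p ∂μ ≠ ∞) :
    (∫⁻ x, w x * meanSum μ B f x ^ p ∂μ) ^ (1 / p) ≤ normBound p γ N D Q *
      (∫⁻ x, w x * f x ^ p ∂μ) ^ (1 / p) := by
  have hp1 : 0 < p - 1 := by linarith
  have hp0 : 0 < p := by linarith
  rcases isEmpty_or_nonempty ι with hι | hι
  · simp [meanSum, ENNReal.zero_rpow_of_pos, hp0]
  have hwm := hw.measurable
  set H := meanSum μ B f with hH
  have hHs : ∀ x, H x = ∑ i, (B i).indicator (fun _ => mean μ f (B i)) x := fun x => tsum_fintype _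
  have hHm : Measurable H := by
    rw [funext hHs]
    exact Finset.measurable_fun_sum _ fun i _ => measurable_const.indicator (hB i)
  have hfint := setLIntegral_ne_top_of_dual hp hw hvt hf hft
  set S := ∫⁻ x, w x * H x ^ p ∂μ with hS
  -- Finiteness is needed in advance because the estimate is finally divided by a power of `S`. It
  -- holds since `H` is bounded and `w` is integrable.
  have hSt : S ≠ ∞ := by
    have hc : ∑ i, mean μ f (B i) ≠ ∞ := ENNReal.sum_ne_top.2 fun i _ =>
      ENNReal.div_ne_top (ne_top_of_le_ne_top hfint (setLIntegral_le_lintegral _ _)) (hB0 i).ne'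
    refine ne_top_of_le_ne_top (ENNReal.mul_ne_top hwt (ENNReal.rpow_ne_top_of_nonneg hp0.le hc))
      (b := (∫⁻ x, w x ∂μ) * (∑ i, mean μ f (B i)) ^ p) ?_
    rw [← lintegral_mul_const _ hwm]
    refine lintegral_mono fun x => ?_
    gcongr
    rw [hHs]
    exact Finset.sum_le_sum fun i _ => indicator_le_self' (fun _ _ => zero_le) x
  by_cases hS0 : S = 0
  · rw [hS0, ENNReal.zero_rpow_of_pos (by positivity)]; exact zero_le
  -- The extremal function of the duality: the form at `f, g` and the dual norm integral of `g` both
  -- equal `S`.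
  set g : X → ℝ≥0∞ := fun x => w x * H x ^ (p - 1) with hg
  have hgm : Measurable g := hwm.mul (hHm.pow_const _)
  have hgS : ∫⁻ x, v x * g x ^ (p / (p - 1)) ∂μ = S := by
    refine lintegral_congr fun x => ?_
    simp only [hg]
    rw [ENNReal.mul_rpow_of_nonneg _ _ (by positivity), ← ENNReal.rpow_mul,
      mul_div_cancel₀ _ hp1.ne', hw.dual x, ← mul_assoc,
      ← ENNReal.rpow_add _ _ (hw.pos x) (hw.ne_top x)]
    have : -1 / (p - 1) + p / (p - 1) = 1 := by field_simp; ring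
    rw [this, ENNReal.rpow_one]
  have hform : sparseForm μ B f g = S := by
    calc sparseForm μ B f g = ∑ i, ∫⁻ x, (B i).indicator (fun _ => mean μ f (B i)) x * g x ∂μ := by
          refine Finset.sum_congr rfl fun i _ => ?_
          have h1 : mean μ g (B i) * μ (B i) = ∫⁻ x in B i, g x ∂μ :=
            ENNReal.div_mul_cancel (hB0 i).ne' (hBt i).ne
          rw [mul_assoc, h1, ← lintegral_const_mul _ hgm, ← lintegral_indicator (hB i)]
          refine lintegral_congr fun x => ?_
          by_cases hx : x ∈ B i <;> simp [hx]
      _ = ∫⁻ x, H x * g x ∂μ := by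
          rw [← lintegral_finsetSum]
          · simp_rw [hHs, Finset.sum_mul]
          · exact fun i _ => (measurable_const.indicator (hB i)).mul hgm
      _ = S := by
          refine lintegral_congr fun x => ?_
          simp only [hg]
          have : H x ^ p = H x ^ (1 + (p - 1)) := by congr 1; ring
          rw [this, ENNReal.rpow_add_of_nonneg _ _ (by norm_num) hp1.le, ENNReal.rpow_one]
          ring
  have h := sparseForm_le hB hB0 hBt hD hγ hE hp hw hQt hQ hwt hvt hf hgm hft (by rwa [hgS])
  rw [hgS, hform] at h
  have hSq0 : S ^ (1 / (p / (p - 1))) ≠ 0 :=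
    (ENNReal.rpow_pos (pos_iff_ne_zero.2 hS0) hSt).ne'
  have hSqt : S ^ (1 / (p / (p - 1))) ≠ ∞ := ENNReal.rpow_ne_top_of_nonneg (by positivity) hSt
  have hsplit : S = S ^ (1 / p) * S ^ (1 / (p / (p - 1))) := by
    rw [← ENNReal.rpow_add _ _ hS0 hSt]
    have : 1 / p + 1 / (p / (p - 1)) = 1 := by field_simp; ring
    rw [this, ENNReal.rpow_one]
  nth_rw 1 [hsplit] at h
  exact (ENNReal.mul_le_mul_iff_left hSq0 hSqt).1 h

/-- The weighted bound for a countable family. -/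
theorem meanSum_le [Countable ι] (hB : ∀ i, MeasurableSet (B i))
    (hB0 : ∀ i, 0 < μ (B i)) (hBt : ∀ i, μ (B i) < ∞) {ℬ : Set (Set X)} {D : ℕ}
    (hD : Besicovitch ℬ D) (hBℬ : ∀ i, B i ∈ ℬ) {E : ι → Set X}
    {γ N : ℝ≥0} (hγ : 0 < γ) (hE : SparseSets μ B E γ N) {p : ℝ} (hp : 1 < p) {w v : X → ℝ≥0∞}
    (hw : IsDualPair p w v) {Q : ℝ≥0∞} (hQt : Q ≠ ∞)
    (hQ : ∀ i, mean μ w (B i) * mean μ v (B i) ^ (p - 1) ≤ Q)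
    {f : X → ℝ≥0∞} (hf : Measurable f) (hft : ∫⁻ x, w x * f x ^ p ∂μ ≠ ∞) :
    (∫⁻ x, w x * meanSum μ B f x ^ p ∂μ) ^ (1 / p) ≤ normBound p γ N D Q *
      (∫⁻ x, w x * f x ^ p ∂μ) ^ (1 / p) := by
  classical
  have hp1 : 0 < p - 1 := by linarith
  have hp0 : 0 < p := by linarith
  have hwm := hw.measurable
  have hv := hw.symm hp
  set F : Finset ι → X → ℝ≥0∞ := fun J x =>
    ∑ i ∈ J, (B i).indicator (fun _ => mean μ f (B i)) x with hF
  have hFm : ∀ J, Measurable (F J) := fun J =>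
    Finset.measurable_fun_sum _ fun i _ => measurable_const.indicator (hB i)
  have hfin : ∀ J : Finset ι, (∫⁻ x, w x * F J x ^ p ∂μ) ^ (1 / p) ≤ normBound p γ N D Q *
      (∫⁻ x, w x * f x ^ p ∂μ) ^ (1 / p) := by
    intro J
    -- After restriction to the union of finitely many sets, both weights become integrable, their
    -- means over these sets being finite by the `A_p` bound.
    set Y := ⋃ i ∈ J, B i with hY
    have hYm : MeasurableSet Y := Finset.measurableSet_biUnion _ fun i _ => hB i
    have hsub : ∀ i : J, B i ⊆ Y := fun i => subset_biUnion_of_mem (u := fun i => B i) i.2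
    have hmeas : ∀ i : J, ∀ A ⊆ B i, (μ.restrict Y) A = μ A := fun i A hA =>
      Measure.restrict_eq_self _ (hA.trans (hsub i))
    have hmean : ∀ i : J, ∀ h, mean (μ.restrict Y) h (B i) = mean μ h (B i) := fun i h => by
      unfold mean
      rw [hmeas i _ subset_rfl, Measure.restrict_restrict_of_subset (hsub i)]
    have hfinite : ∀ u : X → ℝ≥0∞, (∀ i, mean μ u (B i) ≠ ∞) → ∫⁻ x in Y, u x ∂μ ≠ ∞ := by
      intro u hu
      have h1 := measure_biUnion_finset_le (μ := μ.withDensity u) J B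
      rw [withDensity_apply _ hYm] at h1
      refine ne_top_of_le_ne_top ?_ h1
      simp_rw [withDensity_apply u (hB _)]
      refine ENNReal.sum_ne_top.2 fun i _ => ?_
      intro h
      refine hu i ?_
      unfold mean
      rw [h, ENNReal.top_div_of_ne_top (hBt i).ne]
    have hnt := fun i => mean_ne_top_of_mul hp1 (hQ i) hQt
      (mean_ne_zero hwm hw.pos (hB0 i) (hBt i)) (mean_ne_zero hv.measurable hv.pos (hB0 i) (hBt i))
    have h := meanSum_le_of_finite (ι := J) (μ := μ.restrict Y) (B := fun i => B i)
      (E := fun i => E i) (γ := γ) (N := N) (D := D) (p := p) (w := w) (v := v) (Q := Q) (f := f)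
      (fun i => hB i)
      (fun i => by rw [hmeas i _ subset_rfl]; exact hB0 i)
      (fun i => by rw [hmeas i _ subset_rfl]; exact hBt i)
      (hD.overlap fun i => hBℬ i) hγ
      ⟨fun i => hE.subset i, fun i => hE.measurableSet i, fun i => by
        rw [hmeas i _ subset_rfl, hmeas i _ (hE.subset i)]; exact hE.le i, fun x =>
        le_trans (ENNReal.tsum_comp_le_tsum_of_injective Subtype.val_injective
          fun i => (E i).indicator (fun _ => (1 : ℝ≥0∞)) x) (hE.overlap x)⟩
      hp hw hQt (fun i => by rw [hmean, hmean]; exact hQ i)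
      (hfinite w fun i => (hnt i).1) (hfinite v fun i => (hnt i).2) hf
      (ne_top_of_le_ne_top hft (setLIntegral_le_lintegral _ _))
    have h1 : ∀ x, meanSum (μ.restrict Y) (fun i : J => B i) f x = F J x := fun x => by
      simp only [meanSum, hmean, hF]
      rw [tsum_fintype]
      exact Finset.sum_coe_sort J fun i => (B i).indicator (fun _ => mean μ f (B i)) x
    simp_rw [h1] at h
    have h2 : ∫⁻ x, w x * F J x ^ p ∂μ = ∫⁻ x in Y, w x * F J x ^ p ∂μ := by
      rw [← lintegral_indicator hYm]
      refine lintegral_congr fun x => ?_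
      by_cases hx : x ∈ Y
      · rw [indicator_of_mem hx]
      · rw [indicator_of_notMem hx]
        have : F J x = 0 := Finset.sum_eq_zero fun i hi =>
          indicator_of_notMem (fun hxi => hx (hsub ⟨i, hi⟩ hxi)) _
        rw [this, ENNReal.zero_rpow_of_pos hp0, mul_zero]
    rw [h2]
    refine h.trans ?_
    gcongr
    exact Measure.restrict_le_self
  have hsup : ∀ x, w x * meanSum μ B f x ^ p = ⨆ J, w x * F J x ^ p := by
    intro x
    rw [← ENNReal.mul_iSup]
    congr 1
    have := (ENNReal.orderIsoRpow p hp0).map_iSup fun J => F J x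
    simp only [ENNReal.orderIsoRpow_apply] at this
    rw [← this]
    simp only [meanSum, hF, ENNReal.tsum_eq_iSup_sum]
  have hFmono : ∀ J J' : Finset ι, J ⊆ J' → ∀ x, F J x ≤ F J' x := fun J J' h x =>
    Finset.sum_le_sum_of_subset h
  -- Monotone convergence along the directed set of finite subfamilies, which is countable because
  -- `ι` is.
  have hint : ∫⁻ x, w x * meanSum μ B f x ^ p ∂μ = ⨆ J, ∫⁻ x, w x * F J x ^ p ∂μ := by
    simp_rw [hsup]
    refine lintegral_iSup_directed (fun J => (hwm.mul ((hFm J).pow_const _)).aemeasurable) ?_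
    intro J J'
    refine ⟨J ∪ J', fun x => ?_, fun x => ?_⟩
    · exact mul_le_mul' le_rfl (ENNReal.rpow_le_rpow (hFmono _ _ Finset.subset_union_left x) hp0.le)
    · exact mul_le_mul' le_rfl
        (ENNReal.rpow_le_rpow (hFmono _ _ Finset.subset_union_right x) hp0.le)
  rw [hint]
  have := (ENNReal.orderIsoRpow (1 / p) (by positivity)).map_iSup
    fun J => ∫⁻ x, w x * F J x ^ p ∂μ
  simp only [ENNReal.orderIsoRpow_apply] at this
  rw [this]
  exact iSup_le hfin

end Finite

/-! ### Weights, norms and the bound for sparse operators -/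

theorem tsum_indicator_le {X : Type*} {𝒮 : Set (Set X)} {F : Set X → Set X} {N : ℕ} (x : X)
    (h : {A ∈ 𝒮 | x ∈ F A}.encard ≤ N) :
    ∑' A : 𝒮, (F A).indicator (fun _ => (1 : ℝ≥0∞)) x ≤ N := by
  classical
  rw [ENNReal.tsum_eq_iSup_sum]
  refine iSup_le fun J => ?_
  have h1 : ∑ A ∈ J, (F A).indicator (fun _ => (1 : ℝ≥0∞)) x =
      ((J.filter fun A : 𝒮 => x ∈ F A.1).card : ℝ≥0∞) := by
    simp [indicator_apply]
  rw [h1]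
  have h2 : ((J.filter fun A : 𝒮 => x ∈ F A.1).card : ℕ∞) ≤ N := by
    refine le_trans ?_ h
    rw [← Set.encard_coe_eq_coe_finsetCard]
    refine Set.encard_le_encard_of_injOn (f := Subtype.val) (fun A hA => ?_)
      Subtype.val_injective.injOn
    rw [Finset.mem_coe, Finset.mem_filter] at hA
    exact ⟨A.2, hA.2⟩
  exact_mod_cast h2

section Norms

variable {X : Type*} [MeasurableSpace X] {μ : Measure X}

/-- A change on a null set removes the values `0` and `∞`, so that exponents of the weight can be
added at every point. -/
theorem IsWeight.exists_isDualPair {w : X → ℝ≥0∞} (hw : IsWeight μ w) (p : ℝ) :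
    ∃ w' v' : X → ℝ≥0∞, IsDualPair p w' v' ∧ w' =ᵐ[μ] w := by
  set u := hw.aemeasurable.mk w with hu
  have hum : Measurable u := hw.aemeasurable.measurable_mk
  set S : Set X := u ⁻¹' {0, ∞} with hS
  have hSm : MeasurableSet S := hum ((measurableSet_singleton _).union (measurableSet_singleton _))
  classical
  refine ⟨S.piecewise (fun _ => 1) u, fun x => (S.piecewise (fun _ => 1) u x) ^ (-1 / (p - 1)),
    ⟨Measurable.piecewise hSm measurable_const hum, fun x => ?_, fun x => ?_, fun _ => rfl⟩, ?_⟩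
  · by_cases hx : x ∈ S
    · simp [hx]
    · rw [piecewise_eq_of_notMem _ _ _ hx]
      exact fun h => hx (Or.inl h)
  · by_cases hx : x ∈ S
    · simp [hx]
    · rw [piecewise_eq_of_notMem _ _ _ hx]
      exact fun h => hx (Or.inr h)
  · filter_upwards [hw.aemeasurable.ae_eq_mk, hw.ae_pos, hw.ae_lt_top] with x hx h0 ht
    have : x ∉ S := by
      rintro (h | h)
      · rw [hx, ← hu, h] at h0; exact lt_irrefl _ h0
      · rw [hx, ← hu, h] at ht; exact lt_irrefl _ ht
    rw [piecewise_eq_of_notMem _ _ _ this, hx]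

theorem mean_mul_le_apChar {ℬ : Set (Set X)} {p : ℝ} {w w' v' : X → ℝ≥0∞}
    (hw' : IsDualPair p w' v') (h : w' =ᵐ[μ] w) {B : Set X} (hB : B ∈ ℬ) :
    mean μ w' B * mean μ v' B ^ (p - 1) ≤ apChar μ ℬ p w := by
  unfold apChar
  refine le_trans (le_of_eq ?_) (le_biSup _ hB)
  unfold mean
  have h1 : ∫⁻ x in B, w' x ∂μ = ∫⁻ x in B, w x ∂μ := lintegral_congr_ae (ae_restrict_of_ae h)
  have h2 : ∫⁻ x in B, v' x ∂μ = ∫⁻ x in B, w x ^ (-1 / (p - 1)) ∂μ := by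
    refine lintegral_congr_ae (ae_restrict_of_ae ?_)
    filter_upwards [h] with x hx
    rw [hw'.dual, hx]
  rw [h1, h2]

theorem mean_congr_ae {f g : X → ℝ≥0∞} (h : f =ᵐ[μ] g) (A : Set X) : mean μ f A = mean μ g A := by
  unfold mean
  rw [lintegral_congr_ae (ae_restrict_of_ae h)]

/-- A function in `L^p(w)` and a measurable representative of its absolute value. -/
theorem exists_measurable_enorm {p : ℝ} (hp : 1 < p) {w v : X → ℝ≥0∞} (hw : IsDualPair p w v)
    {f : X → ℝ} (hf : MemLp f (ENNReal.ofReal p) (μ.withDensity w)) :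
    AEStronglyMeasurable f μ ∧ ∃ F : X → ℝ≥0∞, Measurable F ∧ F =ᵐ[μ] (fun x => ‖f x‖ₑ) ∧
      eLpNorm f (ENNReal.ofReal p) (μ.withDensity w) = (∫⁻ x, w x * F x ^ p ∂μ) ^ (1 / p) ∧
      ∫⁻ x, w x * F x ^ p ∂μ ≠ ∞ := by
  have hp0 : 0 < p := by linarith
  -- Positivity of `w` makes the null sets of `w dμ` null for `μ`, so measurability up to null sets
  -- passes back to `μ`.
  have hac : μ ≪ μ.withDensity w := withDensity_absolutelyContinuous' hw.measurable.aemeasurable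
    (Filter.Eventually.of_forall hw.pos)
  have hfm : AEStronglyMeasurable f μ := hf.1.mono_ac hac
  refine ⟨hfm, ?_⟩
  have hem := hfm.enorm
  refine ⟨hem.mk _, hem.measurable_mk, hem.ae_eq_mk.symm, ?_⟩
  have h1 : eLpNorm f (ENNReal.ofReal p) (μ.withDensity w) =
      (∫⁻ x, w x * (hem.mk _ x) ^ p ∂μ) ^ (1 / p) := by
    rw [eLpNorm_eq_lintegral_rpow_enorm_toReal (by simpa using hp0) (by simp),
      ENNReal.toReal_ofReal hp0.le, ← lintegral_withDensity hw.measurable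
        (hem.measurable_mk.pow_const _)]
    congr 1
    refine lintegral_congr_ae ?_
    filter_upwards [(withDensity_absolutelyContinuous μ w).ae_le hem.ae_eq_mk] with x hx
    rw [← hx]
  refine ⟨h1, fun h => ?_⟩
  have := hf.2
  rw [h1, h, ENNReal.top_rpow_of_pos (by positivity)] at this
  exact lt_irrefl _ this

/-- The outer norm is monotone and agrees with the usual norm on measurable functions, by the layer
cake formula. A measurable majorant therefore suffices, and `T f` itself need not be measurable. -/
theorem outerLpNorm_le {p : ℝ} (hp : 1 < p) {w : X → ℝ≥0∞} (hw : Measurable w)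
    {g H : X → ℝ≥0∞} (hH : Measurable H) (hg : ∀ᵐ x ∂μ, g x ≤ H x) :
    outerLpNorm p (μ.withDensity w) g ≤ (∫⁻ x, w x * H x ^ p ∂μ) ^ (1 / p) := by
  have hp0 : 0 < p := by linarith
  unfold outerLpNorm
  rw [← lintegral_withDensity hw (hH.pow_const _), lintegral_rpow_layer _ hH hp0]
  gcongr ?_ ^ (1 / p)
  refine mul_le_mul' le_rfl (lintegral_mono fun t => mul_le_mul' le_rfl (measure_mono_ae ?_))
  filter_upwards [(withDensity_absolutelyContinuous μ w).ae_le hg] with x hx h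
  exact lt_of_lt_of_le h hx

/-- The integrals over the members of a family with bounded overlap. -/
theorem tsum_setLIntegral_le {𝒜 : Set (Set X)} (hm : ∀ A ∈ 𝒜, MeasurableSet A) {D : ℕ}
    (hD : ∀ x, {A ∈ 𝒜 | x ∈ A}.encard ≤ D) {h : X → ℝ≥0∞} (hh : Measurable h) :
    ∑' A : 𝒜, ∫⁻ x in A, h x ∂μ ≤ D * ∫⁻ x, h x ∂μ := by
  rw [ENNReal.tsum_eq_iSup_sum]
  exact iSup_le fun J => sum_setLIntegral_le μ (B := fun A : 𝒜 => (A : Set X)) (fun A => hm A A.2)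
    hh fun x =>
      (ENNReal.sum_le_tsum J).trans (tsum_indicator_le (F := id) x (hD x))

/-- The integrals over the sets are positive terms of a finite sum. -/
theorem countable_of_overlap {𝒜 : Set (Set X)} (hm : ∀ A ∈ 𝒜, MeasurableSet A) {D : ℕ}
    (hD : ∀ x, {A ∈ 𝒜 | x ∈ A}.encard ≤ D) {h : X → ℝ≥0∞} (hh : Measurable h)
    (hfin : ∫⁻ x, h x ∂μ ≠ ∞) (hpos : ∀ A ∈ 𝒜, ∫⁻ x in A, h x ∂μ ≠ 0) : 𝒜.Countable := by
  have h1 := Summable.countable_support_ennreal (ne_top_of_le_ne_top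
    (ENNReal.mul_ne_top (ENNReal.natCast_ne_top D) hfin) (tsum_setLIntegral_le (μ := μ) hm hD hh))
  have h2 : (Function.support fun A : 𝒜 => ∫⁻ x in A, h x ∂μ) = univ :=
    eq_univ_of_forall fun A => hpos A A.2
  rw [h2, countable_univ_iff] at h1
  exact countable_coe_iff.1 h1

/-- The members of a sparse family that meet the support of a function in `L^p(w)` are
countable. -/
theorem countable_of_sparse {ℬ : Set (Set X)} (hℬ : ∀ B ∈ ℬ, MeasurableSet B ∧ 0 < μ B ∧ μ B < ∞)
    {D : ℕ} (hD : Besicovitch ℬ D) {𝒮 : Set (Set X)} (h𝒮 : 𝒮 ⊆ ℬ) {E : Set X → Set X}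
    (hE : ∀ B ∈ 𝒮, E B ⊆ B ∧ MeasurableSet (E B) ∧ μ (E B) ≠ 0) (hdis : 𝒮.PairwiseDisjoint E)
    {h : X → ℝ≥0∞} (hh : Measurable h) (hfin : ∫⁻ x, h x ∂μ ≠ ∞)
    (hpos : ∀ B ∈ 𝒮, ∫⁻ x in B, h x ∂μ ≠ 0) : 𝒮.Countable := by
  obtain ⟨𝒜, h𝒜, hU, hov⟩ := hD 𝒮 h𝒮
  have hc : 𝒜.Countable := countable_of_overlap (fun A hA => (hℬ A (h𝒮 (h𝒜 hA))).1) hov hh hfin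
    fun A hA => hpos A (h𝒜 hA)
  -- Although `𝒮` itself may overlap without bound, its disjoint parts `E B` can meet each set of
  -- the countable thinned family in positive measure only countably often.
  have hcA : ∀ A ∈ 𝒜, {B : 𝒮 | 0 < μ (E B ∩ A)}.Countable := by
    intro A hA
    have hA' := hℬ A (h𝒮 (h𝒜 hA))
    refine Measure.countable_meas_pos_of_disjoint_of_meas_iUnion_ne_top μ
      (fun B : 𝒮 => ((hE B B.2).2.1).inter hA'.1) (fun B B' hne => ?_)
      (ne_top_of_le_ne_top hA'.2.2.ne (measure_mono (iUnion_subset fun B => inter_subset_right)))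
    exact (hdis B.2 B'.2 (fun h => hne (Subtype.ext h))).mono inter_subset_left inter_subset_left
  have hcov : (univ : Set 𝒮) ⊆ ⋃ A ∈ 𝒜, {B : 𝒮 | 0 < μ (E B ∩ A)} := by
    intro B _
    by_contra hcon
    simp only [mem_iUnion, mem_ofPred_eq, not_exists, not_lt, nonpos_iff_eq_zero] at hcon
    refine (hE B B.2).2.2 ?_
    have hsub : E B ⊆ ⋃ A ∈ 𝒜, E B ∩ A := by
      intro x hx
      have : x ∈ ⋃₀ 𝒜 := hU ▸ ⟨B, B.2, (hE B B.2).1 hx⟩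
      obtain ⟨A, hA, hxA⟩ := this
      simp only [mem_iUnion]
      exact ⟨A, hA, hx, hxA⟩
    exact measure_mono_null hsub ((measure_biUnion_null_iff hc).2 hcon)
  have := (hc.biUnion hcA).mono hcov
  rw [countable_univ_iff] at this
  exact countable_coe_iff.1 this

end Norms

/-- The weighted bound for sparse operators. -/
theorem strongNorm_sparseOp_le {X : Type*} [MeasurableSpace X] {μ : Measure X} {ℬ : Set (Set X)}
    {D : ℕ} (hℬ : ∀ B ∈ ℬ, MeasurableSet B ∧ 0 < μ B ∧ μ B < ∞) (hD : Besicovitch ℬ D)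
    {γ : ℝ≥0} (hγ : 0 < γ) {𝒮 : Set (Set X)} (h𝒮 : IsSparse μ ℬ γ 𝒮) {p : ℝ} (hp : 1 < p)
    {w : X → ℝ≥0∞} (hw : IsApWeight μ ℬ p w) :
    strongNorm p (μ.withDensity w) (sparseOp μ 𝒮) ≤ normBound p γ 1 D (apChar μ ℬ p w) := by
  have hp0 : 0 < p := by linarith
  obtain ⟨w', v', hpair, hae⟩ := hw.1.exists_isDualPair p
  rw [← withDensity_congr_ae hae]
  refine iSup₂_le fun f hf => ENNReal.div_le_of_le_mul ?_
  obtain ⟨-, F, hFm, hFf, hFn, hFt⟩ := exists_measurable_enorm hp hpair hf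
  rw [hFn]
  obtain ⟨h𝒮ℬ, E, hE, hdis⟩ := h𝒮
  have havg : ∀ A, avg μ f A = mean μ F A := fun A => (mean_congr_ae hFf A).symm
  -- Sets with vanishing average contribute nothing; without them the family becomes countable.
  set 𝒯 : Set (Set X) := {B ∈ 𝒮 | mean μ F B ≠ 0} with h𝒯
  have h𝒯𝒮 : 𝒯 ⊆ 𝒮 := sep_subset _ _
  have hh : Measurable fun x => w' x * F x ^ p := hpair.measurable.mul (hFm.pow_const _)
  have hγ0 : (γ : ℝ≥0∞) ≠ 0 := by exact_mod_cast hγ.ne'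
  have hEpos : ∀ B ∈ 𝒯, μ (E B) ≠ 0 := fun B hB h => by
    have h1 := (hE B (h𝒯𝒮 hB)).2.2
    rw [h, nonpos_iff_eq_zero, mul_eq_zero] at h1
    rcases h1 with h1 | h1
    · exact hγ0 h1
    · exact (hℬ B (h𝒮ℬ (h𝒯𝒮 hB))).2.1.ne' h1
  have hcount : 𝒯.Countable := by
    refine countable_of_sparse hℬ hD (h𝒯𝒮.trans h𝒮ℬ) (E := E) (fun B hB =>
      ⟨(hE B (h𝒯𝒮 hB)).1, (hE B (h𝒯𝒮 hB)).2.1, hEpos B hB⟩) (hdis.subset h𝒯𝒮) hh hFt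
      fun B hB h0 => hB.2 ?_
    rw [lintegral_eq_zero_iff hh] at h0
    unfold mean
    have : ∫⁻ x in B, F x ∂μ = 0 := by
      rw [lintegral_eq_zero_iff hFm]
      filter_upwards [h0] with x hx
      have : F x ^ p = 0 := by simpa [hpair.pos x] using hx
      simpa [ENNReal.rpow_eq_zero_iff, hp0, hp0.not_gt] using this
    rw [this, ENNReal.zero_div]
  have := hcount.to_subtype
  have hop : ∀ x, sparseOp μ 𝒮 f x = meanSum μ (fun A : 𝒯 => (A : Set X)) F x := by
    intro x
    unfold sparseOp meanSum
    simp only [havg]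
    rw [tsum_subtype 𝒮 fun A => A.indicator (fun _ => mean μ F A) x,
      tsum_subtype 𝒯 fun A => A.indicator (fun _ => mean μ F A) x]
    congr 1; ext A
    by_cases hA : A ∈ 𝒮
    · by_cases h0 : mean μ F A = 0
      · rw [indicator_of_mem hA, indicator_of_notMem (fun h : A ∈ 𝒯 => h.2 h0), h0]
        simp
      · rw [indicator_of_mem hA, indicator_of_mem (show A ∈ 𝒯 from ⟨hA, h0⟩)]
    · rw [indicator_of_notMem hA, indicator_of_notMem fun h => hA (h𝒯𝒮 h)]
  have hmem : ∀ A : 𝒯, (A : Set X) ∈ ℬ := fun A => h𝒮ℬ (h𝒯𝒮 A.2)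
  have hHm : Measurable (meanSum μ (fun A : 𝒯 => (A : Set X)) F) :=
    Measurable.tsum fun A => measurable_const.indicator (hℬ A (hmem A)).1
  refine (outerLpNorm_le hp hpair.measurable hHm
    (Filter.Eventually.of_forall fun x => (hop x).le)).trans ?_
  refine meanSum_le (B := fun A : 𝒯 => (A : Set X)) (fun A => (hℬ A (hmem A)).1)
    (fun A => (hℬ A (hmem A)).2.1)
    (fun A => (hℬ A (hmem A)).2.2) hD hmem (E := fun A : 𝒯 => E A.1) hγ
    ⟨fun A => (hE A (h𝒯𝒮 A.2)).1, fun A => (hE A (h𝒯𝒮 A.2)).2.1, fun A => (hE A (h𝒯𝒮 A.2)).2.2,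
      fun x => ?_⟩ hp hpair hw.2.ne (fun A => mean_mul_le_apChar hpair hae (hmem A)) hFm hFt
  classical
  by_cases hx : ∃ A : 𝒯, x ∈ E A
  · obtain ⟨A, hA⟩ := hx
    rw [tsum_eq_single A fun A' hne => indicator_of_notMem (fun h => ?_) _]
    · rw [indicator_of_mem hA]; simp
    · exact (disjoint_left.1 (hdis (h𝒯𝒮 A'.2) (h𝒯𝒮 A.2) fun e => hne (Subtype.ext e))) h hA
  · push Not at hx
    rw [ENNReal.tsum_eq_zero.2 fun A => indicator_of_notMem (hx A) _]
    exact zero_le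

/-! ### Ball-bases with the Besicovitch condition -/

theorem measure_sUnion_le_tsum {X : Type*} [MeasurableSpace X] {μ : Measure X} {𝒜 : Set (Set X)}
    (h : 𝒜.Countable) : μ (⋃₀ 𝒜) ≤ ∑' A : 𝒜, μ A := by
  have := h.to_subtype
  rw [sUnion_eq_iUnion]
  exact measure_iUnion_le _

section BallBasis

variable {X : Type*} [MeasurableSpace X] {μ : Measure X} {ℬ : Set (Set X)}
  {hull : Set X → Set X} {K : ℝ≥0} {D : ℕ}

theorem IsBallBasis.nonempty (h : IsBallBasis μ ℬ hull K) {B : Set X} (hB : B ∈ ℬ) : B.Nonempty :=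
  nonempty_of_measure_ne_zero (h.measure_pos B hB).ne'

theorem IsBallBasis.subset_hull_self (h : IsBallBasis μ ℬ hull K) {B : Set X} (hB : B ∈ ℬ) :
    B ⊆ hull B := by
  refine h.subset_hull B hB B hB ?_ (by rw [inter_self]; exact h.nonempty hB)
  rw [two_mul]; exact le_self_add

/-- The balls through one point cover the space, and a thinned collection of them has at most `D`
members because all contain that point. The hull of the member of largest measure contains the
others. In particular the measure is finite. -/
theorem IsBallBasis.univ_mem [Nonempty X] (h : IsBallBasis μ ℬ hull K) (hD : Besicovitch ℬ D) :
    univ ∈ ℬ := by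
  obtain ⟨x₀⟩ := ‹Nonempty X›
  obtain ⟨𝒜, h𝒜, hU, hov⟩ := hD {B ∈ ℬ | x₀ ∈ B} (sep_subset _ _)
  have hUuniv : ⋃₀ 𝒜 = univ := by
    rw [hU]
    refine eq_univ_of_forall fun x => ?_
    obtain ⟨B, hB, hx₀, hx⟩ := h.exists_mem_mem x₀ x
    exact ⟨B, ⟨hB, hx₀⟩, hx⟩
  have hfin : 𝒜.Finite := by
    have e : {A ∈ 𝒜 | x₀ ∈ A} = 𝒜 := by
      ext A; exact ⟨fun hA => hA.1, fun hA => ⟨hA, (h𝒜 hA).2⟩⟩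
    have := hov x₀
    rw [e] at this
    exact finite_of_encard_le_coe this
  have hne : 𝒜.Nonempty := by
    obtain ⟨A, hA, -⟩ : x₀ ∈ ⋃₀ 𝒜 := hUuniv ▸ mem_univ x₀
    exact ⟨A, hA⟩
  obtain ⟨B, hB, hmax⟩ := exists_max_image 𝒜 μ hfin hne
  have hBℬ := (h𝒜 hB).1
  have : hull B = univ := by
    refine eq_univ_of_univ_subset ?_
    rw [← hUuniv]
    refine sUnion_subset fun A hA => h.subset_hull B hBℬ A (h𝒜 hA).1 ?_
      ⟨x₀, (h𝒜 hA).2, (h𝒜 hB).2⟩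
    exact (hmax A hA).trans (by rw [two_mul]; exact le_self_add)
  rw [← this]
  exact h.hull_mem B hBℬ

/-- Balls with a given property that are maximal with respect to inclusion. -/
theorem IsBallBasis.exists_maximal (h : IsBallBasis μ ℬ hull K) (hD : Besicovitch ℬ D)
    (P : Set X → Prop) {B : Set X} (hB : B ∈ ℬ) (hP : P B) :
    ∃ B' ∈ ℬ, B ⊆ B' ∧ P B' ∧ ∀ R ∈ ℬ, B' ⊂ R → ¬ P R := by
  -- The balls of an increasing sequence share a point, so finitely many of them already have the
  -- same union; the largest of these ends the chain.
  have hwf : WellFoundedGT ℬ := by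
    rw [wellFoundedGT_iff_monotone_chain_condition]
    intro a
    obtain ⟨𝒜, h𝒜, hU, hov⟩ := hD (range fun n => (a n : Set X))
      (by rintro _ ⟨n, rfl⟩; exact (a n).2)
    obtain ⟨x₀, hx₀⟩ := h.nonempty (a 0).2
    have hfin : 𝒜.Finite := by
      have e : {A ∈ 𝒜 | x₀ ∈ A} = 𝒜 := by
        ext A
        refine ⟨fun hA => hA.1, fun hA => ⟨hA, ?_⟩⟩
        obtain ⟨n, rfl⟩ := h𝒜 hA
        exact a.monotone (Nat.zero_le n) hx₀
      have := hov x₀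
      rw [e] at this
      exact finite_of_encard_le_coe this
    have hbound : ∃ n, ∀ A ∈ 𝒜, A ⊆ a n := by
      choose! k hk using fun A (hA : A ∈ 𝒜) => h𝒜 hA
      obtain ⟨n, hn⟩ := (hfin.image k).bddAbove
      refine ⟨n, fun A hA => ?_⟩
      rw [← hk A hA]
      exact a.monotone (hn ⟨A, hA, rfl⟩)
    obtain ⟨n, hn⟩ := hbound
    refine ⟨n, fun m hm => le_antisymm (a.monotone hm) ?_⟩
    have h1 : (a m : Set X) ⊆ ⋃₀ 𝒜 := by
      rw [hU]; exact subset_sUnion_of_mem ⟨m, rfl⟩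
    exact h1.trans (sUnion_subset hn)
  obtain ⟨B', ⟨hBB', hPB'⟩, hmax⟩ :=
    hwf.wf.has_min {B' : ℬ | B ⊆ B' ∧ P B'} ⟨⟨B, hB⟩, subset_rfl, hP⟩
  exact ⟨B', B'.2, hBB', hPB', fun R hR hlt hPR =>
    hmax ⟨R, hR⟩ ⟨hBB'.trans hlt.1, hPR⟩ hlt⟩

/-- The measures of a thinned collection add up to at most `D` times the finite total measure, which
forces countability. Together with the integral bound this takes the place of a covering lemma
below. -/
theorem IsBallBasis.exists_countable_subfamily [IsFiniteMeasure μ] (h : IsBallBasis μ ℬ hull K)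
    (hD : Besicovitch ℬ D) {𝒜 : Set (Set X)} (h𝒜 : 𝒜 ⊆ ℬ) :
    ∃ 𝒜' ⊆ 𝒜, 𝒜'.Countable ∧ ⋃₀ 𝒜' = ⋃₀ 𝒜 ∧ ∀ f : X → ℝ≥0∞, Measurable f →
      ∑' A : 𝒜', ∫⁻ x in A, f x ∂μ ≤ D * ∫⁻ x, f x ∂μ := by
  obtain ⟨𝒜', h𝒜', hU, hov⟩ := hD 𝒜 h𝒜
  have hm : ∀ A ∈ 𝒜', MeasurableSet A := fun A hA => h.measurableSet A (h𝒜 (h𝒜' hA))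
  refine ⟨𝒜', h𝒜', ?_, hU, fun f hf => tsum_setLIntegral_le hm hov hf⟩
  refine countable_of_overlap (μ := μ) (h := fun _ => 1) hm hov measurable_const (by simp)
    fun A hA => ?_
  simpa using (h.measure_pos A (h𝒜 (h𝒜' hA))).ne'

/-- The density theorem for ball-bases. -/
theorem IsBallBasis.ae_exists_dense [IsFiniteMeasure μ] (h : IsBallBasis μ ℬ hull K)
    (hD : Besicovitch ℬ D) {E : Set X} (hE : MeasurableSet E) :
    ∀ᵐ x ∂μ, x ∈ E → ∃ B ∈ ℬ, x ∈ B ∧ μ B ≤ 2 * μ (B ∩ E) := by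
  set 𝒜 : Set (Set X) := {B ∈ ℬ | μ B ≤ 2 * μ (B ∩ E)} with h𝒜
  obtain ⟨𝒜', h𝒜', hc, hU, -⟩ := h.exists_countable_subfamily hD (sep_subset ℬ _ : 𝒜 ⊆ ℬ)
  have hUm : MeasurableSet (⋃₀ 𝒜) := by
    rw [← hU]
    exact MeasurableSet.sUnion hc fun A hA => h.measurableSet A (h𝒜' hA).1
  set F := E \ ⋃₀ 𝒜 with hF
  have hFm : MeasurableSet F := hE.diff hUm
  -- Approximate `F` by a union `V` of balls. A ball of `V` that meets `F` does not belong to `𝒜`,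
  -- so at least half of it lies in `V \ F`; after thinning, these balls have total measure at most
  -- `2 D ε`, and they cover `F ∩ V`.
  have hkey : ∀ ε : ℝ≥0∞, 0 < ε → μ F ≤ (1 + 2 * D) * ε := by
    intro ε hε
    obtain ⟨𝒞, h𝒞, h𝒞c, h𝒞ε⟩ := h.approx F hFm ε hε
    set V := ⋃₀ 𝒞 with hV
    have hVm : MeasurableSet V := MeasurableSet.sUnion h𝒞c fun A hA => h.measurableSet A (h𝒞 hA)
    obtain ⟨𝒟, h𝒟, h𝒟c, h𝒟U, h𝒟int⟩ := h.exists_countable_subfamily hD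
      ((sep_subset 𝒞 fun B => (B ∩ F).Nonempty).trans h𝒞)
    have hVF : μ (V \ F) ≤ ε := (measure_mono subset_union_right).trans h𝒞ε.le
    have hFV : μ (F \ V) ≤ ε := (measure_mono subset_union_left).trans h𝒞ε.le
    have hsum : ∑' A : 𝒟, μ A ≤ 2 * D * ε := by
      calc ∑' A : 𝒟, μ A ≤ ∑' A : 𝒟, 2 * ∫⁻ x in A, (V \ F).indicator 1 x ∂μ := by
            refine ENNReal.tsum_le_tsum fun A => ?_
            obtain ⟨hA𝒞, hAF⟩ := h𝒟 A.2
            rw [lintegral_indicator_one (hVm.diff hFm),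
              Measure.restrict_apply (hVm.diff hFm)]
            have hAV : (A : Set X) ⊆ V := subset_sUnion_of_mem hA𝒞
            have e : (V \ F) ∩ A = (A : Set X) \ F := by
              ext x; exact ⟨fun hx => ⟨hx.2, hx.1.2⟩, fun hx => ⟨⟨hAV hx.1, hx.2⟩, hx.1⟩⟩
            rw [e]
            have hnot : ¬ μ A ≤ 2 * μ (A ∩ E) := fun hle => by
              obtain ⟨x, hxA, hxF⟩ := hAF
              exact hxF.2 ⟨A, ⟨h𝒞 hA𝒞, hle⟩, hxA⟩
            have h1 : 2 * μ (A ∩ F) < μ A := lt_of_le_of_lt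
              (mul_le_mul' le_rfl (measure_mono (inter_subset_inter_right _ sdiff_subset)))
              (not_le.1 hnot)
            have h2 : μ A = μ (A ∩ F) + μ (A \ F) := (measure_inter_add_sdiff _ hFm).symm
            by_contra hcon
            rw [not_le] at hcon
            have h3 : 2 * μ (A ∩ F) + 2 * μ (A \ F) < μ A + μ A := ENNReal.add_lt_add h1 hcon
            rw [← mul_add, ← h2, two_mul] at h3
            exact lt_irrefl _ h3
        _ = 2 * ∑' A : 𝒟, ∫⁻ x in A, (V \ F).indicator 1 x ∂μ := ENNReal.tsum_mul_left
        _ ≤ 2 * (D * ∫⁻ x, (V \ F).indicator 1 x ∂μ) :=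
            mul_le_mul' le_rfl (h𝒟int _ (measurable_one.indicator (hVm.diff hFm)))
        _ ≤ 2 * D * ε := by
            rw [lintegral_indicator_one (hVm.diff hFm), mul_assoc]
            gcongr
    have hFV' : μ (F ∩ V) ≤ 2 * D * ε := by
      refine le_trans (measure_mono ?_) ((measure_sUnion_le_tsum h𝒟c).trans hsum)
      rw [h𝒟U]
      rintro x ⟨hxF, B, hB, hxB⟩
      exact ⟨B, ⟨hB, x, hxB, hxF⟩, hxB⟩
    calc μ F = μ (F ∩ V) + μ (F \ V) := (measure_inter_add_sdiff _ hVm).symm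
      _ ≤ 2 * D * ε + ε := add_le_add hFV' hFV
      _ = _ := by ring
  have hF0 : μ F = 0 := by
    refine nonpos_iff_eq_zero.1 (le_of_forall_gt_imp_ge_of_dense fun ε hε => ?_)
    have hc0 : (1 + 2 * (D : ℝ≥0∞)) ≠ 0 := by simp
    have hct : (1 + 2 * (D : ℝ≥0∞)) ≠ ∞ := by finiteness
    have := hkey (ε / (1 + 2 * D)) (ENNReal.div_pos hε.ne' hct)
    rwa [ENNReal.mul_div_cancel hc0 hct] at this
  rw [ae_iff]
  refine measure_mono_null (fun x hx => ?_) hF0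
  simp only [mem_ofPred_eq, Classical.not_imp] at hx
  refine ⟨hx.1, fun ⟨B, hB, hxB⟩ => hx.2 ⟨B, hB.1, hxB, hB.2⟩⟩

/-! ### Bounded oscillation operators -/

variable {T : (X → ℝ) → X → ℝ}

/-- A form of the weak type inequality that includes the level `s = 0`. There the set is a countable
union of level sets at positive heights, each of them null. -/
theorem weak_type {L : ℝ≥0∞} (hL : weakNorm μ T ≤ L) (hLt : L ≠ ∞) {g : X → ℝ}
    (hg : Integrable g μ) {s m : ℝ≥0∞} (hst : s ≠ ∞) (hsm : L * ∫⁻ x, ‖g x‖ₑ ∂μ ≤ s * m) :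
    μ {x | s < ‖T g x‖ₑ} ≤ m := by
  have hgt : eLpNorm g 1 μ ≠ ∞ := (memLp_one_iff_integrable.2 hg).2.ne
  have key : ∀ t : ℝ, 0 < t → ENNReal.ofReal t * μ {x | t < |T g x|} ≤ s * m := by
    intro t ht
    refine le_trans ?_ hsm
    rw [← eLpNorm_one_eq_lintegral_enorm]
    have h1 : ENNReal.ofReal t * μ {x | t < |T g x|} / eLpNorm g 1 μ ≤ L := by
      refine le_trans ?_ hL
      unfold weakNorm
      exact le_iSup₂_of_le t ht (le_iSup₂_of_le g hg le_rfl)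
    exact (ENNReal.div_le_iff_le_mul (Or.inr hLt) (Or.inl hgt)).1 h1
  by_cases hs : s = 0
  · rw [hs, zero_mul] at key
    have hsub : {x | s < ‖T g x‖ₑ} ⊆ ⋃ n : ℕ, {x | 1 / ((n : ℝ) + 1) < |T g x|} := by
      intro x hx
      have hx' : 0 < |T g x| := by
        have : s < ‖T g x‖ₑ := hx
        rw [hs, enorm_pos] at this
        exact abs_pos.2 this
      obtain ⟨n, hn⟩ := exists_nat_one_div_lt hx'
      exact mem_iUnion.2 ⟨n, hn⟩
    have h0 : μ {x | s < ‖T g x‖ₑ} = 0 := by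
      refine measure_mono_null hsub (measure_iUnion_null fun n => ?_)
      have hn : (0 : ℝ) < 1 / ((n : ℝ) + 1) := by positivity
      have := nonpos_iff_eq_zero.1 (key _ hn)
      rw [mul_eq_zero] at this
      exact this.resolve_left (by simpa using hn)
    rw [h0]; exact zero_le
  · have hpos := ENNReal.toReal_pos hs hst
    have h1 := key _ hpos
    rw [ENNReal.ofReal_toReal hst] at h1
    have e : {x | s < ‖T g x‖ₑ} = {x | s.toReal < |T g x|} := by
      ext x
      change s < ‖T g x‖ₑ ↔ s.toReal < |T g x|
      rw [Real.enorm_eq_ofReal_abs, ← ENNReal.lt_ofReal_iff_toReal_lt hst]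
    rw [e]
    exact (ENNReal.mul_le_mul_iff_right hs hst).1 h1

/-- Off a set of small measure, `T g` and the averages of `g` are bounded. -/
theorem IsBallBasis.exists_bad_set [IsFiniteMeasure μ] (h : IsBallBasis μ ℬ hull K)
    (hD : Besicovitch ℬ D) {L : ℝ≥0∞} (hL : weakNorm μ T ≤ L) (hLt : L ≠ ∞) {g : X → ℝ}
    (hg : Integrable g μ) {b m : ℝ≥0∞} (hbt : b ≠ ∞)
    (hbm : (D + 1) * ∫⁻ x, ‖g x‖ₑ ∂μ ≤ b * m) :
    ∃ E, MeasurableSet E ∧ μ E ≤ 2 * m ∧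
      ∀ x ∉ E, ‖T g x‖ₑ ≤ L * b ∧ ∀ B ∈ ℬ, x ∈ B → avg μ g B ≤ b := by
  -- The summands `1` and `D` of `D + 1` pay for the weak type of `T` and for the thinned balls with
  -- large average. Each exceptional set has measure at most `m`; the first may be nonmeasurable and
  -- is later replaced by its measurable hull.
  have h1 : μ {x | L * b < ‖T g x‖ₑ} ≤ m := by
    refine weak_type hL hLt hg (ENNReal.mul_ne_top hLt hbt) ?_
    rw [mul_assoc]
    refine mul_le_mul' le_rfl (le_trans ?_ hbm)
    nth_rw 1 [← one_mul (∫⁻ x, ‖g x‖ₑ ∂μ)]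
    gcongr
    exact le_add_self
  obtain ⟨𝒜, h𝒜, hc, hU, hint⟩ := h.exists_countable_subfamily hD
    (sep_subset ℬ fun B => b < avg μ g B)
  have hgm := hg.1.enorm
  have hcong : ∀ A : Set X, ∫⁻ x in A, hgm.mk _ x ∂μ = ∫⁻ x in A, ‖g x‖ₑ ∂μ := fun A =>
    (lintegral_congr_ae (ae_restrict_of_ae hgm.ae_eq_mk)).symm
  have h2 : ∑' A : 𝒜, ∫⁻ x in A, ‖g x‖ₑ ∂μ ≤ b * m := by
    have := hint _ hgm.measurable_mk
    simp_rw [hcong] at this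
    rw [← lintegral_congr_ae hgm.ae_eq_mk] at this
    refine this.trans (le_trans ?_ hbm)
    gcongr
    exact le_self_add
  have h3 : ∀ A ∈ 𝒜, b * μ A ≤ ∫⁻ x in A, ‖g x‖ₑ ∂μ := fun A hA =>
    ENNReal.mul_le_of_le_div (h𝒜 hA).2.le
  have h4 : μ (⋃₀ 𝒜) ≤ m := by
    by_cases hb : b = 0
    · have : 𝒜 = ∅ := by
        refine eq_empty_of_forall_notMem fun A hA => ?_
        rw [hb, zero_mul, nonpos_iff_eq_zero, ENNReal.tsum_eq_zero] at h2
        have h5 := (h𝒜 hA).2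
        rw [avg, h2 ⟨A, hA⟩, ENNReal.zero_div] at h5
        exact not_lt_zero h5
      rw [this]; simp
    · refine (ENNReal.mul_le_mul_iff_right hb hbt).1 ?_
      calc b * μ (⋃₀ 𝒜) ≤ b * ∑' A : 𝒜, μ A := by gcongr; exact measure_sUnion_le_tsum hc
        _ = ∑' A : 𝒜, b * μ A := ENNReal.tsum_mul_left.symm
        _ ≤ _ := (ENNReal.tsum_le_tsum fun A : 𝒜 => h3 A A.2).trans h2
  refine ⟨toMeasurable μ {x | L * b < ‖T g x‖ₑ} ∪ ⋃₀ 𝒜, (measurableSet_toMeasurable _ _).union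
    (MeasurableSet.sUnion hc fun A hA => h.measurableSet A (h𝒜 hA).1), ?_, fun x hx => ⟨?_, ?_⟩⟩
  · refine (measure_union_le _ _).trans ?_
    rw [measure_toMeasurable, two_mul]
    exact add_le_add h1 h4
  · by_contra hcon
    exact hx (Or.inl (subset_toMeasurable _ _ (not_le.1 hcon)))
  · intro B hB hxB
    by_contra hcon
    refine hx (Or.inr ?_)
    rw [hU]
    exact ⟨B, ⟨hB, not_le.1 hcon⟩, hxB⟩

theorem lintegral_enorm_indicator {A : Set X} (hA : MeasurableSet A) (g : X → ℝ) :
    ∫⁻ x, ‖A.indicator g x‖ₑ ∂μ = ∫⁻ x in A, ‖g x‖ₑ ∂μ := by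
  rw [← lintegral_indicator hA]
  simp_rw [enorm_indicator_eq_indicator_enorm]

theorem IsSubadditive.enorm_add_le (hT : IsSubadditive μ T) {f g : X → ℝ} (hf : Integrable f μ)
    (hg : Integrable g μ) (x : X) : ‖T (f + g) x‖ₑ ≤ ‖T f x‖ₑ + ‖T g x‖ₑ := by
  simp only [Real.enorm_eq_ofReal_abs]
  rw [← ENNReal.ofReal_add (abs_nonneg _) (abs_nonneg _)]
  exact ENNReal.ofReal_le_ofReal (hT.abs_add_le f g hf hg x)

theorem IsSubadditive.enorm_compl_le (hT : IsSubadditive μ T) {g : X → ℝ} (hg : Integrable g μ)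
    {A : Set X} (hA : MeasurableSet A) (x : X) :
    ‖T (Aᶜ.indicator g) x‖ₑ ≤ ‖T g x‖ₑ + ‖T (A.indicator g) x‖ₑ := by
  have h1 : Aᶜ.indicator g = g + (-1 : ℝ) • A.indicator g := by
    ext y
    by_cases hy : y ∈ A <;> simp [hy]
  have h2 : ‖T ((-1 : ℝ) • A.indicator g) x‖ₑ = ‖T (A.indicator g) x‖ₑ := by
    simp only [Real.enorm_eq_ofReal_abs, hT.abs_smul (-1) _ (hg.indicator hA) x]
    simp
  rw [h1, ← h2]
  exact hT.enorm_add_le hg ((hg.indicator hA).smul _) x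

theorem avg_indicator_le {A : Set X} (g : X → ℝ) (B : Set X) :
    avg μ (A.indicator g) B ≤ avg μ g B := by
  unfold avg
  gcongr with x
  rw [enorm_indicator_eq_indicator_enorm]
  exact indicator_le_self' (fun _ _ => zero_le) x

/-- On a ball that is not mostly bad, the nonlocal part of `T g` is bounded. -/
theorem IsBallBasis.enorm_le_of_good (h : IsBallBasis μ ℬ hull K) (hT : IsSubadditive μ T)
    {L : ℝ≥0∞} (hL : weakNorm μ T ≤ L) (hL1 : locConst μ ℬ hull T ≤ L) (hLt : L ≠ ∞) {g : X → ℝ}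
    (hg : Integrable g μ) {b : ℝ≥0∞} (hbt : b ≠ ∞) {E : Set X}
    (hE : ∀ x ∉ E, ‖T g x‖ₑ ≤ L * b ∧ ∀ B ∈ ℬ, x ∈ B → avg μ g B ≤ b) {R : Set X} (hR : R ∈ ℬ)
    (hRE : 2 * μ (R ∩ E) < μ R) {Z : Set X} (hZ : MeasurableSet Z)
    (hZb : ∫⁻ x in Z, ‖g x‖ₑ ∂μ ≤ K ^ 2 * (b * μ R)) {x : X} (hx : x ∈ R) :
    ‖T ((Z ∪ hull R)ᶜ.indicator g) x‖ₑ ≤ (2 + 2 * (K ^ 2 + K)) * (L * b) := by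
  have hRh := h.hull_mem R hR
  have hRhm := h.measurableSet _ hRh
  have hZR := hZ.union hRhm
  have hgood : ∃ y ∈ R, y ∉ E := by
    by_contra hcon
    push Not at hcon
    rw [inter_eq_left.2 hcon, two_mul] at hRE
    exact absurd hRE (not_lt.2 le_self_add)
  obtain ⟨y₀, hy₀R, hy₀E⟩ := hgood
  have hRb : ∫⁻ x in hull R, ‖g x‖ₑ ∂μ ≤ K * (b * μ R) := by
    have h1 := (hE y₀ hy₀E).2 _ hRh (h.subset_hull_self hR hy₀R)
    calc ∫⁻ x in hull R, ‖g x‖ₑ ∂μ ≤ b * μ (hull R) :=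
          (ENNReal.div_le_iff (h.measure_pos _ hRh).ne' (h.measure_lt_top _ hRh).ne).1 h1
      _ ≤ b * (K * μ R) := by gcongr; exact h.measure_hull_le R hR
      _ = _ := by ring
  have hZRb : ∫⁻ x, ‖(Z ∪ hull R).indicator g x‖ₑ ∂μ ≤ (K ^ 2 + K) * (b * μ R) := by
    rw [lintegral_enorm_indicator hZR, add_mul]
    exact (lintegral_union_le _ _ _).trans (add_le_add hZb hRb)
  set s : ℝ≥0∞ := 2 * (K ^ 2 + K) * (L * b) with hs
  have hst : s ≠ ∞ := by
    refine ENNReal.mul_ne_top ?_ (ENNReal.mul_ne_top hLt hbt)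
    finiteness
  have hweak : μ {x | s < ‖T ((Z ∪ hull R).indicator g) x‖ₑ} ≤ μ R / 2 := by
    refine weak_type hL hLt (hg.indicator hZR) hst ?_
    calc L * ∫⁻ x, ‖(Z ∪ hull R).indicator g x‖ₑ ∂μ ≤ L * ((K ^ 2 + K) * (b * μ R)) := by gcongr
      _ = (K ^ 2 + K) * (L * b) * (2 * (μ R / 2)) := by
          rw [ENNReal.mul_div_cancel (by norm_num) (by norm_num)]; ring
      _ = _ := by rw [hs]; ring
  -- Fewer than half of the points of `R` are bad, and weak type excludes at most another half. So
  -- some good `y` also has a bound for the local part, which subadditivity turns into a bound for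
  -- the nonlocal part at `y`.
  have hex : ∃ y ∈ R, y ∉ E ∧ ‖T ((Z ∪ hull R).indicator g) y‖ₑ ≤ s := by
    by_contra hcon
    push Not at hcon
    have hsub : R ⊆ (R ∩ E) ∪ {x | s < ‖T ((Z ∪ hull R).indicator g) x‖ₑ} := by
      intro y hy
      by_cases hyE : y ∈ E
      · exact Or.inl ⟨hy, hyE⟩
      · exact Or.inr (hcon y hy hyE)
    have h1 : μ R ≤ μ (R ∩ E) + μ R / 2 :=
      (measure_mono hsub).trans ((measure_union_le _ _).trans (by gcongr))
    have h2 : μ R + μ R < μ R + μ R := by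
      calc μ R + μ R ≤ (μ (R ∩ E) + μ R / 2) + (μ (R ∩ E) + μ R / 2) := add_le_add h1 h1
        _ = 2 * μ (R ∩ E) + (μ R / 2 + μ R / 2) := by ring
        _ = 2 * μ (R ∩ E) + μ R := by rw [ENNReal.add_halves]
        _ < _ := by
          exact ENNReal.add_lt_add_right (h.measure_lt_top R hR).ne hRE
    exact lt_irrefl _ h2
  obtain ⟨y, hyR, hyE, hys⟩ := hex
  obtain ⟨hTy, havg⟩ := hE y hyE
  have hbasic : ‖T ((Z ∪ hull R)ᶜ.indicator g) y‖ₑ ≤ L * b + s :=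
    (hT.enorm_compl_le hg hZR y).trans (add_le_add hTy hys)
  have hmax : maxAvg μ ℬ (Zᶜ.indicator g) R ≤ b :=
    iSup₂_le fun A hA => iSup_le fun hRA => (avg_indicator_le g A).trans (havg A hA (hRA hyR))
  -- The localization constant concerns functions cut off by `hull R`; removing `Z` first brings the
  -- required function into this form. Averages over the balls containing `R` are at most `b`
  -- because `y` is good.
  have hind : (hull R)ᶜ.indicator (Zᶜ.indicator g) = (Z ∪ hull R)ᶜ.indicator g := by
    rw [indicator_indicator, ← compl_union, union_comm]
  have hloc : ENNReal.ofReal |T ((Z ∪ hull R)ᶜ.indicator g) x - T ((Z ∪ hull R)ᶜ.indicator g) y| ≤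
      L * b := by
    have h1 : ENNReal.ofReal |T ((hull R)ᶜ.indicator (Zᶜ.indicator g)) x -
        T ((hull R)ᶜ.indicator (Zᶜ.indicator g)) y| / maxAvg μ ℬ (Zᶜ.indicator g) R ≤ L := by
      refine le_trans ?_ hL1
      unfold locConst
      exact le_iSup₂_of_le R hR (le_iSup₂_of_le x hx (le_iSup₂_of_le y hyR
        (le_iSup₂_of_le (Zᶜ.indicator g) (hg.indicator hZ.compl) le_rfl)))
    rw [hind] at h1
    have h2 := (ENNReal.div_le_iff_le_mul (Or.inr hLt)
      (Or.inl (ne_top_of_le_ne_top hbt hmax))).1 h1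
    exact h2.trans (mul_le_mul' le_rfl hmax)
  calc ‖T ((Z ∪ hull R)ᶜ.indicator g) x‖ₑ
      ≤ ENNReal.ofReal |T ((Z ∪ hull R)ᶜ.indicator g) x - T ((Z ∪ hull R)ᶜ.indicator g) y| +
        ‖T ((Z ∪ hull R)ᶜ.indicator g) y‖ₑ := by
        rw [← Real.enorm_eq_ofReal_abs]
        refine le_trans (le_of_eq ?_) (enorm_add_le _ _)
        congr 1; ring
    _ ≤ L * b + (L * b + s) := add_le_add hloc hbasic
    _ = _ := by rw [hs]; ring

/-- On a maximal mostly bad ball contained in `P`, the part of `T g` off the hull of `P` is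
bounded. -/
theorem IsBallBasis.enorm_le_of_maximal (h : IsBallBasis μ ℬ hull K) (hT : IsSubadditive μ T)
    {L : ℝ≥0∞} (hL : weakNorm μ T ≤ L) (hL1 : locConst μ ℬ hull T ≤ L)
    (hL2 : connConst μ ℬ hull T < L) (hLt : L ≠ ∞) {g : X → ℝ}
    (hg : Integrable g μ) {b : ℝ≥0∞} (hbt : b ≠ ∞) {E : Set X}
    (hE : ∀ x ∉ E, ‖T g x‖ₑ ≤ L * b ∧ ∀ B ∈ ℬ, x ∈ B → avg μ g B ≤ b) {B P : Set X} (hB : B ∈ ℬ)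
    (hP : P ∈ ℬ) (hBP : B ⊆ P) (hmax : ∀ R ∈ ℬ, B ⊂ R → ¬ μ R ≤ 2 * μ (R ∩ E)) {x : X}
    (hx : x ∈ B) :
    ‖T ((hull P)ᶜ.indicator g) x‖ₑ ≤ (3 + 2 * (K ^ 2 + K)) * (L * b) := by
  have hc : (3 + 2 * (K ^ 2 + K) : ℝ≥0∞) * (L * b) =
      L * b + (2 + 2 * (K ^ 2 + K)) * (L * b) := by ring
  rw [hc]
  -- If `P` is strictly larger than `B`, maximality makes `P` good and the preceding estimate
  -- applies with `Z = ∅`. If `B = P`, connectivity provides a larger ball `R`, good by maximality,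
  -- and bounds the part of `g` in `hull R \ hull B`; the rest is the preceding estimate with `Z =
  -- hull B`.
  by_cases hne : B = P
  · subst hne
    by_cases hu : hull B = univ
    · have h0 : (hull B)ᶜ.indicator g = (0 : ℝ) • g := by rw [hu]; ext z; simp
      have h1 := hT.abs_smul 0 g hg x
      rw [abs_zero, zero_mul] at h1
      rw [h0, Real.enorm_eq_ofReal_abs, h1]
      simp
    · have hBh := h.hull_mem B hB
      have hBhm := h.measurableSet _ hBh
      -- The infimum over `R` need not be attained, which is why the hypothesis on `connConst` is
      -- strict.
      have h1 : (⨅ R ∈ ℬ, ⨅ (_ : B ⊂ R), ⨆ x ∈ B, ⨆ (f : X → ℝ) (_ : Integrable f μ),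
          ENNReal.ofReal |T ((hull R \ hull B).indicator f) x| / avg μ f (hull R)) < L := by
        refine lt_of_le_of_lt ?_ hL2
        unfold connConst
        exact le_iSup₂_of_le B hB (le_iSup_of_le hu le_rfl)
      simp only [iInf_lt_iff] at h1
      obtain ⟨R, hR, hBR, hlt⟩ := h1
      have hRh := h.hull_mem R hR
      have hRhm := h.measurableSet _ hRh
      have hRE : 2 * μ (R ∩ E) < μ R := not_le.1 (hmax R hR hBR)
      obtain ⟨y, hyR, hyE⟩ : ∃ y ∈ R, y ∉ E := by
        by_contra hcon
        push Not at hcon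
        rw [inter_eq_left.2 hcon, two_mul] at hRE
        exact absurd hRE (not_lt.2 le_self_add)
      have havg := (hE y hyE).2
      have hloc : ‖T ((hull R \ hull B).indicator g) x‖ₑ ≤ L * b := by
        have h2 : ENNReal.ofReal |T ((hull R \ hull B).indicator g) x| / avg μ g (hull R) ≤ L :=
          le_trans (le_iSup₂_of_le x hx (le_iSup₂ (f := fun f (_ : Integrable f μ) =>
            ENNReal.ofReal |T ((hull R \ hull B).indicator f) x| / avg μ f (hull R)) g hg)) hlt.le
        have h3 := havg _ hRh (h.subset_hull_self hR hyR)
        rw [Real.enorm_eq_ofReal_abs]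
        exact ((ENNReal.div_le_iff_le_mul (Or.inr hLt)
          (Or.inl (ne_top_of_le_ne_top hbt h3))).1 h2).trans (mul_le_mul' le_rfl h3)
      have hint : ∀ A ∈ ℬ, y ∈ A → ∫⁻ x in A, ‖g x‖ₑ ∂μ ≤ b * μ A := fun A hA hyA =>
        (ENNReal.div_le_iff (h.measure_pos _ hA).ne' (h.measure_lt_top _ hA).ne).1 (havg A hA hyA)
      obtain ⟨z, hz⟩ := h.nonempty hB
      have hzB : z ∈ hull B := h.subset_hull_self hB hz
      have hzR : z ∈ R := hBR.1 hz
      have hK1 : (1 : ℝ≥0∞) ≤ K := by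
        have h2 := h.measure_hull_le B hB
        by_contra hcon
        have h3 : (K : ℝ≥0∞) * μ B < 1 * μ B :=
          ENNReal.mul_lt_mul_left (h.measure_pos B hB).ne' (h.measure_lt_top B hB).ne
            (not_le.1 hcon)
        rw [one_mul] at h3
        exact absurd ((measure_mono (h.subset_hull_self hB)).trans h2) (not_le.2 h3)
      -- A good point lies in `R` but perhaps not in `hull B`. Depending on which is larger, either
      -- `hull (hull B)` contains `R`, or `hull R` contains `hull B`; in both cases a ball through
      -- the good point dominates.
      have hZb : ∫⁻ x in hull B, ‖g x‖ₑ ∂μ ≤ K ^ 2 * (b * μ R) := by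
        by_cases hcmp : μ R ≤ 2 * μ (hull B)
        · have hsub : R ⊆ hull (hull B) := h.subset_hull _ hBh R hR hcmp ⟨z, hzR, hzB⟩
          have hBhh := h.hull_mem _ hBh
          calc ∫⁻ x in hull B, ‖g x‖ₑ ∂μ ≤ ∫⁻ x in hull (hull B), ‖g x‖ₑ ∂μ :=
                lintegral_mono_set (h.subset_hull_self hBh)
            _ ≤ b * μ (hull (hull B)) := hint _ hBhh (hsub hyR)
            _ ≤ b * (K * (K * μ R)) := by
                gcongr
                exact (h.measure_hull_le _ hBh).trans (mul_le_mul' le_rfl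
                  ((h.measure_hull_le _ hB).trans (mul_le_mul' le_rfl (measure_mono hBR.1))))
            _ = _ := by ring
        · have hle : μ (hull B) ≤ 2 * μ R := by
            have h4 : 2 * μ (hull B) ≤ μ R := (not_le.1 hcmp).le
            calc μ (hull B) ≤ 2 * μ (hull B) := by rw [two_mul]; exact le_self_add
              _ ≤ μ R := h4
              _ ≤ 2 * μ R := by rw [two_mul]; exact le_self_add
          have hsub : hull B ⊆ hull R := h.subset_hull R hR _ hBh hle ⟨z, hzB, hzR⟩
          calc ∫⁻ x in hull B, ‖g x‖ₑ ∂μ ≤ ∫⁻ x in hull R, ‖g x‖ₑ ∂μ := lintegral_mono_set hsub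
            _ ≤ b * μ (hull R) := hint _ hRh (h.subset_hull_self hR hyR)
            _ ≤ b * (K * μ R) := by gcongr; exact h.measure_hull_le R hR
            _ = K * 1 * (b * μ R) := by ring
            _ ≤ K * K * (b * μ R) := by gcongr
            _ = _ := by ring
      have hsplit : (hull B)ᶜ.indicator g = (hull R \ hull B).indicator g +
          (hull B ∪ hull R)ᶜ.indicator g := by
        ext z
        by_cases h1 : z ∈ hull B <;> by_cases h2 : z ∈ hull R <;> simp [h1, h2]
      rw [hsplit]
      refine (hT.enorm_add_le (hg.indicator (hRhm.diff hBhm))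
        (hg.indicator (hBhm.union hRhm).compl) x).trans (add_le_add hloc ?_)
      exact h.enorm_le_of_good hT hL hL1 hLt hg hbt hE hR hRE hBhm hZb (hBR.1 hx)
  · have hBP' : B ⊂ P := lt_of_le_of_ne hBP hne
    have := h.enorm_le_of_good hT hL hL1 hLt hg hbt hE hP (not_le.1 (hmax P hP hBP'))
      MeasurableSet.empty (by simp) (hBP hx)
    rw [empty_union] at this
    exact this.trans le_add_self

end BallBasis

/-! ### Selection of a sparse family of balls -/

/-- The Vitali selection principle with all sizes declared equal, so that only the intersections
matter. -/
theorem exists_maximal_disjoint {X : Type*} {𝒞 : Set (Set X)} (h : ∀ B ∈ 𝒞, B.Nonempty) :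
    ∃ 𝒟 ⊆ 𝒞, 𝒟.PairwiseDisjoint id ∧ ∀ B ∈ 𝒞, ∃ A ∈ 𝒟, (B ∩ A).Nonempty := by
  obtain ⟨𝒟, h𝒟, hdis, hcov⟩ := Vitali.exists_disjoint_subfamily_covering_enlargement
    (id : Set X → Set X) 𝒞 (fun _ => 1) 2 (by norm_num) (fun _ _ => by norm_num) 1
    (fun _ _ => le_rfl) h
  exact ⟨𝒟, h𝒟, hdis, fun B hB => by
    obtain ⟨A, hA, hBA, -⟩ := hcov B hB
    exact ⟨A, hA, hBA⟩⟩

/-- Greedy selection, class by class, of a family of sets from the candidates that are attached to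
the sets selected before. -/
theorem exists_selection {X : Type*} {ℬ : Set (Set X)} (hne : ∀ B ∈ ℬ, B.Nonempty)
    {hull : Set X → Set X} (hhull : ∀ B ∈ ℬ, B ⊆ hull B) (cl : Set X → ℕ)
    (Cand Small : Set X → Set X → Prop) (hCand : ∀ Q ∈ ℬ, ∀ B, Cand Q B → B ∈ ℬ ∧ cl Q < cl B)
    {Q₀ : Set X} (hQ₀ : Q₀ ∈ ℬ) (hcl : cl Q₀ = 0) :
    ∃ 𝒮 ⊆ ℬ, Q₀ ∈ 𝒮 ∧ (∀ A ∈ 𝒮, ∀ B ∈ 𝒮, cl A = cl B → A ≠ B → Disjoint A B) ∧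
      (∀ B ∈ 𝒮, B ≠ Q₀ → ∃ Q ∈ 𝒮, Cand Q B ∧
        ∀ A ∈ 𝒮, cl A < cl B → (hull A ∩ B).Nonempty → ¬ Small A Q) ∧
      (∀ Q ∈ 𝒮, ∀ B, Cand Q B →
        ∃ A ∈ 𝒮, (hull A ∩ B).Nonempty ∧ cl A ≤ cl B ∧ (Small A Q ∨ cl A = cl B)) := by
  -- The sets eligible for class `n + 1`: candidates of a selected `Q` that are not met by the hull
  -- of a selected set small compared with `Q`. A maximal disjoint subfamily of these is added at
  -- each stage.
  set 𝒞 : ℕ → Set (Set X) → Set (Set X) := fun n U => {B ∈ ℬ | cl B = n + 1 ∧ ∃ Q ∈ U, Cand Q B ∧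
    ∀ A ∈ U, (hull A ∩ B).Nonempty → ¬ Small A Q} with h𝒞
  have hsel : ∀ n U, ∃ 𝒟 ⊆ 𝒞 n U, 𝒟.PairwiseDisjoint id ∧
      ∀ B ∈ 𝒞 n U, ∃ A ∈ 𝒟, (B ∩ A).Nonempty := fun n U =>
    exists_maximal_disjoint fun B hB => hne B hB.1
  choose sel hsub hdis hcov using hsel
  set U : ℕ → Set (Set X) := fun n => Nat.rec {Q₀} (fun k V => V ∪ sel k V) n with hU
  have hU0 : U 0 = {Q₀} := rfl
  have hUs : ∀ n, U (n + 1) = U n ∪ sel n (U n) := fun n => rfl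
  have hmono : Monotone U := monotone_nat_of_le_succ fun n => by
    rw [hUs]; exact subset_union_left
  have hUℬ : ∀ n, ∀ A ∈ U n, A ∈ ℬ ∧ cl A ≤ n := by
    intro n
    induction n with
    | zero =>
      intro A hA
      rw [hU0, mem_singleton_iff] at hA
      rw [hA]
      exact ⟨hQ₀, hcl.le⟩
    | succ n ih =>
      rw [hUs]
      rintro A (hA | hA)
      · exact ⟨(ih A hA).1, (ih A hA).2.trans (Nat.le_succ n)⟩
      · have := hsub n (U n) hA
        exact ⟨this.1, this.2.1.le⟩
  have hUcl : ∀ n, ∀ A ∈ U n, A ∈ U (cl A) := by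
    intro n
    induction n with
    | zero =>
      intro A hA
      rw [hU0, mem_singleton_iff] at hA
      rw [hA, hcl, hU0]
      rfl
    | succ n ih =>
      rw [hUs]
      rintro A (hA | hA)
      · exact ih A hA
      · have := (hsub n (U n) hA).2.1
        rw [this, hUs]; exact Or.inr hA
  have hlate : ∀ n, ∀ A ∈ U (n + 1), cl A = n + 1 → A ∈ sel n (U n) := by
    intro n A hA hn
    rw [hUs] at hA
    rcases hA with hA | hA
    · have := (hUℬ n A hA).2; omega
    · exact hA
  refine ⟨⋃ n, U n, iUnion_subset fun n A hA => (hUℬ n A hA).1, mem_iUnion.2 ⟨0, rfl⟩, ?_, ?_, ?_⟩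
  · intro A hA B hB hAB hne
    obtain ⟨n, hA⟩ := mem_iUnion.1 hA
    obtain ⟨m, hB⟩ := mem_iUnion.1 hB
    have hA := hUcl n A hA
    have hB := hUcl m B hB
    rw [← hAB] at hB
    rcases hc : cl A with _ | k
    · rw [hc, hU0] at hA hB
      rw [mem_singleton_iff] at hA hB
      exact absurd (hA.trans hB.symm) hne
    · rw [hc] at hA hB
      exact hdis k (U k) (hlate k A hA hc) (hlate k B hB (hAB ▸ hc)) hne
  · intro B hB hB0
    obtain ⟨m, hB⟩ := mem_iUnion.1 hB
    have hB := hUcl m B hB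
    rcases hc : cl B with _ | k
    · rw [hc, hU0] at hB
      exact absurd hB hB0
    · rw [hc] at hB
      obtain ⟨-, -, Q, hQ, hQB, hA⟩ := hsub k (U k) (hlate k B hB hc)
      refine ⟨Q, mem_iUnion.2 ⟨k, hQ⟩, hQB, fun A hA' hlt => hA A ?_⟩
      obtain ⟨n, hA'⟩ := mem_iUnion.1 hA'
      exact hmono (by omega : cl A ≤ k) (hUcl n A hA')
  · intro Q hQ B hQB
    obtain ⟨m, hQ⟩ := mem_iUnion.1 hQ
    have hQℬ := (hUℬ m Q hQ).1
    have hQ := hUcl m Q hQ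
    obtain ⟨hB, hlt⟩ := hCand Q hQℬ B hQB
    obtain ⟨k, hk⟩ : ∃ k, cl B = k + 1 := ⟨cl B - 1, by omega⟩
    -- Either a small selected set already serves `B`, or `B` was eligible and, by maximality, meets
    -- a set selected from its own class.
    by_cases hex : ∃ A ∈ U k, (hull A ∩ B).Nonempty ∧ Small A Q
    · obtain ⟨A, hA, hAB, hs⟩ := hex
      exact ⟨A, mem_iUnion.2 ⟨k, hA⟩, hAB, by have := (hUℬ k A hA).2; omega, Or.inl hs⟩
    · push Not at hex
      have hBC : B ∈ 𝒞 k (U k) := ⟨hB, hk, Q, hmono (by omega : cl Q ≤ k) hQ, hQB, hex⟩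
      obtain ⟨A, hA, x, hxB, hxA⟩ := hcov k (U k) B hBC
      have hA' := hsub k (U k) hA
      refine ⟨A, mem_iUnion.2 ⟨k + 1, by rw [hUs]; exact Or.inr hA⟩,
        ⟨x, hhull A hA'.1 hxA, hxB⟩, ?_, Or.inr ?_⟩
      · rw [hA'.2.1, hk]
      · rw [hA'.2.1, hk]

/-! ### Size classes, clusters and generations -/

section Sparse

variable {X : Type*} [MeasurableSpace X] {μ : Measure X} {ℬ : Set (Set X)}
  {hull : Set X → Set X} {K : ℝ≥0} {D : ℕ}

theorem IsBallBasis.measure_hull_hull_le (h : IsBallBasis μ ℬ hull K) {B : Set X} (hB : B ∈ ℬ) :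
    μ (hull (hull B)) ≤ K ^ 2 * μ B := by
  rw [pow_two, mul_assoc]
  exact (h.measure_hull_le _ (h.hull_mem B hB)).trans
    (mul_le_mul' le_rfl (h.measure_hull_le B hB))

theorem IsBallBasis.measure_hull_hull_hull_le (h : IsBallBasis μ ℬ hull K) {B : Set X}
    (hB : B ∈ ℬ) : μ (hull (hull (hull B))) ≤ K ^ 3 * μ B := by
  rw [pow_succ' (K : ℝ≥0∞) 2, mul_assoc]
  exact (h.measure_hull_le _ (h.hull_mem _ (h.hull_mem B hB))).trans
    (mul_le_mul' le_rfl (h.measure_hull_hull_le hB))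

/-- `cl B` is the number `n` with `2 ^ n * μ B ≤ μ X < 2 ^ (n + 1) * μ B`. -/
def IsSizeClass (μ : Measure X) (ℬ : Set (Set X)) (cl : Set X → ℕ) : Prop :=
  ∀ B ∈ ℬ, 2 ^ cl B * μ B ≤ μ univ ∧ μ univ < 2 ^ (cl B + 1) * μ B

theorem IsBallBasis.exists_isSizeClass [IsFiniteMeasure μ] (h : IsBallBasis μ ℬ hull K) :
    ∃ cl, IsSizeClass μ ℬ cl := by
  classical
  have hex : ∀ B ∈ ℬ, ∃ n : ℕ, 2 ^ n * μ B ≤ μ univ ∧ μ univ < 2 ^ (n + 1) * μ B := by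
    intro B hB
    have hB0 := (h.measure_pos B hB).ne'
    have hBt := (h.measure_lt_top B hB).ne
    have hlim : ∃ n : ℕ, μ univ < 2 ^ (n + 1) * μ B := by
      obtain ⟨n, hn⟩ := ENNReal.exists_nat_gt
        (ENNReal.div_ne_top (measure_ne_top μ univ) hB0)
      refine ⟨n, ?_⟩
      have h1 : μ univ < n * μ B := by
        rwa [ENNReal.div_lt_iff (Or.inl hB0) (Or.inl hBt)] at hn
      refine h1.trans_le ?_
      gcongr
      have : n ≤ 2 ^ (n + 1) := (Nat.lt_two_pow_self).le.trans (Nat.pow_le_pow_right (by norm_num)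
        (Nat.le_succ n))
      exact_mod_cast this
    refine ⟨Nat.find hlim, ?_, Nat.find_spec hlim⟩
    rcases hc : Nat.find hlim with _ | k
    · rw [pow_zero, one_mul]; exact measure_mono (subset_univ _)
    · exact not_lt.1 (Nat.find_min hlim (by omega : k < Nat.find hlim))
  choose! cl hcl using hex
  exact ⟨cl, hcl⟩

theorem IsSizeClass.le_two_mul {cl : Set X → ℕ} (hcl : IsSizeClass μ ℬ cl) {A B : Set X}
    (hA : A ∈ ℬ) (hB : B ∈ ℬ) (hAB : cl A ≤ cl B) : μ B ≤ 2 * μ A := by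
  have h1 : 2 ^ cl A * μ B ≤ 2 ^ cl A * (2 * μ A) := by
    calc 2 ^ cl A * μ B ≤ 2 ^ cl B * μ B := by gcongr; norm_num
      _ ≤ 2 ^ (cl A + 1) * μ A := (hcl B hB).1.trans (hcl A hA).2.le
      _ = _ := by ring
  exact (ENNReal.mul_le_mul_iff_right (by simp) (by finiteness)).1 h1

theorem IsSizeClass.lt_of_two_mul_lt {cl : Set X → ℕ} (hcl : IsSizeClass μ ℬ cl) {A B : Set X}
    (hA : A ∈ ℬ) (hB : B ∈ ℬ) (hAB : 2 * μ B < μ A) : cl A < cl B := by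
  by_contra hcon
  exact absurd (hcl.le_two_mul hB hA (not_lt.1 hcon)) (not_le.2 hAB)

/-- Sets of comparable measure that contain a given point, if those of the same class are
disjoint. -/
theorem IsSizeClass.encard_le {cl : Set X → ℕ} (hcl : IsSizeClass μ ℬ cl) {𝒢 : Set (Set X)}
    (h𝒢 : 𝒢 ⊆ ℬ) (hdis : ∀ A ∈ 𝒢, ∀ B ∈ 𝒢, cl A = cl B → A ≠ B → Disjoint A B)
    {x : X} (hx : ∀ A ∈ 𝒢, x ∈ A) {r : ℕ} (hr : ∀ A ∈ 𝒢, ∀ B ∈ 𝒢, μ A ≤ 2 ^ r * μ B) :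
    𝒢.encard ≤ (r + 1 : ℕ) := by
  rcases 𝒢.eq_empty_or_nonempty with h0 | hne
  · simp [h0]
  obtain ⟨_, ⟨A₀, hA₀, rfl⟩, hmin⟩ := wellFounded_lt.has_min (cl '' 𝒢) (hne.image cl)
  have hmin' : ∀ B ∈ 𝒢, cl A₀ ≤ cl B := fun B hB => not_lt.1 (hmin _ ⟨B, hB, rfl⟩)
  -- Sets of one class that share `x` coincide, so `cl` is injective on `𝒢`; comparability confines
  -- it to `r + 1` consecutive values.
  have hmap : ∀ B ∈ 𝒢, cl B ∈ (Finset.Icc (cl A₀) (cl A₀ + r) : Set ℕ) := by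
    intro B hB
    rw [Finset.coe_Icc]
    refine ⟨hmin' B hB, ?_⟩
    by_contra hcon
    rw [not_le] at hcon
    have h1 : (2 : ℝ≥0∞) ^ cl B * μ B < 2 ^ cl B * μ B := by
      calc (2 : ℝ≥0∞) ^ cl B * μ B ≤ μ univ := (hcl B (h𝒢 hB)).1
        _ < 2 ^ (cl A₀ + 1) * μ A₀ := (hcl A₀ (h𝒢 hA₀)).2
        _ ≤ 2 ^ (cl A₀ + 1) * (2 ^ r * μ B) := by gcongr; exact hr A₀ hA₀ B hB
        _ = 2 ^ (cl A₀ + r + 1) * μ B := by ring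
        _ ≤ _ := by gcongr; · norm_num
                    · exact hcon
    exact lt_irrefl _ h1
  have hinj : InjOn cl 𝒢 := by
    intro A hA B hB hAB
    by_contra hne
    exact disjoint_left.1 (hdis A hA B hB hAB hne) (hx A hA) (hx B hB)
  refine (Set.encard_le_encard_of_injOn hmap hinj).trans ?_
  rw [Set.encard_coe_eq_coe_finsetCard]
  simp only [Nat.card_Icc, Nat.cast_le]
  omega

theorem tsum_measure_le {𝒢 : Set (Set X)} (hm : ∀ A ∈ 𝒢, MeasurableSet A) {r : ℕ}
    (hov : ∀ x, {A ∈ 𝒢 | x ∈ A}.encard ≤ r) {G : Set X} (hG : MeasurableSet G) :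
    ∑' A : 𝒢, μ (A ∩ G) ≤ r * μ G := by
  have := tsum_setLIntegral_le (μ := μ) hm hov (measurable_one.indicator hG)
  rw [lintegral_indicator_one hG] at this
  refine le_trans (ENNReal.tsum_le_tsum fun A => ?_) this
  rw [lintegral_indicator_one hG, Measure.restrict_apply hG, inter_comm]

/-- Balls of comparable size whose hulls meet are contained in one ball of comparable size. -/
theorem IsBallBasis.exists_cluster (h : IsBallBasis μ ℬ hull K) (hK : 1 ≤ K) {cl : Set X → ℕ}
    (hcl : IsSizeClass μ ℬ cl) {A : Set X} (hA : A ∈ ℬ) {κ : ℝ≥0∞} (hκ : 1 ≤ κ) {ℛ : Set (Set X)}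
    (hℛ : ∀ R ∈ ℛ, R ∈ ℬ ∧ μ R ≤ κ * μ A ∧ (hull (hull R) ∩ hull A).Nonempty) :
    ∃ G ∈ ℬ, (∀ R ∈ ℛ, R ⊆ G) ∧ μ G ≤ K ^ 4 * κ * μ A := by
  have hKK : (1 : ℝ≥0∞) ≤ K := by exact_mod_cast hK
  have hAh := h.hull_mem A hA
  set ℱ : Set (Set X) := insert (hull A) ((fun R => hull (hull R)) '' ℛ) with hℱ
  have hℱ' : ∀ F ∈ ℱ, F ∈ ℬ ∧ μ F ≤ K ^ 2 * κ * μ A ∧ (F ∩ hull A).Nonempty := by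
    rintro F (rfl | ⟨R, hR, rfl⟩)
    · refine ⟨hAh, ?_, by rw [inter_self]; exact h.nonempty hAh⟩
      calc μ (hull A) ≤ K * 1 * 1 * μ A := by rw [mul_one, mul_one]; exact h.measure_hull_le A hA
        _ ≤ K * K * κ * μ A := by gcongr
        _ = _ := by ring
    · obtain ⟨h1, h2, h3⟩ := hℛ R hR
      refine ⟨h.hull_mem _ (h.hull_mem _ h1), ?_, h3⟩
      calc _ ≤ K ^ 2 * μ R := h.measure_hull_hull_le h1
        _ ≤ K ^ 2 * (κ * μ A) := by gcongr
        _ = _ := by ring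
  -- The least class marks a set that is largest up to a factor two. Its hull contains `hull A`, so
  -- its second hull contains every member meeting `hull A`.
  obtain ⟨_, ⟨G, hG, rfl⟩, hmin⟩ := wellFounded_lt.has_min (cl '' ℱ)
    ⟨_, hull A, mem_insert _ _, rfl⟩
  have hle : ∀ F ∈ ℱ, μ F ≤ 2 * μ G := fun F hF =>
    hcl.le_two_mul (hℱ' G hG).1 (hℱ' F hF).1 (not_lt.1 (hmin _ ⟨F, hF, rfl⟩))
  obtain ⟨hGℬ, hGm, hGA⟩ := hℱ' G hG
  have hGh := h.hull_mem G hGℬ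
  have hAG : hull A ⊆ hull G := h.subset_hull G hGℬ _ hAh (hle _ (mem_insert _ _))
    (by rwa [inter_comm])
  refine ⟨hull (hull G), h.hull_mem _ hGh, fun R hR => ?_, ?_⟩
  · have hRF : hull (hull R) ∈ ℱ := mem_insert_of_mem _ ⟨R, hR, rfl⟩
    obtain ⟨h1, -, h3⟩ := hℱ' _ hRF
    have hRℬ := (hℛ R hR).1
    refine ((h.subset_hull_self hRℬ).trans (h.subset_hull_self (h.hull_mem R hRℬ))).trans ?_
    refine h.subset_hull _ hGh _ h1 ((hle _ hRF).trans ?_) (h3.mono (inter_subset_inter_right _ hAG))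
    gcongr
    exact h.subset_hull_self hGℬ
  · calc _ ≤ K ^ 2 * μ G := h.measure_hull_hull_le hGℬ
      _ ≤ K ^ 2 * (K ^ 2 * κ * μ A) := by gcongr
      _ = _ := by ring

/-- The sets reached from `R` by `k` steps of the relation `Ch`. -/
def descendants (Ch : Set X → Set (Set X)) : ℕ → Set X → Set (Set X)
  | 0, R => {R}
  | k + 1, R => ⋃ Q ∈ descendants Ch k R, Ch Q

/-- Each generation has total measure at most `ε` times that of the previous one. -/
theorem tsum_descendants_le {Ch : Set X → Set (Set X)} {ε : ℝ≥0∞} {𝒮 : Set (Set X)}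
    (hCh𝒮 : ∀ Q, Ch Q ⊆ 𝒮) (hCh : ∀ Q ∈ 𝒮, ∑' B : Ch Q, μ B ≤ ε * μ Q) {R : Set X} (hR : R ∈ 𝒮)
    (k : ℕ) : descendants Ch k R ⊆ 𝒮 ∧ ∑' B : descendants Ch k R, μ B ≤ ε ^ k * μ R := by
  induction k with
  | zero =>
    refine ⟨singleton_subset_iff.2 hR, ?_⟩
    simp [descendants]
  | succ k ih =>
    refine ⟨iUnion₂_subset fun Q _ => hCh𝒮 Q, ?_⟩
    calc ∑' B : descendants Ch (k + 1) R, μ B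
        ≤ ∑' (Q : descendants Ch k R) (B : Ch Q), μ B :=
          ENNReal.tsum_biUnion_le_tsum (fun B => μ B) (descendants Ch k R) Ch
      _ ≤ ∑' Q : descendants Ch k R, ε * μ Q := ENNReal.tsum_le_tsum fun Q => hCh Q (ih.1 Q.2)
      _ = ε * ∑' Q : descendants Ch k R, μ Q := ENNReal.tsum_mul_left
      _ ≤ ε * (ε ^ k * μ R) := by gcongr; exact ih.2
      _ = _ := by ring

end Sparse

/-! ### Trees of balls and sparseness -/

section SparseFamily

variable {X : Type*} [MeasurableSpace X] {μ : Measure X} {ℬ : Set (Set X)}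
  {hull : Set X → Set X} {K : ℝ≥0} {D : ℕ}

/-- The sets of `𝒮` that are comparable to `A` in size and have a twofold hull meeting `hull A`. -/
def comparable (μ : Measure X) (hull : Set X → Set X) (κ : ℝ≥0∞) (𝒮 : Set (Set X)) (A : Set X) :
    Set (Set X) :=
  {R ∈ 𝒮 | μ A ≤ κ * μ R ∧ μ R < κ * μ A ∧ (hull (hull R) ∩ hull A).Nonempty}

/-- The much smaller sets of `𝒮` that meet `A`. -/
def smaller (μ : Measure X) (κ : ℝ≥0∞) (𝒮 : Set (Set X)) (A : Set X) : Set (Set X) :=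
  {B ∈ 𝒮 | κ * μ B < μ A ∧ (B ∩ A).Nonempty}

/-- `Ch` assigns children to the members of `𝒮` in such a way that each member other than `X` is a
child, and the parent of a set `B` is not much larger than the larger sets near `B`. -/
structure IsTree (μ : Measure X) (hull : Set X → Set X) (cl : Set X → ℕ) (κ ε : ℝ≥0∞)
    (𝒮 : Set (Set X)) (Ch : Set X → Set (Set X)) : Prop where
  subset : ∀ Q, Ch Q ⊆ 𝒮
  exists_parent : ∀ B ∈ 𝒮, B ≠ univ → ∃ Q ∈ 𝒮, B ∈ Ch Q
  cl_lt : ∀ Q ∈ 𝒮, ∀ B ∈ Ch Q, cl Q < cl B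
  hull_subset : ∀ Q ∈ 𝒮, ∀ B ∈ Ch Q, hull (hull (hull B)) ⊆ hull (hull (hull Q))
  meets : ∀ Q ∈ 𝒮, ∀ B ∈ Ch Q, (B ∩ hull (hull Q)).Nonempty
  parent_lt : ∀ Q ∈ 𝒮, ∀ B ∈ Ch Q, ∀ A ∈ 𝒮, cl A < cl B → (hull A ∩ B).Nonempty →
    μ Q < κ * μ A
  tsum_le : ∀ Q ∈ 𝒮, ∑' B : Ch Q, μ B ≤ ε * μ Q

/-- Climb from `B` through its ancestors. While an ancestor is much smaller than `A`, its threefold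
hull meets `A` and so lies in `hull A`; hence by `parent_lt` its parent is not much larger than `A`.
The first ancestor that is not much smaller is comparable to `A`. The classes decrease along the
way, so the climb ends. -/
theorem IsTree.exists_descendant (h : IsBallBasis μ ℬ hull K) (hK : 1 ≤ K) {cl : Set X → ℕ}
    (hcl : IsSizeClass μ ℬ cl) {ε : ℝ≥0∞} {𝒮 : Set (Set X)} (h𝒮 : 𝒮 ⊆ ℬ)
    {Ch : Set X → Set (Set X)} (ht : IsTree μ hull cl (2 * K ^ 3) ε 𝒮 Ch) {A : Set X} (hA : A ∈ 𝒮)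
    {B : Set X} (hB : B ∈ 𝒮) (hBA : 2 * K ^ 3 * μ B < μ A)
    (hmeet : (hull (hull (hull B)) ∩ A).Nonempty) :
    ∃ R ∈ comparable μ hull (2 * K ^ 3) 𝒮 A, ∃ k, B ∈ descendants Ch (k + 1) R := by
  have hKK : (1 : ℝ≥0∞) ≤ K ^ 3 := one_le_pow₀ (by exact_mod_cast hK)
  induction hn : cl B using Nat.strong_induction_on generalizing B with
  | _ n ih =>
  have hBℬ := h𝒮 hB
  have hB1 := h.hull_mem B hBℬ
  have hB2 := h.hull_mem _ hB1
  have hB3 := h.hull_mem _ hB2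
  have hBsub : B ⊆ hull (hull (hull B)) := (h.subset_hull_self hBℬ).trans
    ((h.subset_hull_self hB1).trans (h.subset_hull_self hB2))
  have hsub : hull (hull (hull B)) ⊆ hull A := by
    refine h.subset_hull A (h𝒮 hA) _ hB3 ?_ hmeet
    calc _ ≤ K ^ 3 * μ B := h.measure_hull_hull_hull_le hBℬ
      _ ≤ 2 * (K ^ 3 * μ B) := by rw [two_mul]; exact le_self_add
      _ = 2 * K ^ 3 * μ B := by ring
      _ ≤ μ A := hBA.le
      _ ≤ 2 * μ A := by rw [two_mul]; exact le_self_add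
  have h2B : 2 * μ B < μ A := by
    refine lt_of_le_of_lt ?_ hBA
    nth_rw 1 [← mul_one 2]
    gcongr
  have hBu : B ≠ univ := by
    rintro rfl
    refine absurd h2B (not_lt.2 ?_)
    rw [two_mul]
    exact (measure_mono (subset_univ _)).trans le_self_add
  obtain ⟨Q, hQ, hQB⟩ := ht.exists_parent B hB hBu
  have hclAB := hcl.lt_of_two_mul_lt (h𝒮 hA) hBℬ h2B
  obtain ⟨z, hz⟩ := h.nonempty hBℬ
  have hQA := ht.parent_lt Q hQ B hQB A hA hclAB ⟨z, hsub (hBsub hz), hz⟩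
  obtain ⟨y, hyB, hyQ⟩ := ht.meets Q hQ B hQB
  by_cases hAQ : μ A ≤ 2 * K ^ 3 * μ Q
  · exact ⟨Q, ⟨hQ, hAQ, hQA, y, hyQ, hsub (hBsub hyB)⟩, 0,
      mem_iUnion₂.2 ⟨Q, rfl, hQB⟩⟩
  · obtain ⟨R, hR, k, hk⟩ := ih (cl Q) (hn ▸ ht.cl_lt Q hQ B hQB) hQ (not_le.1 hAQ)
      (hmeet.mono (inter_subset_inter_left _ (ht.hull_subset Q hQ B hQB))) rfl
    exact ⟨R, hR, k + 1, mem_iUnion₂.2 ⟨Q, hk, hQB⟩⟩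

/-- All these sets lie in one ball of size comparable to `A`. Their measures differ by factors of at
most `κ²`, so at most `r + 1` of them share a point. -/
theorem tsum_comparable_le (h : IsBallBasis μ ℬ hull K) (hK : 1 ≤ K) {cl : Set X → ℕ}
    (hcl : IsSizeClass μ ℬ cl) {𝒮 : Set (Set X)} (h𝒮 : 𝒮 ⊆ ℬ)
    (hdis : ∀ A ∈ 𝒮, ∀ B ∈ 𝒮, cl A = cl B → A ≠ B → Disjoint A B) {κ : ℝ≥0∞} (hκ : 1 ≤ κ) {r : ℕ}
    (hr : κ ^ 2 ≤ 2 ^ r) {A : Set X} (hA : A ∈ 𝒮) :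
    ∑' R : comparable μ hull κ 𝒮 A, μ R ≤ (r + 1 : ℕ) * (K ^ 4 * κ * μ A) := by
  obtain ⟨G, hG, hRG, hGm⟩ := h.exists_cluster hK hcl (h𝒮 hA) hκ
    (ℛ := comparable μ hull κ 𝒮 A) fun R hR => ⟨h𝒮 hR.1, hR.2.2.1.le, hR.2.2.2⟩
  calc ∑' R : comparable μ hull κ 𝒮 A, μ R = ∑' R : comparable μ hull κ 𝒮 A, μ (R ∩ G) :=
        tsum_congr fun R => by rw [inter_eq_left.2 (hRG R R.2)]
    _ ≤ (r + 1 : ℕ) * μ G := by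
        refine tsum_measure_le (fun R hR => h.measurableSet R (h𝒮 hR.1)) (fun x => ?_)
          (h.measurableSet G hG)
        refine hcl.encard_le (fun R hR => h𝒮 hR.1.1)
          (fun R hR R' hR' => hdis R hR.1.1 R' hR'.1.1) (x := x) (fun R hR => hR.2) ?_
        intro R hR R' hR'
        calc μ R ≤ κ * μ A := hR.1.2.2.1.le
          _ ≤ κ * (κ * μ R') := by gcongr; exact hR'.1.2.1
          _ = κ ^ 2 * μ R' := by ring
          _ ≤ _ := by gcongr
    _ ≤ _ := by gcongr

theorem tsum_pow_succ_le {ε : ℝ≥0∞} (hε : 2 * ε ≤ 1) : ∑' k : ℕ, ε ^ (k + 1) ≤ 2 * ε := by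
  have h1 : ε ≤ 2⁻¹ := by
    rw [ENNReal.le_inv_iff_mul_le, mul_comm]; exact hε
  calc ∑' k : ℕ, ε ^ (k + 1) = ε * ∑' k : ℕ, ε ^ k := by
        rw [← ENNReal.tsum_mul_left]; simp_rw [pow_succ']
    _ = ε * (1 - ε)⁻¹ := by rw [ENNReal.tsum_geometric]
    _ ≤ ε * 2 := by
        gcongr
        rw [ENNReal.inv_le_iff_inv_le]
        refine ENNReal.le_sub_of_add_le_right (ne_top_of_le_ne_top (by simp) h1) ?_
        calc (2 : ℝ≥0∞)⁻¹ + ε ≤ 2⁻¹ + 2⁻¹ := by gcongr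
          _ = 1 := ENNReal.inv_two_add_inv_two
    _ = _ := mul_comm _ _

/-- Much smaller members that meet `A` descend from members comparable to `A`. Summing the
generations gives at most `2 ε` times the total measure of the latter, and the condition on `ε`
makes this at most half of `μ A`. -/
theorem IsTree.measure_smaller_le (h : IsBallBasis μ ℬ hull K) (hK : 1 ≤ K) {cl : Set X → ℕ}
    (hcl : IsSizeClass μ ℬ cl) {ε : ℝ≥0∞} {𝒮 : Set (Set X)} (h𝒮 : 𝒮 ⊆ ℬ) (hc : 𝒮.Countable)
    (hdis : ∀ A ∈ 𝒮, ∀ B ∈ 𝒮, cl A = cl B → A ≠ B → Disjoint A B)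
    {Ch : Set X → Set (Set X)} (ht : IsTree μ hull cl (2 * K ^ 3) ε 𝒮 Ch)
    {r : ℕ} (hr : (2 * K ^ 3 : ℝ≥0∞) ^ 2 ≤ 2 ^ r) (h2ε : 2 * ε ≤ 1)
    (hε : 4 * (r + 1 : ℕ) * K ^ 4 * (2 * K ^ 3) * ε ≤ 1) {A : Set X} (hA : A ∈ 𝒮) :
    2 * μ (⋃₀ smaller μ (2 * K ^ 3) 𝒮 A) ≤ μ A := by
  have hKK : (1 : ℝ≥0∞) ≤ K ^ 3 := one_le_pow₀ (by exact_mod_cast hK)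
  have hκ : (1 : ℝ≥0∞) ≤ 2 * K ^ 3 := hKK.trans (by rw [two_mul]; exact le_self_add)
  set 𝒩 := smaller μ (2 * K ^ 3) 𝒮 A with h𝒩
  set ℛ := comparable μ hull (2 * K ^ 3) 𝒮 A with hℛ
  have hsub : 𝒩 ⊆ ⋃ R ∈ ℛ, ⋃ k, descendants Ch (k + 1) R := by
    intro B hB
    have hBℬ := h𝒮 hB.1
    have hB1 := h.hull_mem B hBℬ
    have hBsub : B ⊆ hull (hull (hull B)) := (h.subset_hull_self hBℬ).trans
      ((h.subset_hull_self hB1).trans (h.subset_hull_self (h.hull_mem _ hB1)))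
    obtain ⟨R, hR, k, hk⟩ := ht.exists_descendant h hK hcl h𝒮 hA hB.1 hB.2.1
      (hB.2.2.mono (inter_subset_inter_left _ hBsub))
    exact mem_iUnion₂.2 ⟨R, hR, mem_iUnion.2 ⟨k, hk⟩⟩
  have hsum : ∑' B : 𝒩, μ B ≤ 2 * ε * ((r + 1 : ℕ) * (K ^ 4 * (2 * K ^ 3) * μ A)) := by
    calc ∑' B : 𝒩, μ B
        ≤ ∑' B : ⋃ R ∈ ℛ, ⋃ k, descendants Ch (k + 1) R, μ B :=
          ENNReal.tsum_mono_subtype (fun B => μ B) hsub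
      _ ≤ ∑' (R : ℛ) (B : ⋃ k, descendants Ch (k + 1) R), μ B :=
          ENNReal.tsum_biUnion_le_tsum (fun B => μ B) ℛ fun R => ⋃ k, descendants Ch (k + 1) R
      _ ≤ ∑' R : ℛ, 2 * ε * μ R := by
          refine ENNReal.tsum_le_tsum fun R => ?_
          calc ∑' B : ⋃ k, descendants Ch (k + 1) (R : Set X), μ B
              ≤ ∑' (k : ℕ) (B : descendants Ch (k + 1) (R : Set X)), μ B :=
                ENNReal.tsum_iUnion_le_tsum (fun B => μ B) fun k => descendants Ch (k + 1) R
            _ ≤ ∑' k : ℕ, ε ^ (k + 1) * μ R := ENNReal.tsum_le_tsum fun k =>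
                (tsum_descendants_le ht.subset ht.tsum_le R.2.1 (k + 1)).2
            _ = (∑' k : ℕ, ε ^ (k + 1)) * μ R := ENNReal.tsum_mul_right
            _ ≤ _ := by gcongr; exact tsum_pow_succ_le h2ε
      _ = 2 * ε * ∑' R : ℛ, μ R := ENNReal.tsum_mul_left
      _ ≤ _ := by gcongr; exact tsum_comparable_le h hK hcl h𝒮 hdis hκ hr hA
  calc 2 * μ (⋃₀ 𝒩) ≤ 2 * ∑' B : 𝒩, μ B := by
        gcongr; exact measure_sUnion_le_tsum (hc.mono fun B hB => hB.1)
    _ ≤ 2 * (2 * ε * ((r + 1 : ℕ) * (K ^ 4 * (2 * K ^ 3) * μ A))) := by gcongr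
    _ = 4 * (r + 1 : ℕ) * K ^ 4 * (2 * K ^ 3) * ε * μ A := by ring
    _ ≤ 1 * μ A := by gcongr
    _ = μ A := one_mul _

theorem IsSizeClass.countable [IsFiniteMeasure μ] (h : IsBallBasis μ ℬ hull K) {cl : Set X → ℕ}
    {𝒮 : Set (Set X)} (h𝒮 : 𝒮 ⊆ ℬ)
    (hdis : ∀ A ∈ 𝒮, ∀ B ∈ 𝒮, cl A = cl B → A ≠ B → Disjoint A B) : 𝒮.Countable := by
  have : 𝒮 = ⋃ n : ℕ, {A ∈ 𝒮 | cl A = n} := by ext A; simp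
  rw [this]
  refine countable_iUnion fun n => countable_of_overlap (μ := μ) (h := fun _ => 1) (D := 1)
    (fun A hA => h.measurableSet A (h𝒮 hA.1)) (fun x => ?_) measurable_const (by simp)
    fun A hA => by simpa using (h.measure_pos A (h𝒮 hA.1)).ne'
  rw [Nat.cast_one, encard_le_one_iff]
  intro A B hA hB
  by_contra hne
  exact disjoint_left.1 (hdis A hA.1.1 B hB.1.1 (hA.1.2.trans hB.1.2.symm) hne) hA.2 hB.2

/-- Given bad sets `E Q` and candidate balls that are mostly bad, there is a sparse family that
is closed under passing to candidates, up to taking hulls. -/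
theorem IsBallBasis.exists_sparse_family [Nonempty X] [IsFiniteMeasure μ]
    (h : IsBallBasis μ ℬ hull K) (hD : Besicovitch ℬ D) (hK : 1 ≤ K)
    {r : ℕ} (hr : (2 * K ^ 3 : ℝ≥0∞) ^ 2 ≤ 2 ^ r) {ε : ℝ≥0∞}
    (hε : 4 * (r + 1 : ℕ) * K ^ 4 * (2 * K ^ 3) * ε ≤ 1) {E : Set X → Set X}
    (hEm : ∀ Q ∈ ℬ, MeasurableSet (E Q)) (hE : ∀ Q ∈ ℬ, 2 * μ (E Q) ≤ ε * μ Q)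
    {Cand : Set X → Set X → Prop} (hCand : ∀ Q ∈ ℬ, ∀ B, Cand Q B → B ∈ ℬ ∧
      (B ∩ hull (hull Q)).Nonempty ∧ μ B ≤ 2 * μ (B ∩ E Q)) :
    ∃ 𝒮 ⊆ ℬ, univ ∈ 𝒮 ∧ 𝒮.Countable ∧
      (∀ Q ∈ 𝒮, ∀ B, Cand Q B → ∃ A ∈ 𝒮, B ⊆ hull (hull A) ∧
        hull (hull (hull A)) ⊆ hull (hull (hull Q)) ∧ μ A < μ Q) ∧
      ∃ F : Set X → Set X, (∀ A ∈ 𝒮, F A ⊆ A ∧ MeasurableSet (F A) ∧ μ A ≤ 2 * μ (F A)) ∧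
        ∀ x, {A ∈ 𝒮 | x ∈ F A}.encard ≤ (r + 1 : ℕ) := by
  have hK1 : (1 : ℝ≥0∞) ≤ K := by exact_mod_cast hK
  have hKK : (1 : ℝ≥0∞) ≤ K ^ 3 := one_le_pow₀ hK1
  obtain ⟨cl, hcl⟩ := h.exists_isSizeClass
  have hu := h.univ_mem hD
  have hclu : cl univ = 0 := by
    by_contra hne
    have h1 := (hcl univ hu).1
    have h2 : 2 * μ univ ≤ 2 ^ cl univ * μ univ := by
      gcongr
      exact le_self_pow₀ (by norm_num) hne
    have h3 : μ univ < 2 * μ univ := by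
      rw [two_mul]
      exact ENNReal.lt_add_right (measure_ne_top μ _) (h.measure_pos _ hu).ne'
    exact absurd (h3.trans_le (h2.trans h1)) (lt_irrefl _)
  have hκε : 4 * (2 * K ^ 3) * ε ≤ 1 := by
    refine le_trans ?_ hε
    have : (1 : ℝ≥0∞) ≤ (r + 1 : ℕ) * K ^ 4 := one_le_mul (by norm_cast; omega) (one_le_pow₀ hK1)
    calc 4 * (2 * K ^ 3) * ε = 1 * (4 * (2 * K ^ 3) * ε) := (one_mul _).symm
      _ ≤ ((r + 1 : ℕ) * K ^ 4) * (4 * (2 * K ^ 3) * ε) := by gcongr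
      _ = _ := by ring
  have h8ε : 8 * ε ≤ 1 := by
    refine le_trans ?_ hκε
    calc 8 * ε = 8 * 1 * ε := by rw [mul_one]
      _ ≤ 8 * K ^ 3 * ε := by gcongr
      _ = _ := by ring
  have h2ε : 2 * ε ≤ 1 := le_trans (by gcongr; norm_num) h8ε
  -- At least half of a candidate lies in the small set `E Q`, so the candidate itself is small.
  have hCm : ∀ Q ∈ ℬ, ∀ B, Cand Q B → μ B ≤ ε * μ Q := fun Q hQ B hB =>
    (hCand Q hQ B hB).2.2.trans
      ((mul_le_mul' le_rfl (measure_mono inter_subset_right)).trans (hE Q hQ))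
  have hCs : ∀ Q ∈ ℬ, ∀ B, Cand Q B → 4 * (2 * K ^ 3) * μ B ≤ μ Q := fun Q hQ B hB => by
    calc 4 * (2 * K ^ 3) * μ B ≤ 4 * (2 * K ^ 3) * (ε * μ Q) := by gcongr; exact hCm Q hQ B hB
      _ = 4 * (2 * K ^ 3) * ε * μ Q := by ring
      _ ≤ 1 * μ Q := by gcongr
      _ = _ := one_mul _
  have hCcl : ∀ Q ∈ ℬ, ∀ B, Cand Q B → B ∈ ℬ ∧ cl Q < cl B := fun Q hQ B hB => by
    have hBℬ := (hCand Q hQ B hB).1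
    refine ⟨hBℬ, hcl.lt_of_two_mul_lt hQ hBℬ ?_⟩
    refine lt_of_lt_of_le ?_ (hCs Q hQ B hB)
    have h2B0 : 2 * μ B ≠ 0 := mul_ne_zero (by norm_num) (h.measure_pos B hBℬ).ne'
    calc 2 * μ B < 2 * μ B + 2 * μ B := ENNReal.lt_add_right (by finiteness) h2B0
      _ ≤ 2 * (2 * μ B) := by rw [← two_mul]
      _ ≤ 2 * (2 * μ B) + 2 * (2 * μ B) := le_self_add
      _ = 4 * (2 * 1) * μ B := by ring
      _ ≤ _ := by gcongr
  have hnest : ∀ Q ∈ ℬ, ∀ A ∈ ℬ, 2 * K ^ 3 * μ A ≤ μ Q →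
      (hull (hull (hull A)) ∩ hull (hull Q)).Nonempty →
      hull (hull (hull A)) ⊆ hull (hull (hull Q)) := by
    intro Q hQ A hA hAQ hne
    have hQ2 := h.hull_mem _ (h.hull_mem Q hQ)
    refine h.subset_hull _ hQ2 _ (h.hull_mem _ (h.hull_mem _ (h.hull_mem A hA))) ?_ hne
    calc _ ≤ K ^ 3 * μ A := h.measure_hull_hull_hull_le hA
      _ ≤ 2 * (K ^ 3 * μ A) := by rw [two_mul]; exact le_self_add
      _ = 2 * K ^ 3 * μ A := by ring
      _ ≤ μ Q := hAQ
      _ ≤ μ (hull (hull Q)) := measure_mono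
          ((h.subset_hull_self hQ).trans (h.subset_hull_self (h.hull_mem Q hQ)))
      _ ≤ _ := by rw [two_mul]; exact le_self_add
  have hsub2 : ∀ A ∈ ℬ, A ⊆ hull (hull A) := fun A hA =>
    (h.subset_hull_self hA).trans (h.subset_hull_self (h.hull_mem A hA))
  have hsub3 : ∀ A ∈ ℬ, hull (hull A) ⊆ hull (hull (hull A)) := fun A hA =>
    h.subset_hull_self (h.hull_mem _ (h.hull_mem A hA))
  obtain ⟨𝒮, h𝒮, hu𝒮, hdis, hpar, hcov⟩ := exists_selection (fun B hB => h.nonempty hB)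
    (fun B hB => h.subset_hull_self hB) cl Cand (fun A Q => 2 * K ^ 3 * μ A ≤ μ Q) hCcl hu hclu
  have hc := IsSizeClass.countable h h𝒮 hdis
  -- The children of `Q` are the selected sets for which `Q` can serve as the witness of
  -- eligibility.
  set Ch : Set X → Set (Set X) := fun Q => {B ∈ 𝒮 | Cand Q B ∧
    ∀ A ∈ 𝒮, cl A < cl B → (hull A ∩ B).Nonempty → ¬ 2 * K ^ 3 * μ A ≤ μ Q} with hCh
  have hCs' : ∀ Q ∈ ℬ, ∀ B, Cand Q B → 2 * K ^ 3 * (2 * μ B) ≤ μ Q := fun Q hQ B hB => by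
    refine le_trans ?_ (hCs Q hQ B hB)
    calc 2 * K ^ 3 * (2 * μ B) ≤ 2 * K ^ 3 * (2 * μ B) + 2 * K ^ 3 * (2 * μ B) := le_self_add
      _ = _ := by ring
  have hCs1 : ∀ Q ∈ ℬ, ∀ B, Cand Q B → 2 * K ^ 3 * μ B ≤ μ Q := fun Q hQ B hB => by
    refine le_trans ?_ (hCs' Q hQ B hB)
    gcongr
    rw [two_mul]
    exact le_self_add
  have ht : IsTree μ hull cl (2 * K ^ 3) ε 𝒮 Ch := by
    refine ⟨fun Q B hB => hB.1, ?_, ?_, ?_, ?_, ?_, ?_⟩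
    · intro B hB hBu
      obtain ⟨Q, hQ, hQB, hA⟩ := hpar B hB hBu
      exact ⟨Q, hQ, hB, hQB, hA⟩
    · exact fun Q hQ B hB => (hCcl Q (h𝒮 hQ) B hB.2.1).2
    · intro Q hQ B hB
      have hBℬ := h𝒮 hB.1
      exact hnest Q (h𝒮 hQ) B hBℬ (hCs1 Q (h𝒮 hQ) B hB.2.1)
        ((hCand Q (h𝒮 hQ) B hB.2.1).2.1.mono
          (inter_subset_inter_left _ ((hsub2 B hBℬ).trans (hsub3 B hBℬ))))
    · exact fun Q hQ B hB => (hCand Q (h𝒮 hQ) B hB.2.1).2.1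
    · exact fun Q hQ B hB A hA hlt hne => not_le.1 (hB.2.2 A hA hlt hne)
    · intro Q hQ
      -- An earlier child meeting `B` would be small compared with `Q` and would have excluded `B`.
      -- Within one class the selection is disjoint anyway, so the children pack into twice `E Q`.
      have hdisCh : ∀ A ∈ Ch Q, ∀ B ∈ Ch Q, cl A < cl B → Disjoint A B := by
        intro A hA B hB hlt
        by_contra hne
        rw [not_disjoint_iff] at hne
        obtain ⟨x, hxA, hxB⟩ := hne
        exact hB.2.2 A hA.1 hlt ⟨x, h.subset_hull_self (h𝒮 hA.1) hxA, hxB⟩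
          (hCs1 Q (h𝒮 hQ) A hA.2.1)
      have hov : ∀ x, {A ∈ Ch Q | x ∈ A}.encard ≤ (1 : ℕ) := by
        intro x
        rw [Nat.cast_one, encard_le_one_iff]
        intro A B hA hB
        by_contra hne
        rcases lt_trichotomy (cl A) (cl B) with hlt | heq | hlt
        · exact disjoint_left.1 (hdisCh A hA.1 B hB.1 hlt) hA.2 hB.2
        · exact disjoint_left.1 (hdis A hA.1.1 B hB.1.1 heq hne) hA.2 hB.2
        · exact disjoint_left.1 (hdisCh B hB.1 A hA.1 hlt) hB.2 hA.2
      calc ∑' B : Ch Q, μ B ≤ ∑' B : Ch Q, 2 * μ (B ∩ E Q) := ENNReal.tsum_le_tsum fun B =>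
            (hCand Q (h𝒮 hQ) B B.2.2.1).2.2
        _ = 2 * ∑' B : Ch Q, μ (B ∩ E Q) := ENNReal.tsum_mul_left
        _ ≤ 2 * ((1 : ℕ) * μ (E Q)) := by
            gcongr
            exact tsum_measure_le (fun A hA => h.measurableSet A (h𝒮 hA.1)) hov (hEm Q (h𝒮 hQ))
        _ = 2 * μ (E Q) := by simp
        _ ≤ _ := hE Q (h𝒮 hQ)
  have hFm : ∀ A, MeasurableSet (⋃₀ smaller μ (2 * K ^ 3) 𝒮 A) := fun A =>
    MeasurableSet.sUnion (hc.mono fun B hB => hB.1) fun B hB => h.measurableSet B (h𝒮 hB.1)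
  refine ⟨𝒮, h𝒮, hu𝒮, hc, ?_, fun A => A \ ⋃₀ smaller μ (2 * K ^ 3) 𝒮 A, ?_, ?_⟩
  · intro Q hQ B hB
    obtain ⟨A, hA, hAB, hle, hsmall⟩ := hcov Q hQ B hB
    have hQℬ := h𝒮 hQ
    have hAℬ := h𝒮 hA
    obtain ⟨hBℬ, hBQ, -⟩ := hCand Q hQℬ B hB
    have hBA : B ⊆ hull (hull A) := by
      refine h.subset_hull _ (h.hull_mem A hAℬ) B hBℬ ((hcl.le_two_mul hAℬ hBℬ hle).trans ?_)
        (by rwa [inter_comm])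
      gcongr
      exact h.subset_hull_self hAℬ
    -- When `A` and `B` only share a class, `A` may be twice as large as `B`; the extra factor two
    -- in `hCs'` absorbs this.
    have hAQ : 2 * K ^ 3 * μ A ≤ μ Q := by
      rcases hsmall with hs | hs
      · exact hs
      · exact le_trans (by gcongr; exact hcl.le_two_mul hBℬ hAℬ hs.ge) (hCs' Q hQℬ B hB)
    refine ⟨A, hA, hBA, hnest Q hQℬ A hAℬ hAQ
      (hBQ.mono (inter_subset_inter_left _ (hBA.trans (hsub3 A hAℬ)))), ?_⟩
    calc μ A < μ A + μ A := ENNReal.lt_add_right (measure_ne_top μ _) (h.measure_pos A hAℬ).ne'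
      _ = 2 * 1 * μ A := by ring
      _ ≤ 2 * K ^ 3 * μ A := by gcongr
      _ ≤ _ := hAQ
  · intro A hA
    refine ⟨sdiff_subset, (h.measurableSet A (h𝒮 hA)).diff (hFm A), ?_⟩
    have h1 := ht.measure_smaller_le h hK hcl h𝒮 hc hdis hr h2ε hε hA
    have h2 : μ A ≤ μ (⋃₀ smaller μ (2 * K ^ 3) 𝒮 A) +
        μ (A \ ⋃₀ smaller μ (2 * K ^ 3) 𝒮 A) := by
      rw [← measure_inter_add_sdiff A (hFm A)]
      gcongr
      exact inter_subset_right
    refine (ENNReal.add_le_add_iff_left (measure_ne_top μ A)).1 ?_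
    calc μ A + μ A = 2 * μ A := (two_mul _).symm
      _ ≤ 2 * (μ (⋃₀ smaller μ (2 * K ^ 3) 𝒮 A) + μ (A \ ⋃₀ smaller μ (2 * K ^ 3) 𝒮 A)) := by
          gcongr
      _ = 2 * μ (⋃₀ smaller μ (2 * K ^ 3) 𝒮 A) + 2 * μ (A \ ⋃₀ smaller μ (2 * K ^ 3) 𝒮 A) :=
          mul_add _ _ _
      _ ≤ _ := by gcongr
  · intro x
    -- If one set were much smaller than another through `x`, then `x` would have been removed from
    -- the larger one.
    have hcmp : ∀ A ∈ {A ∈ 𝒮 | x ∈ A \ ⋃₀ smaller μ (2 * K ^ 3) 𝒮 A},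
        ∀ B ∈ {A ∈ 𝒮 | x ∈ A \ ⋃₀ smaller μ (2 * K ^ 3) 𝒮 A}, μ A ≤ 2 ^ r * μ B := by
      intro A hA B hB
      have h1 : μ A ≤ 2 * K ^ 3 * μ B := by
        by_contra hcon
        exact hA.2.2 ⟨B, ⟨hB.1, not_le.1 hcon, x, hB.2.1, hA.2.1⟩, hB.2.1⟩
      refine h1.trans (mul_le_mul' (le_trans ?_ hr) le_rfl)
      rw [pow_two]
      exact le_mul_of_one_le_left zero_le (hKK.trans (by rw [two_mul]; exact le_self_add))
    exact hcl.encard_le (fun A hA => h𝒮 hA.1) (fun A hA B hB => hdis A hA.1 B hB.1)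
      (fun A hA => hA.2.1) hcmp

end SparseFamily

/-! ### Sparse domination -/

section Domination

variable {X : Type*} [MeasurableSpace X] {μ : Measure X} {ℬ : Set (Set X)}
  {hull : Set X → Set X} {K : ℝ≥0} {D : ℕ}

/-- An iteration along a relation that decreases a size function on a finite set. -/
theorem exists_finset_of_descent {ι : Type*} {m : ι → ℝ≥0∞} {V : Set ι} (hV : V.Finite)
    {a t : ι → ℝ≥0∞} (h : ∀ Q ∈ V, t Q ≤ a Q ∨ ∃ A ∈ V, m A < m Q ∧ t Q ≤ a Q + t A) :
    ∀ Q ∈ V, ∃ J : Finset ι, (∀ A ∈ J, A ∈ V ∧ m A ≤ m Q) ∧ t Q ≤ ∑ A ∈ J, a A := by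
  classical
  intro Q hQ
  induction hn : {A ∈ V | m A < m Q}.ncard using Nat.strong_induction_on generalizing Q with
  | _ n ih =>
  rcases h Q hQ with h1 | ⟨A, hA, hlt, h1⟩
  · exact ⟨{Q}, fun A hA => by rw [Finset.mem_singleton.1 hA]; exact ⟨hQ, le_rfl⟩,
      by simpa using h1⟩
  · have hss : {B ∈ V | m B < m A} ⊂ {B ∈ V | m B < m Q} :=
      ⟨fun B hB => ⟨hB.1, hB.2.trans hlt⟩, fun hcon => lt_irrefl _ (hcon ⟨hA, hlt⟩).2⟩
    obtain ⟨J, hJ, hJs⟩ := ih _ (hn ▸ ncard_lt_ncard hss (hV.subset (sep_subset _ _))) A hA rfl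
    refine ⟨insert Q J, fun B hB => ?_, ?_⟩
    · rcases Finset.mem_insert.1 hB with rfl | hB
      · exact ⟨hQ, le_rfl⟩
      · exact ⟨(hJ B hB).1, (hJ B hB).2.trans hlt.le⟩
    · rw [Finset.sum_insert fun hQJ => absurd ((hJ Q hQJ).2.trans_lt hlt) (lt_irrefl _)]
      exact h1.trans (by gcongr)

/-- A bounded oscillation operator is dominated by a sparse sum. -/
theorem IsBallBasis.exists_domination [Nonempty X] [IsFiniteMeasure μ]
    (h : IsBallBasis μ ℬ hull K) (hD : Besicovitch ℬ D) (hK : 1 ≤ K)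
    {T : (X → ℝ) → X → ℝ} (hT : IsSubadditive μ T) {L : ℝ≥0∞} (hL : weakNorm μ T ≤ L)
    (hL1 : locConst μ ℬ hull T ≤ L) (hL2 : connConst μ ℬ hull T < L) (hLt : L ≠ ∞)
    {r : ℕ} (hr : (2 * K ^ 3 : ℝ≥0∞) ^ 2 ≤ 2 ^ r) {ε β : ℝ≥0∞}
    (hε : 4 * (r + 1 : ℕ) * K ^ 4 * (2 * K ^ 3) * ε ≤ 1) (hβt : β ≠ ∞)
    (hβ : 4 * (D + 1) * K ^ 3 ≤ β * ε) {f : X → ℝ} (hf : Integrable f μ) :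
    ∃ 𝒮 ⊆ ℬ, 𝒮.Countable ∧
      (∃ F : Set X → Set X, SparseSets μ (fun A : 𝒮 => hull (hull (hull A))) (fun A : 𝒮 => F A)
        (2 * K ^ 3)⁻¹ (r + 1 : ℕ)) ∧
      ∀ᵐ x ∂μ, ‖T f x‖ₑ ≤ (3 + 2 * (K ^ 2 + K)) * (L * β) *
        ∑' A : 𝒮, (hull (hull (hull (A : Set X)))).indicator
          (fun _ => avg μ f (hull (hull (hull (A : Set X))))) x := by
  have hh3 : ∀ Q ∈ ℬ, hull (hull (hull Q)) ∈ ℬ := fun Q hQ =>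
    h.hull_mem _ (h.hull_mem _ (h.hull_mem Q hQ))
  have hm3 : ∀ Q ∈ ℬ, MeasurableSet (hull (hull (hull Q))) := fun Q hQ =>
    h.measurableSet _ (hh3 Q hQ)
  have hsub2 : ∀ A ∈ ℬ, A ⊆ hull (hull A) := fun A hA =>
    (h.subset_hull_self hA).trans (h.subset_hull_self (h.hull_mem A hA))
  have hsub3 : ∀ A ∈ ℬ, hull (hull A) ⊆ hull (hull (hull A)) := fun A hA =>
    h.subset_hull_self (h.hull_mem _ (h.hull_mem A hA))
  have havg : ∀ Q ∈ ℬ, avg μ f (hull (hull (hull Q))) ≠ ∞ := fun Q hQ =>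
    ENNReal.div_ne_top (ne_top_of_le_ne_top hf.2.ne (setLIntegral_le_lintegral _ _))
      (h.measure_pos _ (hh3 Q hQ)).ne'
  -- The bad set for `f` restricted to the threefold hull of `Q`, at the height `β` times the
  -- average there. The target `m = ε μ(Q) / 4` leaves room for two exceptional sets and the factor
  -- two; `K ^ 3` compares the hull with `Q`.
  have hex : ∀ Q ∈ ℬ, ∃ E, MeasurableSet E ∧ 2 * μ E ≤ ε * μ Q ∧
      ∀ x ∉ E, ‖T ((hull (hull (hull Q))).indicator f) x‖ₑ ≤
        L * (β * avg μ f (hull (hull (hull Q)))) ∧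
        ∀ B ∈ ℬ, x ∈ B → avg μ ((hull (hull (hull Q))).indicator f) B ≤
          β * avg μ f (hull (hull (hull Q))) := by
    intro Q hQ
    obtain ⟨E, hEm, hE, hEg⟩ := h.exists_bad_set hD hL hLt
      (hf.indicator (hm3 Q hQ)) (b := β * avg μ f (hull (hull (hull Q)))) (m := ε * μ Q / 4)
      (ENNReal.mul_ne_top hβt (havg Q hQ)) (by
        rw [lintegral_enorm_indicator (hm3 Q hQ)]
        have e : ∫⁻ x in hull (hull (hull Q)), ‖f x‖ₑ ∂μ =
            avg μ f (hull (hull (hull Q))) * μ (hull (hull (hull Q))) := by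
          unfold avg
          rw [ENNReal.div_mul_cancel (h.measure_pos _ (hh3 Q hQ)).ne'
            (h.measure_lt_top _ (hh3 Q hQ)).ne]
        rw [e]
        calc (D + 1) * (avg μ f (hull (hull (hull Q))) * μ (hull (hull (hull Q))))
            ≤ (D + 1) * (avg μ f (hull (hull (hull Q))) * (K ^ 3 * μ Q)) := by
              gcongr; exact h.measure_hull_hull_hull_le hQ
          _ = (4 * (D + 1) * K ^ 3) * (avg μ f (hull (hull (hull Q))) * μ Q / 4) := by
              rw [ENNReal.div_eq_inv_mul]
              have : (4 : ℝ≥0∞) * 4⁻¹ = 1 := ENNReal.mul_inv_cancel (by norm_num) (by norm_num)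
              calc _ = 1 * ((D + 1) * (avg μ f (hull (hull (hull Q))) * (K ^ 3 * μ Q))) :=
                    (one_mul _).symm
                _ = _ := by rw [← this]; ring
          _ ≤ (β * ε) * (avg μ f (hull (hull (hull Q))) * μ Q / 4) := by gcongr
          _ = _ := by simp only [ENNReal.div_eq_inv_mul]; ring)
    refine ⟨E, hEm, ?_, hEg⟩
    calc 2 * μ E ≤ 2 * (2 * (ε * μ Q / 4)) := by gcongr
      _ = 4 * (ε * μ Q / 4) := by ring
      _ = _ := ENNReal.mul_div_cancel (by norm_num) (by norm_num)
  choose! E hEm hEμ hEg using hex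
  obtain ⟨𝒮, h𝒮, hu, hc, hcov, F, hF, hFov⟩ := h.exists_sparse_family hD hK hr hε hEm hEμ
    (Cand := fun Q B => B ∈ ℬ ∧ (B ∩ hull (hull Q)).Nonempty ∧ μ B ≤ 2 * μ (B ∩ E Q) ∧
      ∀ R ∈ ℬ, B ⊂ R → ¬ μ R ≤ 2 * μ (R ∩ E Q)) fun Q hQ B hB => ⟨hB.1, hB.2.1, hB.2.2.1⟩
  have := hc.to_subtype
  have hov : ∀ x, ∑' A : 𝒮, (F A).indicator (fun _ => (1 : ℝ≥0∞)) x ≤ (r + 1 : ℕ) := fun x =>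
    tsum_indicator_le x (hFov x)
  refine ⟨𝒮, h𝒮, hc, ⟨F, fun A => ?_, fun A => (hF A A.2).2.1, fun A => ?_, fun x => ?_⟩, ?_⟩
  · exact (hF A A.2).1.trans ((hsub2 A (h𝒮 A.2)).trans (hsub3 A (h𝒮 A.2)))
  · have hK0 : (2 * K ^ 3 : ℝ≥0) ≠ 0 := by positivity
    rw [ENNReal.coe_inv hK0]
    refine ENNReal.inv_mul_le_iff (by exact_mod_cast hK0) ENNReal.coe_ne_top |>.2 ?_
    push_cast
    calc μ (hull (hull (hull (A : Set X)))) ≤ K ^ 3 * μ A :=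
          h.measure_hull_hull_hull_le (h𝒮 A.2)
      _ ≤ K ^ 3 * (2 * μ (F A)) := by gcongr; exact (hF A A.2).2.2
      _ = _ := by ring
  · exact_mod_cast hov x
  have hsumF : ∑' A : 𝒮, μ (F A) ≤ (r + 1 : ℕ) * μ univ := by
    calc ∑' A : 𝒮, μ (F A) = ∑' A : 𝒮, ∫⁻ x, (F A).indicator (fun _ => (1 : ℝ≥0∞)) x ∂μ :=
          tsum_congr fun A => (lintegral_indicator_one (hF A A.2).2.1).symm
      _ = ∫⁻ x, ∑' A : 𝒮, (F A).indicator (fun _ => (1 : ℝ≥0∞)) x ∂μ :=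
          (lintegral_tsum (f := fun (A : 𝒮) x => (F A).indicator (fun _ => (1 : ℝ≥0∞)) x) fun A =>
            (measurable_const.indicator (hF A A.2).2.1).aemeasurable).symm
      _ ≤ ∫⁻ _, (r + 1 : ℕ) ∂μ := lintegral_mono hov
      _ = _ := by simp
  -- By the Borel–Cantelli lemma almost every point lies in finitely many twofold hulls, so the
  -- descent below stops at such a point.
  have hBC : ∀ᵐ x ∂μ, {A : 𝒮 | x ∈ hull (hull (A : Set X))}.Finite := by
    refine ae_finite_setOfPred_mem (ne_top_of_le_ne_top ?_ (?_ :
      _ ≤ (K : ℝ≥0∞) ^ 2 * 2 * ((r + 1 : ℕ) * μ univ)))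
    · finiteness
    · calc ∑' A : 𝒮, μ (hull (hull (A : Set X))) ≤ ∑' A : 𝒮, K ^ 2 * 2 * μ (F A) := by
            refine ENNReal.tsum_le_tsum fun A => ?_
            rw [mul_assoc]
            exact (h.measure_hull_hull_le (h𝒮 A.2)).trans
              (mul_le_mul' le_rfl (hF A A.2).2.2)
        _ = K ^ 2 * 2 * ∑' A : 𝒮, μ (F A) := ENNReal.tsum_mul_left
        _ ≤ _ := by gcongr
  have hdens : ∀ᵐ x ∂μ, ∀ Q : 𝒮, x ∈ E Q → ∃ B ∈ ℬ, x ∈ B ∧ μ B ≤ 2 * μ (B ∩ E Q) :=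
    ae_all_iff.2 fun Q => h.ae_exists_dense hD (hEm Q (h𝒮 Q.2))
  filter_upwards [hBC, hdens] with x hfin hx
  set c : ℝ≥0∞ := (3 + 2 * (K ^ 2 + K)) with hcdef
  have hc1 : 1 ≤ c := le_trans (by norm_num) (le_self_add : (3 : ℝ≥0∞) ≤ c)
  -- One step of the descent. At a good point the average over the hull of `Q` suffices. At a bad
  -- point the maximal mostly bad ball through `x` is a candidate, hence lies in the twofold hull of
  -- some smaller selected `A`; what `f` does outside the threefold hull of `A` is bounded, and the
  -- rest is passed on to `A`.
  have hstep : ∀ Q ∈ {A : 𝒮 | x ∈ hull (hull (A : Set X))},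
      ‖T ((hull (hull (hull (Q : Set X)))).indicator f) x‖ₑ ≤
        c * (L * β) * avg μ f (hull (hull (hull (Q : Set X)))) ∨
      ∃ A ∈ {A : 𝒮 | x ∈ hull (hull (A : Set X))}, μ (A : Set X) < μ (Q : Set X) ∧
        ‖T ((hull (hull (hull (Q : Set X)))).indicator f) x‖ₑ ≤
          c * (L * β) * avg μ f (hull (hull (hull (Q : Set X)))) +
          ‖T ((hull (hull (hull (A : Set X)))).indicator f) x‖ₑ := by
    intro Q hQ
    have hQℬ := h𝒮 Q.2
    by_cases hxE : x ∈ E Q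
    · right
      obtain ⟨B₀, hB₀, hxB₀, hB₀E⟩ := hx Q hxE
      obtain ⟨B, hB, hB₀B, hBE, hmax⟩ := h.exists_maximal hD
        (fun R => μ R ≤ 2 * μ (R ∩ E Q)) hB₀ hB₀E
      obtain ⟨A, hA, hBA, hAQ, hlt⟩ := hcov Q Q.2 B ⟨hB, ⟨x, hB₀B hxB₀, hQ⟩, hBE, hmax⟩
      refine ⟨⟨A, hA⟩, hBA (hB₀B hxB₀), hlt, ?_⟩
      have hAℬ := h𝒮 hA
      set g := (hull (hull (hull (Q : Set X)))).indicator f with hg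
      have hgi : Integrable g μ := hf.indicator (hm3 Q hQℬ)
      have hsplit : g = (hull (hull (hull A)))ᶜ.indicator g +
          (hull (hull (hull A))).indicator f := by
        have e : (hull (hull (hull A))).indicator f = (hull (hull (hull A))).indicator g := by
          rw [hg, indicator_indicator, inter_eq_left.2 hAQ]
        rw [e, indicator_compl_add_self]
      have h1 := h.enorm_le_of_maximal hT hL hL1 hL2 hLt hgi
        (ENNReal.mul_ne_top hβt (havg Q hQℬ)) (hEg Q hQℬ) hB
        (h.hull_mem _ (h.hull_mem A hAℬ)) hBA hmax (hB₀B hxB₀)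
      calc ‖T g x‖ₑ ≤ ‖T ((hull (hull (hull A)))ᶜ.indicator g) x‖ₑ +
            ‖T ((hull (hull (hull A))).indicator f) x‖ₑ := by
            conv_lhs => rw [hsplit]
            exact hT.enorm_add_le (hgi.indicator (hm3 A hAℬ).compl)
              (hf.indicator (hm3 A hAℬ)) x
        _ ≤ c * (L * (β * avg μ f (hull (hull (hull (Q : Set X)))))) +
            ‖T ((hull (hull (hull A))).indicator f) x‖ₑ := by gcongr
        _ = _ := by ring
    · left
      calc _ ≤ L * (β * avg μ f (hull (hull (hull (Q : Set X))))) := (hEg Q hQℬ x hxE).1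
        _ = 1 * (L * β) * avg μ f (hull (hull (hull (Q : Set X)))) := by ring
        _ ≤ _ := by gcongr
  -- The descent starts at the whole space, where the restricted function is `f` itself.
  have hu1 : hull univ = univ := eq_univ_of_univ_subset (h.subset_hull_self (h𝒮 hu))
  obtain ⟨J, hJ, hJs⟩ := exists_finset_of_descent (m := fun A : 𝒮 => μ (A : Set X)) hfin
    (a := fun A : 𝒮 => c * (L * β) * avg μ f (hull (hull (hull (A : Set X)))))
    (t := fun A : 𝒮 => ‖T ((hull (hull (hull (A : Set X)))).indicator f) x‖ₑ) hstep ⟨univ, hu⟩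
    (by simp [hu1])
  simp only [hu1, indicator_univ] at hJs
  refine hJs.trans ?_
  rw [← Finset.mul_sum]
  gcongr
  refine le_trans (Finset.sum_le_sum fun A hA => ?_) (ENNReal.sum_le_tsum J)
  rw [indicator_of_mem (hsub3 A (h𝒮 A.2) (hJ A hA).1)]

/-- The constant in the bound for bounded oscillation operators. -/
noncomputable def boConst (p : ℝ) (K : ℝ≥0) (D r : ℕ) (β : ℝ≥0) : ℝ≥0∞ :=
  (3 + 2 * (K ^ 2 + K)) * β * ((2 * K ^ 3) * (r + 1 : ℕ) * opConst p *
    (D : ℝ≥0∞) ^ max (1 / (p - 1)) (p - 1))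

theorem boConst_ne_top {p : ℝ} (hp : 1 < p) (K : ℝ≥0) (D r : ℕ) (β : ℝ≥0) :
    boConst p K D r β ≠ ∞ := by
  have h1 := opConst_ne_top hp
  have h2 : (D : ℝ≥0∞) ^ max (1 / (p - 1)) (p - 1) ≠ ∞ :=
    ENNReal.rpow_ne_top_of_nonneg (le_max_of_le_right (by linarith)) (ENNReal.natCast_ne_top D)
  unfold boConst
  finiteness

/-- The members of `L^p(w)` are integrable if the measure is that of a ball. -/
theorem IsApWeight.integrable {p : ℝ} (hp : 1 < p) {w : X → ℝ≥0∞} (hw : IsApWeight μ ℬ p w)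
    (hu : univ ∈ ℬ) (hu0 : μ univ ≠ 0) (hut : μ univ ≠ ∞) {f : X → ℝ}
    (hf : MemLp f (ENNReal.ofReal p) (μ.withDensity w)) : Integrable f μ := by
  obtain ⟨w', v', hpair, hae⟩ := hw.1.exists_isDualPair p
  rw [← withDensity_congr_ae hae] at hf
  obtain ⟨hfm, F, hFm, hFf, -, hFt⟩ := exists_measurable_enorm hp hpair hf
  -- The `A_p` condition on the ball `X` makes the dual weight integrable, and Hölder's inequality
  -- does the rest.
  have hvt : ∫⁻ x, v' x ∂μ ≠ ∞ := by
    intro hv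
    have h1 := (mean_mul_le_apChar hpair hae hu).trans_lt hw.2
    have h2 : mean μ v' univ = ∞ := by
      unfold mean
      rw [Measure.restrict_univ, hv, ENNReal.top_div_of_ne_top hut]
    have h3 : mean μ w' univ ≠ 0 := by
      unfold mean
      rw [Measure.restrict_univ]
      refine (ENNReal.div_pos ?_ hut).ne'
      rw [Ne, lintegral_eq_zero_iff hpair.measurable]
      intro h0
      have hF : ∀ᵐ x ∂μ, False := by
        filter_upwards [h0] with x hx
        exact hpair.pos x hx
      rw [ae_iff] at hF
      exact hu0 (by simpa using hF)
    rw [h2, ENNReal.top_rpow_of_pos (by linarith), ENNReal.mul_top h3] at h1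
    exact lt_irrefl _ h1
  refine ⟨hfm, ?_⟩
  have := setLIntegral_ne_top_of_dual hp hpair hvt hFm hFt
  rw [lintegral_congr_ae hFf] at this
  exact this.lt_top

/-- The dominating sum runs over threefold hulls, which contain sets of relative measure at least
`(2 K^3)⁻¹` with overlap at most `r + 1`; so `meanSum_le` applies to it. -/
theorem IsBallBasis.strongNorm_le_of_lt [Nonempty X] [IsFiniteMeasure μ]
    (h : IsBallBasis μ ℬ hull K) (hD : Besicovitch ℬ D) (hK : 1 ≤ K)
    {T : (X → ℝ) → X → ℝ} (hT : IsSubadditive μ T) {L : ℝ≥0∞} (hL : weakNorm μ T ≤ L)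
    (hL1 : locConst μ ℬ hull T ≤ L) (hL2 : connConst μ ℬ hull T < L) (hLt : L ≠ ∞)
    {r : ℕ} (hr : (2 * K ^ 3 : ℝ≥0∞) ^ 2 ≤ 2 ^ r) {ε : ℝ≥0∞} {β : ℝ≥0}
    (hε : 4 * (r + 1 : ℕ) * K ^ 4 * (2 * K ^ 3) * ε ≤ 1)
    (hβ : 4 * (D + 1) * K ^ 3 ≤ β * ε) {p : ℝ} (hp : 1 < p) {w : X → ℝ≥0∞}
    (hw : IsApWeight μ ℬ p w) :
    strongNorm p (μ.withDensity w) (fun f x => ‖T f x‖ₑ) ≤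
      boConst p K D r β * apChar μ ℬ p w ^ max 1 (1 / (p - 1)) * L := by
  have hp0 : 0 < p := by linarith
  have hu := h.univ_mem hD
  refine iSup₂_le fun f hf => ENNReal.div_le_of_le_mul ?_
  have hfi := hw.integrable hp hu (h.measure_pos _ hu).ne' (measure_ne_top μ _) hf
  obtain ⟨w', v', hpair, hae⟩ := hw.1.exists_isDualPair p
  rw [← withDensity_congr_ae hae] at hf ⊢
  obtain ⟨-, F, hFm, hFf, hFn, hFt⟩ := exists_measurable_enorm hp hpair hf
  obtain ⟨𝒮, h𝒮, hc, ⟨E, hE⟩, hdom⟩ := h.exists_domination hD hK hT hL hL1 hL2 hLt hr hε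
    ENNReal.coe_ne_top hβ hfi
  have := hc.to_subtype
  have hmem : ∀ A : 𝒮, hull (hull (hull (A : Set X))) ∈ ℬ := fun A =>
    h.hull_mem _ (h.hull_mem _ (h.hull_mem A (h𝒮 A.2)))
  have hK0 : (0 : ℝ≥0) < 2 * K ^ 3 := by positivity
  set H := meanSum μ (fun A : 𝒮 => hull (hull (hull (A : Set X)))) F with hH
  have hHm : Measurable H :=
    Measurable.tsum fun A => measurable_const.indicator (h.measurableSet _ (hmem A))
  set c : ℝ≥0∞ := (3 + 2 * (K ^ 2 + K)) * (L * β) with hcdef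
  have hmain := meanSum_le (B := fun A : 𝒮 => hull (hull (hull (A : Set X))))
    (fun A => h.measurableSet _ (hmem A)) (fun A => h.measure_pos _ (hmem A))
    (fun A => h.measure_lt_top _ (hmem A)) hD hmem (E := fun A : 𝒮 => E A.1)
    (inv_pos.2 hK0) hE hp hpair hw.2.ne (fun A => mean_mul_le_apChar hpair hae (hmem A)) hFm hFt
  have havg : ∀ A, avg μ f A = mean μ F A := fun A => (mean_congr_ae hFf A).symm
  rw [hFn]
  calc outerLpNorm p (μ.withDensity w') (fun x => ‖T f x‖ₑ)
      ≤ (∫⁻ x, w' x * (c * H x) ^ p ∂μ) ^ (1 / p) := by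
        refine outerLpNorm_le hp hpair.measurable (hHm.const_mul c) ?_
        filter_upwards [hdom] with x hx
        refine hx.trans (le_of_eq ?_)
        rw [hH, meanSum]
        simp only [havg]
    _ = c * (∫⁻ x, w' x * H x ^ p ∂μ) ^ (1 / p) := by
        have h1 : ∀ x, w' x * (c * H x) ^ p = c ^ p * (w' x * H x ^ p) := fun x => by
          rw [ENNReal.mul_rpow_of_nonneg _ _ hp0.le]; ring
        have h2 : Measurable fun x => w' x * H x ^ p := hpair.measurable.mul (hHm.pow_const _)
        simp_rw [h1]
        rw [lintegral_const_mul _ h2, ENNReal.mul_rpow_of_nonneg _ _ (by positivity),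
          ← ENNReal.rpow_mul, mul_one_div_cancel hp0.ne', ENNReal.rpow_one]
    _ ≤ c * (normBound p (2 * K ^ 3)⁻¹ (r + 1 : ℕ) D (apChar μ ℬ p w) *
        (∫⁻ x, w' x * F x ^ p ∂μ) ^ (1 / p)) := by gcongr
    _ = _ := by
        rw [normBound, hcdef, boConst, ENNReal.coe_inv hK0.ne', inv_inv]
        push_cast
        ring

/-- Lets `L` decrease to `s`, which removes the strict inequality demanded by the infimum in
`connConst`. -/
theorem le_mul_of_forall_lt {a M s : ℝ≥0∞} (hM : M ≠ ∞) (hs : s ≠ ∞)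
    (h : ∀ L, s < L → L ≠ ∞ → a ≤ M * L) : a ≤ M * s := by
  by_cases hM0 : M = 0
  · have := h (s + 1) (ENNReal.lt_add_right hs one_ne_zero) (by finiteness)
    rw [hM0, zero_mul] at this ⊢
    exact this
  · rw [mul_comm, ← ENNReal.div_le_iff hM0 hM]
    refine le_of_forall_gt_imp_ge_of_dense fun L hL => ?_
    by_cases hLt : L = ∞
    · rw [hLt]; exact le_top
    · rw [ENNReal.div_le_iff hM0 hM, mul_comm]
      exact h L hL hLt

theorem IsBallBasis.mono (h : IsBallBasis μ ℬ hull K) {K' : ℝ≥0} (hK : K ≤ K') :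
    IsBallBasis μ ℬ hull K' :=
  { h with measure_hull_le := fun B hB => (h.measure_hull_le B hB).trans (by gcongr) }

theorem exists_boConst {p : ℝ} (hp : 1 < p) (K : ℝ≥0) (D : ℕ) :
    ∃ C : ℝ≥0, ∀ (X : Type*) [MeasurableSpace X] (μ : Measure X)
      (ℬ : Set (Set X)) (hull : Set X → Set X),
      IsBallBasis μ ℬ hull K → Besicovitch ℬ D →
      ∀ T : (X → ℝ) → X → ℝ, IsBO μ ℬ hull T → weakNorm μ T < ∞ →
      ∀ w : X → ℝ≥0∞, IsApWeight μ ℬ p w →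
        (∀ f : X → ℝ, MemLp f (ENNReal.ofReal p) (μ.withDensity w) → Integrable f μ) ∧
        strongNorm p (μ.withDensity w) (fun f x => ‖T f x‖ₑ) ≤
          C * (locConst μ ℬ hull T + connConst μ ℬ hull T + weakNorm μ T) *
            apChar μ ℬ p w ^ max 1 (1 / (p - 1)) := by
  -- Enlarging `K` to at least one is harmless and also covers bases without balls.
  obtain ⟨K', hKK', hK1⟩ : ∃ K' : ℝ≥0, K ≤ K' ∧ 1 ≤ K' :=
    ⟨max K 1, le_max_left _ _, le_max_right _ _⟩
  -- The overlap `r` depends on `K'` alone. Then `ε = t⁻¹` is small enough for the half-measure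
  -- estimate, and `β` is the least height compatible with this `ε`.
  obtain ⟨r, hr⟩ := pow_unbounded_of_one_lt ((2 * K' ^ 3) ^ 2) (one_lt_two : (1 : ℝ≥0) < 2)
  set t : ℝ≥0 := 4 * (r + 1 : ℕ) * K' ^ 4 * (2 * K' ^ 3) with ht
  have ht0 : t ≠ 0 := by positivity
  set β : ℝ≥0 := 4 * (D + 1) * K' ^ 3 * t with hβ
  refine ⟨(boConst p K' D r β).toNNReal, ?_⟩
  intro X _ μ ℬ hull h hD T hT hN w hw
  rw [ENNReal.coe_toNNReal (boConst_ne_top hp K' D r β)]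
  -- On an empty space there is no ball and `univ` need not belong to the basis; there the measure
  -- is zero.
  cases isEmpty_or_nonempty X with
  | inl hX =>
    have hμ : μ = 0 := Measure.eq_zero_of_isEmpty μ
    refine ⟨fun f _ => by rw [hμ]; exact integrable_zero_measure, ?_⟩
    refine le_trans (iSup₂_le fun f _ => ENNReal.div_le_of_le_mul ?_) zero_le
    simp [outerLpNorm, hμ, show 0 < p by linarith]
  | inr hX =>
  have hu := h.univ_mem hD
  have hfin : IsFiniteMeasure μ := ⟨h.measure_lt_top _ hu⟩
  refine ⟨fun f hf => hw.integrable hp hu (h.measure_pos _ hu).ne' (measure_ne_top μ _) hf, ?_⟩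
  have hs : locConst μ ℬ hull T + connConst μ ℬ hull T + weakNorm μ T ≠ ∞ :=
    ENNReal.add_ne_top.2 ⟨ENNReal.add_ne_top.2 ⟨hT.localization.ne, hT.connectivity.ne⟩, hN.ne⟩
  have hQ : apChar μ ℬ p w ^ max 1 (1 / (p - 1)) ≠ ∞ :=
    ENNReal.rpow_ne_top_of_nonneg (le_max_of_le_left zero_le_one) hw.2.ne
  refine (le_mul_of_forall_lt (ENNReal.mul_ne_top (boConst_ne_top hp K' D r β) hQ) hs
    fun L hL hLt => ?_).trans (le_of_eq (by ring))
  refine (h.mono hKK').strongNorm_le_of_lt hD hK1 hT.subadditive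
    (le_add_self.trans hL.le) ((le_self_add.trans le_self_add).trans hL.le)
    ((le_add_self.trans le_self_add).trans_lt hL) hLt (ε := (t : ℝ≥0∞)⁻¹) ?_ ?_ ?_ hp hw
  · exact_mod_cast hr.le
  · have : (4 * (r + 1 : ℕ) * K' ^ 4 * (2 * K' ^ 3) : ℝ≥0∞) = t := by rw [ht]; push_cast; rfl
    rw [this]
    exact ENNReal.mul_inv_le_one _
  · rw [hβ]
    push_cast
    rw [mul_assoc _ (t : ℝ≥0∞), ENNReal.mul_inv_cancel (by exact_mod_cast ht0)
      ENNReal.coe_ne_top, mul_one]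

end Domination

end BallOsc

theorem mainTheorem5 (p : ℝ) (hp : 1 < p) :
    (∃ c : ℝ≥0, ∀ (X : Type u) [MeasurableSpace X] (μ : Measure X) (ℬ : Set (Set X)) (D : ℕ),
      (∀ B ∈ ℬ, MeasurableSet B ∧ 0 < μ B ∧ μ B < ∞) → Besicovitch ℬ D →
      ∀ (γ : ℝ≥0), 0 < γ → γ < 1 → ∀ 𝒮 : Set (Set X), IsSparse μ ℬ γ 𝒮 →
      ∀ w : X → ℝ≥0∞, IsApWeight μ ℬ p w →
        strongNorm p (μ.withDensity w) (sparseOp μ 𝒮) ≤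
          c * (γ : ℝ≥0∞)⁻¹ * (D : ℝ≥0∞) ^ max (1 / (p - 1)) (p - 1) *
            apChar μ ℬ p w ^ max 1 (1 / (p - 1))) ∧
    (∀ (K : ℝ≥0) (D : ℕ), ∃ C : ℝ≥0, ∀ (X : Type u) [MeasurableSpace X] (μ : Measure X)
      (ℬ : Set (Set X)) (hull : Set X → Set X),
      IsBallBasis μ ℬ hull K → Besicovitch ℬ D →
      ∀ T : (X → ℝ) → X → ℝ, IsBO μ ℬ hull T → weakNorm μ T < ∞ →
      ∀ w : X → ℝ≥0∞, IsApWeight μ ℬ p w →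
        (∀ f : X → ℝ, MemLp f (ENNReal.ofReal p) (μ.withDensity w) → Integrable f μ) ∧
        strongNorm p (μ.withDensity w) (fun f x => ‖T f x‖ₑ) ≤
          C * (locConst μ ℬ hull T + connConst μ ℬ hull T + weakNorm μ T) *
            apChar μ ℬ p w ^ max 1 (1 / (p - 1))) := by
  refine ⟨⟨(opConst p).toNNReal, ?_⟩, fun K D => exists_boConst hp K D⟩
  intro X _ μ ℬ D hℬ hD γ hγ _ 𝒮 h𝒮 w hw
  refine (strongNorm_sparseOp_le hℬ hD hγ h𝒮 hp hw).trans (le_of_eq ?_)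
  rw [normBound, ENNReal.coe_toNNReal (opConst_ne_top hp)]
  push_cast
  ring
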